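/- Let $M$ be a smooth manifold with a foliation $\mathcal F$ of codimension $2q$, given by an open cover $\{U_i\}$ of $M$, submersions $f_i:U_i\to T_0$ with connected fibres onto open subsets of a $2q$-dimensional manifold $T_0$, and local diffeomorphisms $\gamma_{ij}$ of $T_0$ with $f_j=\gamma_{ij}\circ f_i$ on $U_i\cap U_j$. A smooth form $\alpha$ on $M$ is basic if $i_X\alpha=i_Xd\alpha=0$ for all $X$ tangent to the leaves; $\Omega^\bullet(M/\mathcal F)$ denotes the graded real vector space of basic forms. Suppose that $\mathcal F$ is transversely symplectic, with basic symplectic form $\omega$: a closed basic $2$-form whose kernel at every point is the tangent space of the leaf. Let $G$ be the pairing induced by the inverse matrix of $\omega$ on the exterior powers of the conormal bundle, that is, in a basis of a fibre of the normal bundle, $$G(\alpha,\beta)=\tfrac1{k!}\sum \omega^{i_1j_1}\cdots\omega^{i_kj_k}\,\alpha_{i_1\dots i_k}\,\beta_{j_1\dots j_k},$$ let $*_s$ be the fibrewise symplectic star operator, defined by $\alpha\wedge *_s\beta=G(\alpha,\beta)\,\omega^q/q!$ for $k$-forms $\alpha,\beta$ of the normal bundle, and let $d^\Lambda\alpha=(-1)^{k+1}*_s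 d\,*_s\alpha$ for $\alpha\in\Omega^k(M/\mathcal F)$. Then $d$ and $d^\Lambda$ are linear endomorphisms of $\Omega^\bullet(M/\mathcal F)$ of degrees $1$ and $-1$ with $d^2=(d^\Lambda)^2=dd^\Lambda+d^\Lambda d=0$, so that $$\mathrm{Doub}^{a,b}=\Omega^{a-b}(M/\mathcal F)\qquad(a,b\in\mathbb Z),\qquad d:\mathrm{Doub}^{a,b}\to\mathrm{Doub}^{a+1,b},\quad d^\Lambda:\mathrm{Doub}^{a,b}\to\mathrm{Doub}^{a,b+1},$$ is a double complex, and both of its spectral sequences, those of the filtrations ${}'F^p\mathrm{Tot}^k=\bigoplus_{a+b=k,\,a\ge p}\mathrm{Doub}^{a,b}$ and ${}''F^p\mathrm{Tot}^k=\bigoplus_{a+b=k,\,b\ge p}\mathrm{Doub}^{a,b}$ of the total complex with differential $d+d^\Lambda$, degenerate at the first page: all differentials $d_r$ with $r\ge1$ vanish. -/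

import Mathlib

open scoped Manifold ContDiff Matrix DirectSum Nat

noncomputable section

/-! ### Spectral sequences of filtered complexes and of double complexes -/

/-- A complex of modules, written as one module `T` with an endomorphism `D`, `D ∘ D = 0`, together
with a decreasing filtration: `F p k` is the `p`-th step of the filtration in degree `k`. -/
structure FiltComplex (R : Type*) [CommRing R] (T : Type*) [AddCommGroup T] [Module R T] where
  D : T →ₗ[R] T
  F : ℤ → ℤ → Submodule R T
  D_D : ∀ x, D (D x) = 0
  D_mem : ∀ p k x, x ∈ F p k → D x ∈ F p (k + 1)
  F_anti : ∀ p k, F (p + 1) k ≤ F p k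

namespace FiltComplex

variable {R : Type*} [CommRing R] {T : Type*} [AddCommGroup T] [Module R T] (C : FiltComplex R T)

/-- `Z_r` in filtration degree `p` and total degree `k`:
elements of `F^p` in degree `k` whose differential lies in `F^{p+r}`. -/
def cyc (r p k : ℤ) : Submodule R T := C.F p k ⊓ (C.F (p + r) (k + 1)).comap C.D

/-- The submodule `Z_{r-1}^{p+1} + D (Z_{r-1}^{p-r+1})` of `Z_r^p`, in total degree `k`. -/
def bdry (r p k : ℤ) : Submodule R T :=
  C.cyc (r - 1) (p + 1) k ⊔ (C.cyc (r - 1) (p - r + 1) (k - 1)).map C.D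

/-- The entry of the page `E_r` in filtration degree `p` and total degree `k`,
that is `E_r^{p, k-p}`. -/
abbrev Page (r p k : ℤ) : Type _ := C.cyc r p k ⧸ (C.bdry r p k).submoduleOf (C.cyc r p k)

lemma D_mem_cyc (r p k : ℤ) (x : T) (hx : x ∈ C.cyc r p k) :
    C.D x ∈ C.cyc r (p + r) (k + 1) := by
  refine ⟨hx.2, ?_⟩
  simp [C.D_D]

/-- The differential `d_r : E_r^{p, k-p} → E_r^{p+r, k-p-r+1}`, induced by `D`. -/
def pageD (r p k : ℤ) : C.Page r p k →ₗ[R] C.Page r (p + r) (k + 1) :=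
  Submodule.mapQ _ _ (C.D.restrict (C.D_mem_cyc r p k)) (by
    rintro ⟨x, hx⟩ hb
    simp only [Submodule.submoduleOf, Submodule.mem_comap, Submodule.subtype_apply,
      LinearMap.coe_restrict_apply] at hb ⊢
    obtain ⟨y, hy, z, hz, rfl⟩ := Submodule.mem_sup.1 hb
    obtain ⟨w, -, rfl⟩ := Submodule.mem_map.1 hz
    refine Submodule.mem_sup_right (Submodule.mem_map.2 ⟨y, ?_, ?_⟩)
    · have h1 : p + r - r + 1 = p + 1 := by ring
      have h2 : k + 1 - 1 = k := by ring
      rw [h1, h2]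
      exact hy
    · simp [C.D_D])

/-- The spectral sequence degenerates at the page `s`: all differentials `d_r`, `r ≥ s`, vanish. -/
def DegeneratesAt (s : ℤ) : Prop := ∀ r, s ≤ r → ∀ p k, C.pageD r p k = 0

end FiltComplex

/-- A double complex of modules: `d'` has bidegree `(1,0)`, `d''` has bidegree `(0,1)`,
and `d' d'' + d'' d' = 0`. -/
structure DoubleCpx (R : Type*) [CommRing R] (K : ℤ → ℤ → Type*)
    [∀ p q, AddCommGroup (K p q)] [∀ p q, Module R (K p q)] where
  d₁ : ∀ p q, K p q →ₗ[R] K (p + 1) q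
  d₂ : ∀ p q, K p q →ₗ[R] K p (q + 1)
  d₁_d₁ : ∀ p q x, d₁ (p + 1) q (d₁ p q x) = 0
  d₂_d₂ : ∀ p q x, d₂ p (q + 1) (d₂ p q x) = 0
  anti : ∀ p q x, d₁ p (q + 1) (d₂ p q x) + d₂ (p + 1) q (d₁ p q x) = 0

namespace DoubleCpx

variable {R : Type*} [CommRing R] {K : ℤ → ℤ → Type*}
  [∀ p q, AddCommGroup (K p q)] [∀ p q, Module R (K p q)] (C : DoubleCpx R K)

/-- The total complex: the direct sum of all `K p q` (its part of degree `k` is the sum of the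
`K p q` with `p + q = k`). -/
abbrev Tot (_ : DoubleCpx R K) : Type _ := ⨁ i : ℤ × ℤ, K i.1 i.2

/-- The inclusion of `K p q` into the total complex. -/
def incl (p q : ℤ) : K p q →ₗ[R] C.Tot :=
  DirectSum.lof R (ℤ × ℤ) (fun i => K i.1 i.2) (p, q)

/-- The total differential `d' + d''`. -/
def totD : C.Tot →ₗ[R] C.Tot :=
  DirectSum.toModule R (ℤ × ℤ) C.Tot fun i =>
    C.incl (i.1 + 1) i.2 ∘ₗ C.d₁ i.1 i.2 + C.incl i.1 (i.2 + 1) ∘ₗ C.d₂ i.1 i.2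

lemma totD_incl (p q : ℤ) (x : K p q) :
    C.totD (C.incl p q x) = C.incl (p + 1) q (C.d₁ p q x) + C.incl p (q + 1) (C.d₂ p q x) := by
  simp only [totD, incl]
  rw [DirectSum.toModule_lof]
  simp

lemma totD_totD (x : C.Tot) : C.totD (C.totD x) = 0 := by
  suffices h : C.totD ∘ₗ C.totD = 0 from LinearMap.congr_fun h x
  refine DirectSum.linearMap_ext R fun i => LinearMap.ext fun y => ?_
  change C.totD (C.totD (C.incl i.1 i.2 y)) = 0
  rw [totD_incl, map_add, totD_incl, totD_incl, C.d₁_d₁, C.d₂_d₂, map_zero, map_zero, zero_add,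
    add_zero, ← map_add, eq_neg_of_add_eq_zero_left (C.anti i.1 i.2 y), add_neg_cancel, map_zero]

/-- The elements of the total complex whose components vanish outside of the set `S` of indices. -/
def supp (S : Set (ℤ × ℤ)) : Submodule R C.Tot where
  carrier := {x | ∀ i, i ∉ S → x i = 0}
  add_mem' hx hy i hi := by rw [DirectSum.add_apply, hx i hi, hy i hi, add_zero]
  zero_mem' _ _ := rfl
  smul_mem' c x hx i hi := by rw [DirectSum.smul_apply, hx i hi, smul_zero]

lemma incl_mem_supp {S : Set (ℤ × ℤ)} {p q : ℤ} (h : (p, q) ∈ S) (x : K p q) :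
    C.incl p q x ∈ C.supp S := by
  intro i hi
  have hne : (p, q) ≠ i := fun e => hi (e ▸ h)
  exact DirectSum.of_eq_of_ne _ _ _ hne.symm

lemma totD_mem_supp {S S' : Set (ℤ × ℤ)}
    (h : ∀ p q, (p, q) ∈ S → (p + 1, q) ∈ S' ∧ (p, q + 1) ∈ S') (x : C.Tot)
    (hx : x ∈ C.supp S) : C.totD x ∈ C.supp S' := by
  classical
  rw [← DirectSum.sum_support_of x, map_sum]
  refine Submodule.sum_mem _ fun i hi => ?_
  have hiS : (i.1, i.2) ∈ S := by
    by_contra hc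
    exact (DFinsupp.mem_support_iff.1 hi) (hx i hc)
  change C.totD (C.incl i.1 i.2 (x i)) ∈ _
  rw [totD_incl]
  exact Submodule.add_mem _ (C.incl_mem_supp (h _ _ hiS).1 _) (C.incl_mem_supp (h _ _ hiS).2 _)

/-- The total complex with the filtration
`'F^p Tot^k = ⨁_{a + b = k, a ≥ p} K a b`; its spectral sequence is the first spectral sequence
of the double complex (`'E_1` is the `d''`-cohomology). -/
def first : FiltComplex R C.Tot where
  D := C.totD
  F p k := C.supp {i | i.1 + i.2 = k ∧ p ≤ i.1}
  D_D := C.totD_totD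
  D_mem p k x hx := by
    refine C.totD_mem_supp (fun a b hab => ?_) x hx
    simp only [Set.mem_ofPred_eq] at hab ⊢
    omega
  F_anti p k x hx i hi := hx i fun h => hi ⟨h.1, by have := h.2; omega⟩

/-- The total complex with the filtration
`''F^q Tot^k = ⨁_{a + b = k, b ≥ q} K a b`; its spectral sequence is the second spectral sequence
of the double complex (`''E_1` is the `d'`-cohomology). -/
def second : FiltComplex R C.Tot where
  D := C.totD
  F p k := C.supp {i | i.1 + i.2 = k ∧ p ≤ i.2}
  D_D := C.totD_totD
  D_mem p k x hx := by
    refine C.totD_mem_supp (fun a b hab => ?_) x hx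
    simp only [Set.mem_ofPred_eq] at hab ⊢
    omega
  F_anti p k x hx i hi := hx i fun h => hi ⟨h.1, by have := h.2; omega⟩

end DoubleCpx

/-- `V` is a `ℤ`-graded module with homogeneous components `𝒱 j`, and `δ₁`, `δ₂` are endomorphisms
of orders `a` and `b` with `δ₁² = δ₂² = δ₁ δ₂ + δ₂ δ₁ = 0`. -/
structure IsBidifferential {R : Type*} [CommRing R] {V : Type*} [AddCommGroup V] [Module R V]
    (𝒱 : ℤ → Submodule R V) (δ₁ δ₂ : V →ₗ[R] V) (a b : ℤ) : Prop where
  internal : DirectSum.IsInternal 𝒱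
  order₁ : ∀ j x, x ∈ 𝒱 j → δ₁ x ∈ 𝒱 (j + a)
  order₂ : ∀ j x, x ∈ 𝒱 j → δ₂ x ∈ 𝒱 (j + b)
  sq₁ : ∀ x, δ₁ (δ₁ x) = 0
  sq₂ : ∀ x, δ₂ (δ₂ x) = 0
  anti : ∀ x, δ₁ (δ₂ x) + δ₂ (δ₁ x) = 0

/-- The double complex `Doub^{p,q}(V) = V^{a p + b q}`, where `a`, `b` are the orders of
`δ₁`, `δ₂`. -/
def Doub {R : Type*} [CommRing R] {V : Type*} [AddCommGroup V] [Module R V]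
    {𝒱 : ℤ → Submodule R V} {δ₁ δ₂ : V →ₗ[R] V} {a b : ℤ} (h : IsBidifferential 𝒱 δ₁ δ₂ a b) :
    DoubleCpx R (fun p q => 𝒱 (a * p + b * q)) where
  d₁ p q := δ₁.restrict (fun x hx => by
    rw [show a * (p + 1) + b * q = a * p + b * q + a by ring]
    exact h.order₁ _ x hx)
  d₂ p q := δ₂.restrict (fun x hx => by
    rw [show a * p + b * (q + 1) = a * p + b * q + b by ring]
    exact h.order₂ _ x hx)
  d₁_d₁ p q x := Subtype.ext (h.sq₁ x)
  d₂_d₂ p q x := Subtype.ext (h.sq₂ x)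
  anti p q x := Subtype.ext (h.anti x)

/-! ### Symplectic linear algebra on a fibre

`V` plays the role of a tangent space of the manifold, `K` that of the tangent space of the leaf,
so that `V ⧸ K` is the fibre of the normal bundle. A `k`-covector on `V ⧸ K` is the same thing as a
`k`-covector on `V` that vanishes as soon as one of its arguments lies in `K`. -/

namespace FibreAlg

variable {V : Type*} [AddCommGroup V] [Module ℝ V]

/-- The exterior product of alternating forms: the sum over shuffles
`(a ∧ b)(v) = ∑ sign(σ) a(v_σ(1), …, v_σ(k)) b(v_σ(k+1), …, v_σ(k+l))`. -/
def wedge {k l : ℕ} (a : V [⋀^Fin k]→ₗ[ℝ] ℝ) (b : V [⋀^Fin l]→ₗ[ℝ] ℝ) :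
    V [⋀^Fin (k + l)]→ₗ[ℝ] ℝ :=
  ((LinearMap.mul' ℝ ℝ).compAlternatingMap (a.domCoprod b)).domDomCongr finSumFinEquiv

/-- The exterior power `w ∧ ⋯ ∧ w` (`m` factors) of a 2-form. -/
def wedgePow (w : V [⋀^Fin 2]→ₗ[ℝ] ℝ) : (m : ℕ) → V [⋀^Fin (2 * m)]→ₗ[ℝ] ℝ
  | 0 => AlternatingMap.constOfIsEmpty ℝ V (Fin 0) (1 : ℝ)
  | m + 1 => wedge (wedgePow w m) w

/-- The covector `a` on `V` comes from `V ⧸ K`. -/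
def Horizontal (K : Submodule ℝ V) {k : ℕ} (a : V [⋀^Fin k]→ₗ[ℝ] ℝ) : Prop :=
  ∀ v : Fin k → V, (∃ i, v i ∈ K) → a v = 0

variable [FiniteDimensional ℝ V]

/-- Vectors of `V` representing a basis of `V ⧸ K`. -/
def frame (K : Submodule ℝ V) (i : Fin (Module.finrank ℝ (V ⧸ K))) : V :=
  Function.surjInv K.mkQ_surjective (Module.finBasis ℝ (V ⧸ K) i)

/-- The matrix `(w_ij)` of the 2-form `w` with respect to the basis of `V ⧸ K`. -/
def gram (K : Submodule ℝ V) (w : V [⋀^Fin 2]→ₗ[ℝ] ℝ) :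
    Matrix (Fin (Module.finrank ℝ (V ⧸ K))) (Fin (Module.finrank ℝ (V ⧸ K))) ℝ :=
  Matrix.of fun i j => w ![frame K i, frame K j]

/-- The pairing of `k`-covectors of the symplectic vector space `V ⧸ K` that is induced by the
symplectic form `w`:
`G(a, b) = (1 / k!) ∑ w^{i_1 j_1} ⋯ w^{i_k j_k} a_{i_1 … i_k} b_{j_1 … j_k}`, where `(w^{ij})` is the
inverse of the matrix `(w_ij)`. It does not depend on the basis of `V ⧸ K`, and
`G(a_1 ∧ ⋯ ∧ a_k, b_1 ∧ ⋯ ∧ b_k) = det (G(a_i, b_j))`. -/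
def pairing (K : Submodule ℝ V) (w : V [⋀^Fin 2]→ₗ[ℝ] ℝ) {k : ℕ} (a b : V [⋀^Fin k]→ₗ[ℝ] ℝ) : ℝ :=
  ((k ! : ℝ))⁻¹ * ∑ I : Fin k → Fin (Module.finrank ℝ (V ⧸ K)),
    ∑ J : Fin k → Fin (Module.finrank ℝ (V ⧸ K)),
      (∏ s, (gram K w)⁻¹ (I s) (J s)) * a (fun s => frame K (I s)) * b (fun s => frame K (J s))

variable [TopologicalSpace V]

/-- The covector `c` of degree `l` on `V ⧸ K`, `k + l = 2 q`, satisfies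
`a ∧ c = G(a, b) w^q / q!` for all covectors `a` of degree `k` on `V ⧸ K`. -/
def IsStar (K : Submodule ℝ V) (w : V [⋀^Fin 2]→ₗ[ℝ] ℝ) (q : ℕ) {k l : ℕ} (h : k + l = 2 * q)
    (b : V [⋀^Fin k]→L[ℝ] ℝ) (c : V [⋀^Fin l]→L[ℝ] ℝ) : Prop :=
  Horizontal K c.toAlternatingMap ∧
    ∀ a : V [⋀^Fin k]→L[ℝ] ℝ, Horizontal K a.toAlternatingMap →
      (wedge a.toAlternatingMap c.toAlternatingMap).domDomCongr (finCongr h) =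
        (pairing K w a.toAlternatingMap b.toAlternatingMap * ((q ! : ℝ))⁻¹) • wedgePow w q

open Classical in
/-- The symplectic star operator on the covectors of `V ⧸ K`: `star b` is the unique covector `c`
with `a ∧ c = G(a, b) w^q / q!` for all `a`. -/
def star (K : Submodule ℝ V) (w : V [⋀^Fin 2]→ₗ[ℝ] ℝ) (q : ℕ) {k l : ℕ} (h : k + l = 2 * q)
    (b : V [⋀^Fin k]→L[ℝ] ℝ) : V [⋀^Fin l]→L[ℝ] ℝ :=
  if hc : ∃ c, IsStar K w q h b c then hc.choose else 0

end FibreAlg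

/-! ### Differential forms on a manifold -/

section Forms

variable (n : ℕ) (M : Type*) [TopologicalSpace M] [ChartedSpace (EuclideanSpace ℝ (Fin n)) M]

/-- Not necessarily smooth differential forms of degree `k`. -/
abbrev FormSec (k : ℕ) : Type _ := ∀ x : M, TangentSpace (𝓡 n) x [⋀^Fin k]→L[ℝ] ℝ

/-- Not necessarily smooth and not necessarily homogeneous differential forms. -/
abbrev MixedSec : Type _ := ∀ k : ℕ, FormSec n M k

variable {n M}

/-- The expression of a differential form in a chart, i.e. its pullback under the inverse of the
chart. -/
def localRep {k : ℕ} (α : FormSec n M k)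
    (c : OpenPartialHomeomorph M (EuclideanSpace ℝ (Fin n))) (y : EuclideanSpace ℝ (Fin n)) :
    EuclideanSpace ℝ (Fin n) [⋀^Fin k]→L[ℝ] ℝ :=
  (α (c.symm y)).compContinuousLinearMap
    (mfderiv 𝓘(ℝ, EuclideanSpace ℝ (Fin n)) (𝓡 n) c.symm y)

/-- A differential form is smooth if its expressions in all charts of the atlas are smooth. -/
def SmoothForm {k : ℕ} (α : FormSec n M k) : Prop :=
  ∀ c ∈ atlas (EuclideanSpace ℝ (Fin n)) M, ContDiffOn ℝ ∞ (localRep α c) c.target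

/-- The exterior derivative of a differential form, computed at `x` in the chart at `x`. -/
def extD {k : ℕ} (α : FormSec n M k) : FormSec n M (k + 1) := fun x =>
  (extDeriv (localRep α (chartAt (EuclideanSpace ℝ (Fin n)) x))
    (chartAt (EuclideanSpace ℝ (Fin n)) x x)).compContinuousLinearMap
      (mfderiv (𝓡 n) 𝓘(ℝ, EuclideanSpace ℝ (Fin n)) (chartAt (EuclideanSpace ℝ (Fin n)) x) x)

/-- The exterior derivative of a not necessarily homogeneous form. -/
def mixedD (α : MixedSec n M) : MixedSec n M
  | 0 => 0
  | k + 1 => extD (α k)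

lemma localRep_add {k : ℕ} (α β : FormSec n M k)
    (c : OpenPartialHomeomorph M (EuclideanSpace ℝ (Fin n))) :
    localRep (α + β) c = localRep α c + localRep β c := rfl

lemma localRep_smul {k : ℕ} (r : ℝ) (α : FormSec n M k)
    (c : OpenPartialHomeomorph M (EuclideanSpace ℝ (Fin n))) :
    localRep (r • α) c = r • localRep α c := rfl

lemma smoothForm_zero {k : ℕ} : SmoothForm (0 : FormSec n M k) := by
  intro c _
  exact contDiffOn_const (c := 0)

lemma SmoothForm.add {k : ℕ} {α β : FormSec n M k} (ha : SmoothForm α) (hb : SmoothForm β) :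
    SmoothForm (α + β) := by
  intro c hc
  rw [localRep_add]
  exact (ha c hc).add (hb c hc)

lemma SmoothForm.smul {k : ℕ} {α : FormSec n M k} (ha : SmoothForm α) (r : ℝ) :
    SmoothForm (r • α) := by
  intro c hc
  rw [localRep_smul]
  exact (ha c hc).const_smul r

lemma SmoothForm.differentiableAt {k : ℕ} {α : FormSec n M k} (ha : SmoothForm α) (x : M) :
    DifferentiableAt ℝ (localRep α (chartAt (EuclideanSpace ℝ (Fin n)) x))
      (chartAt (EuclideanSpace ℝ (Fin n)) x x) :=
  ((ha _ (chart_mem_atlas _ x)).contDiffAt ((chartAt _ x).open_target.mem_nhds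
    ((chartAt _ x).map_source (mem_chart_source _ x)))).differentiableAt (by simp)

lemma extD_add {k : ℕ} {α β : FormSec n M k} (ha : SmoothForm α) (hb : SmoothForm β) :
    extD (α + β) = extD α + extD β := by
  funext x
  simp only [extD, localRep_add]
  rw [extDeriv_add (ha.differentiableAt x) (hb.differentiableAt x)]
  rfl

lemma extD_smul {k : ℕ} (r : ℝ) (α : FormSec n M k) : extD (r • α) = r • extD α := by
  funext x
  simp only [extD, localRep_smul]
  rw [extDeriv_smul]
  rfl

end Forms

/-! ### Foliations and basic forms -/

/-- A foliation of codimension `c` on the `n`-manifold `M`, given by an open cover `U i`,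
submersions `f i : U i → T₀` with connected fibres into a `c`-manifold `T₀` (the values of `f i`
outside of `U i` are irrelevant) and local diffeomorphisms `γ` of `T₀`, defined on
`f i (U i ∩ U j)`, with `f j = γ ∘ f i` on `U i ∩ U j`. -/
structure Foliation (n c : ℕ) (M : Type*) [TopologicalSpace M]
    [ChartedSpace (EuclideanSpace ℝ (Fin n)) M] (T₀ : Type*) [TopologicalSpace T₀]
    [ChartedSpace (EuclideanSpace ℝ (Fin c)) T₀] (ι : Type*) where
  U : ι → Set M
  isOpen_U : ∀ i, IsOpen (U i)
  cover : ∀ x, ∃ i, x ∈ U i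
  f : ι → M → T₀
  submersion : ∀ i, ∀ x ∈ U i, Manifold.IsSubmersionAt (𝓡 n) (𝓡 c) ∞ (f i) x
  connected : ∀ i t, IsPreconnected (U i ∩ f i ⁻¹' {t})
  transition : ∀ i j, (U i ∩ U j).Nonempty → ∃ γ : PartialDiffeomorph (𝓡 c) (𝓡 c) T₀ T₀ ∞,
    γ.source = f i '' (U i ∩ U j) ∧ ∀ x ∈ U i ∩ U j, f j x = γ (f i x)

namespace Foliation

variable {n c : ℕ} {M : Type*} [TopologicalSpace M]
    [ChartedSpace (EuclideanSpace ℝ (Fin n)) M] {T₀ : Type*} [TopologicalSpace T₀]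
    [ChartedSpace (EuclideanSpace ℝ (Fin c)) T₀] {ι : Type*} (F : Foliation n c M T₀ ι)

/-- The tangent space at `x` of the leaf through `x`, i.e. the kernel of the differential at `x` of
`f i`, which is the same for all `i` with `x ∈ U i`. -/
def tangent (x : M) : Submodule ℝ (TangentSpace (𝓡 n) x) :=
  ⨅ i, ⨅ _ : x ∈ F.U i, LinearMap.ker (mfderiv (𝓡 n) (𝓡 c) (F.f i) x).toLinearMap

/-- A smooth form `α` is basic if `i_X α = 0` and `i_X dα = 0` for all `X` tangent to the leaves. -/
structure IsBasic {k : ℕ} (α : FormSec n M k) : Prop where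
  smooth : SmoothForm α
  horizontal : ∀ (x : M) (v : Fin k → TangentSpace (𝓡 n) x), (∃ i, v i ∈ F.tangent x) → α x v = 0
  horizontal_extD : ∀ (x : M) (v : Fin (k + 1) → TangentSpace (𝓡 n) x),
    (∃ i, v i ∈ F.tangent x) → extD α x v = 0

variable {F} in
lemma IsBasic.add {k : ℕ} {α β : FormSec n M k} (ha : F.IsBasic α) (hb : F.IsBasic β) :
    F.IsBasic (α + β) where
  smooth := ha.smooth.add hb.smooth
  horizontal x v hv := by
    change α x v + β x v = 0
    rw [ha.horizontal x v hv, hb.horizontal x v hv, add_zero]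
  horizontal_extD x v hv := by
    rw [extD_add ha.smooth hb.smooth]
    change extD α x v + extD β x v = 0
    rw [ha.horizontal_extD x v hv, hb.horizontal_extD x v hv, add_zero]

variable {F} in
lemma IsBasic.smul {k : ℕ} {α : FormSec n M k} (ha : F.IsBasic α) (r : ℝ) :
    F.IsBasic (r • α) where
  smooth := ha.smooth.smul r
  horizontal x v hv := by
    change r • α x v = 0
    rw [ha.horizontal x v hv, smul_zero]
  horizontal_extD x v hv := by
    rw [extD_smul]
    change r • extD α x v = 0
    rw [ha.horizontal_extD x v hv, smul_zero]

lemma isBasic_zero {k : ℕ} : F.IsBasic (0 : FormSec n M k) where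
  smooth := smoothForm_zero
  horizontal _ _ _ := rfl
  horizontal_extD x v _ := by
    rw [← zero_smul ℝ (0 : FormSec n M k), extD_smul, zero_smul]
    rfl

/-- The real vector space of basic forms, the sum of its homogeneous components (there are no nonzero
basic forms in degrees greater than `c`). -/
def BasicForms : Submodule ℝ (MixedSec n M) where
  carrier := {α | ∀ k, F.IsBasic (α k)}
  add_mem' ha hb k := (ha k).add (hb k)
  zero_mem' _ := F.isBasic_zero
  smul_mem' r _ ha k := (ha k).smul r

/-- The basic forms of degree `j`. -/
def basicDeg (j : ℤ) : Submodule ℝ F.BasicForms where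
  carrier := {α | ∀ k : ℕ, (k : ℤ) ≠ j → α.1 k = 0}
  add_mem' ha hb k hk := by
    exact (congrArg₂ (· + ·) (ha k hk) (hb k hk)).trans (add_zero _)
  zero_mem' _ _ := rfl
  smul_mem' r _ ha k hk :=
    (congrArg (r • ·) (ha k hk)).trans (smul_zero _)

/-- A basic symplectic form: a closed basic 2-form that is nondegenerate on the normal bundle. -/
structure IsSymplectic (σ : FormSec n M 2) : Prop where
  basic : F.IsBasic σ
  closed : extD σ = 0
  nondegenerate : ∀ (x : M) (v : TangentSpace (𝓡 n) x),
    (∀ w : TangentSpace (𝓡 n) x, σ x ![v, w] = 0) → v ∈ F.tangent x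

instance instFiniteDimensionalTangent (x : M) : FiniteDimensional ℝ (TangentSpace (𝓡 n) x) :=
  inferInstanceAs (FiniteDimensional ℝ (EuclideanSpace ℝ (Fin n)))

/-- The symplectic star operator of a foliation of codimension `2 q`, applied fibrewise: the part of
degree `l` of `* α` is `*` of the part of degree `2 q - l` of `α`. -/
def starOp (q : ℕ) (σ : FormSec n M 2) (α : MixedSec n M) : MixedSec n M := fun l x =>
  if h : l ≤ 2 * q then
    FibreAlg.star (F.tangent x) (σ x).toAlternatingMap q
      (show 2 * q - l + l = 2 * q from Nat.sub_add_cancel h) (α (2 * q - l) x)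
  else 0

/-- The operator `d^Λ α = (-1)^(k+1) * d * α` for `α` of degree `k`, extended additively to
inhomogeneous forms. -/
def symplecticD (q : ℕ) (σ : FormSec n M 2) (α : MixedSec n M) : MixedSec n M :=
  F.starOp q σ (mixedD (F.starOp q σ (fun k x => (-1 : ℝ) ^ (k + 1) • α k x)))

end Foliation

end

/-! On the forms of each normal fibre, exterior multiplication `L` by ω and contraction `Λ` with the
inverse bivector generate an action of sl₂, with [L, Λ] = N - q, where N multiplies by the degree.
Two facts about d are added: [L, d] = 0, because ω is closed, and [N, d] = d. They make d a highest
weight vector of weight 1 for the adjoint action. As `Λ` is nilpotent, d generates a copy of the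
standard representation, spanned by d and δ = [d, Λ] (`commute_commutator_of_sl2`). Hence [Λ, δ] = 0
and [L, δ] = -d, and d² = 0 then forces dδ + δd = 0 and δ² = 0. Neither Darboux coordinates nor a
Hodge theory is involved.

The star operator enters through the Weyl element W = e^L e^{-Λ} e^L, which conjugates the pair (x,
y) of any copy of the standard representation into (y, -x). On a fibre such pairs are formed by
exterior multiplication with a covector of a frame and contraction with the vector dual to it under
ω. Together with W(1) = ω^q/q! this gives α ∧ Wβ = ± G(α, β) ω^q/q!, so *_s is W up to a sign
depending on the degree (`FibreAlg.star_eq`). The pair (d, δ) is of the same kind, so W d = δ W, and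
a comparison of signs gives d^Λ = δ (`symplecticD_eq`).

For the degeneration, `L` acts on the total complex with bidegree (1, -1), respects the first
filtration, and e^L (d + δ) e^{-L} = δ. The differential δ preserves the first index, so up to a
filtered automorphism the complex is a direct sum of columns and d_r = 0 for r ≥ 1. The second
filtration is treated in the same way with `Λ`, whose exponential turns d + δ into d.

Geometry is needed only to see that `L` and `Λ` preserve basic forms and that [L, d] = 0. In a chart
where the leaves are translates of a constant subspace K, a basic form is a smooth K-horizontal form
whose derivative along K vanishes (`exists_isAdapted`, `basicOn_of_horizontal`). There the operators
can be written in a constant frame. -/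

noncomputable section

/-! ### Exponentials of nilpotent elements and `sl₂` -/

section Nexp

variable {A : Type*} [Ring A] [Algebra ℝ A]

/-- The exponential series truncated after `N` terms. -/
def nexp (N : ℕ) (a : A) : A := ∑ m ∈ Finset.range N, ((m ! : ℝ))⁻¹ • a ^ m

/-- The bracket with `a` is a derivation whose square kills `x`, so each of the m + 1 factors
contributes one copy of `y`. -/
lemma pow_succ_mul_of_commutator {a x y : A} (hx : a * x = x * a + y) (hy : a * y = y * a) (m : ℕ) :
    a ^ (m + 1) * x = x * a ^ (m + 1) + ((m + 1 : ℕ) : ℝ) • (y * a ^ m) := by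
  have hym : ∀ m : ℕ, a ^ m * y = y * a ^ m := fun m =>
    (show Commute a y from hy).pow_left m
  induction m with
  | zero => simp [hx]
  | succ m ih =>
    rw [pow_succ a (m + 1), mul_assoc, hx, mul_add, ← mul_assoc, ih, hym, add_mul, mul_assoc,
      ← pow_succ, smul_mul_assoc, mul_assoc, ← pow_succ, add_assoc, Nat.cast_succ (m + 1),
      add_smul, one_smul]

/-- This is e^a x e^{-a} = e^{ad a} x, where the series stops after the linear term. -/
lemma nexp_mul_of_commutator {N : ℕ} {a x y : A} (ha : a ^ N = 0) (hx : a * x = x * a + y)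
    (hy : a * y = y * a) : nexp N a * x = (x + y) * nexp N a := by
  cases N with
  | zero =>
    simp [nexp]
  | succ N =>
    -- Truncation loses the last term of y e^a. It is zero: the commutator formula at the first
    -- vanishing power of `a` leaves only a nonzero multiple of it.
    have hz : y * a ^ N = 0 := by
      have := pow_succ_mul_of_commutator hx hy N
      rw [ha, zero_mul, mul_zero, zero_add, eq_comm, smul_eq_zero] at this
      exact this.resolve_left (by exact_mod_cast N.succ_ne_zero)
    have h1 : y * nexp (N + 1) a = ∑ m ∈ Finset.range N, ((m ! : ℝ))⁻¹ • (y * a ^ m) := by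
      simp only [nexp, Finset.mul_sum, mul_smul_comm]
      rw [Finset.sum_range_succ, hz, smul_zero, add_zero]
    rw [add_mul, h1]
    simp only [nexp, Finset.sum_mul, Finset.mul_sum, smul_mul_assoc, mul_smul_comm]
    rw [Finset.sum_range_succ', Finset.sum_range_succ' (fun m => ((m ! : ℝ))⁻¹ • (x * a ^ m))]
    simp only [pow_succ_mul_of_commutator hx hy, smul_add, Finset.sum_add_distrib, pow_zero,
      one_mul, mul_one]
    have h2 : ∀ m : ℕ, (((m + 1)! : ℕ) : ℝ)⁻¹ • ((m + 1 : ℕ) : ℝ) • (y * a ^ m)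
        = ((m ! : ℝ))⁻¹ • (y * a ^ m) := by
      intro m
      rw [smul_smul, Nat.factorial_succ]
      congr 1
      push_cast
      have : (m ! : ℝ) ≠ 0 := by exact_mod_cast m.factorial_ne_zero
      field_simp
    simp only [h2]
    abel

lemma nexp_mul_nexp_neg {N : ℕ} {a : A} (ha : a ^ N = 0) : nexp N a * nexp N (-a) = 1 := by
  -- `IsNilpotent.exp` is defined for ℚ-algebras, so scalars are restricted.
  let _ : Algebra ℚ A := Algebra.compHom A (algebraMap ℚ ℝ)
  have key : ∀ b : A, b ^ N = 0 → nexp N b = IsNilpotent.exp b := by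
    intro b hb
    rw [IsNilpotent.exp_eq_sum hb, nexp]
    refine Finset.sum_congr rfl fun m _ => ?_
    change _ = (algebraMap ℚ ℝ ((m ! : ℚ)⁻¹)) • b ^ m
    simp
  rw [key a ha, key (-a) (by rw [neg_pow, ha, mul_zero]),
    IsNilpotent.exp_mul_exp_neg_self ⟨N, ha⟩]

/-- The Weyl element attached to a raising and a lowering operator. -/
def weyl (N : ℕ) (l m : A) : A := nexp N l * nexp N (-m) * nexp N l

variable {N : ℕ} {l m x y : A}

/-- The hypotheses say that `x`, `y` form a copy of the standard representation under ad l and ad m.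
The three exponentials send x to x, then to x + y, then to (x + y) - x = y. -/
lemma weyl_mul_left (hl : l ^ N = 0) (hm : m ^ N = 0) (hlx : l * x = x * l)
    (hmx : m * x = x * m - y) (hly : l * y = y * l - x) (hmy : m * y = y * m) :
    weyl N l m * x = y * weyl N l m := by
  have h1 : nexp N l * x = x * nexp N l := by
    rw [nexp_mul_of_commutator hl (y := 0) (by rw [hlx, add_zero]) (by simp), add_zero]
  have h2 : nexp N (-m) * x = (x + y) * nexp N (-m) :=
    nexp_mul_of_commutator (by rw [neg_pow, hm, mul_zero]) (by rw [neg_mul, hmx]; noncomm_ring)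
      (by rw [neg_mul, hmy, mul_neg])
  have h3 : nexp N l * y = (y + -x) * nexp N l :=
    nexp_mul_of_commutator hl (by rw [hly, sub_eq_add_neg]) (by rw [mul_neg, hlx, neg_mul])
  rw [weyl, mul_assoc, h1, ← mul_assoc, mul_assoc (nexp N l), h2, ← mul_assoc (nexp N l), mul_add,
    h1, h3]
  noncomm_ring

/-- The second basis vector follows the path y, y - x, -x, -x. -/
lemma weyl_mul_right (hl : l ^ N = 0) (hm : m ^ N = 0) (hlx : l * x = x * l)
    (hmx : m * x = x * m - y) (hly : l * y = y * l - x) (hmy : m * y = y * m) :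
    weyl N l m * y = -x * weyl N l m := by
  have h1 : nexp N l * x = x * nexp N l := by
    rw [nexp_mul_of_commutator hl (y := 0) (by rw [hlx, add_zero]) (by simp), add_zero]
  have h2 : nexp N (-m) * x = (x + y) * nexp N (-m) :=
    nexp_mul_of_commutator (by rw [neg_pow, hm, mul_zero]) (by rw [neg_mul, hmx]; noncomm_ring)
      (by rw [neg_mul, hmy, mul_neg])
  have h2' : nexp N (-m) * y = y * nexp N (-m) := by
    rw [nexp_mul_of_commutator (y := 0) (by rw [neg_pow, hm, mul_zero])
      (by rw [neg_mul, hmy, mul_neg, add_zero]) (by simp), add_zero]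
  have h3 : nexp N l * y = (y + -x) * nexp N l :=
    nexp_mul_of_commutator hl (by rw [hly, sub_eq_add_neg]) (by rw [mul_neg, hlx, neg_mul])
  have h4 : nexp N (-m) * (y + -x) = -x * nexp N (-m) := by
    rw [mul_add, mul_neg, h2, h2']
    noncomm_ring
  rw [weyl, mul_assoc, h3, ← mul_assoc, mul_assoc (nexp N l), h4, ← mul_assoc (nexp N l), mul_neg,
    h1]
  noncomm_ring

/-- Serves to compute the Weyl element on a vector killed by every `y`: the last two exponentials
send it to a vector killed by every `x`. -/
lemma mul_nexp_mul_nexp (hl : l ^ N = 0) (hm : m ^ N = 0) (hlx : l * x = x * l)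
    (hmx : m * x = x * m - y) (hly : l * y = y * l - x) (hmy : m * y = y * m) :
    x * (nexp N (-m) * nexp N l) = -(nexp N (-m) * nexp N l * y) := by
  have h2 : nexp N (-m) * x = (x + y) * nexp N (-m) :=
    nexp_mul_of_commutator (by rw [neg_pow, hm, mul_zero]) (by rw [neg_mul, hmx]; noncomm_ring)
      (by rw [neg_mul, hmy, mul_neg])
  have h2' : nexp N (-m) * y = y * nexp N (-m) := by
    rw [nexp_mul_of_commutator (y := 0) (by rw [neg_pow, hm, mul_zero])
      (by rw [neg_mul, hmy, mul_neg, add_zero]) (by simp), add_zero]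
  have h3 : nexp N l * y = (y + -x) * nexp N l :=
    nexp_mul_of_commutator hl (by rw [hly, sub_eq_add_neg]) (by rw [mul_neg, hlx, neg_mul])
  have h4 : nexp N (-m) * (y + -x) = -x * nexp N (-m) := by
    rw [mul_add, mul_neg, h2, h2']
    noncomm_ring
  rw [mul_assoc (nexp N (-m)) (nexp N l) y, h3, ← mul_assoc (nexp N (-m)) (y + -x), h4]
  noncomm_ring

attribute [local instance] LieRing.ofAssociativeRing

/-- In an `sl₂`-triple `(l, h, m)` with `m` nilpotent, the bracket with `m` kills `⁅m, d⁆` as soon as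
`d` is a highest weight vector of weight `1`. -/
lemma commute_commutator_of_sl2 {h d : A} (hm : IsNilpotent m) (hlm : ⁅l, m⁆ = h)
    (hhm : ⁅h, m⁆ = (-2 : ℝ) • m) (hhd : ⁅h, d⁆ = d) (hld : ⁅l, d⁆ = 0) : ⁅m, ⁅m, d⁆⁆ = 0 := by
  have hh1 : ⁅h, ⁅m, d⁆⁆ = (-1 : ℝ) • ⁅m, d⁆ := by
    rw [leibniz_lie, hhm, hhd, smul_lie]
    module
  have hl1 : ⁅l, ⁅m, d⁆⁆ = d := by
    rw [leibniz_lie, hlm, hhd, hld, lie_zero, add_zero]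
  -- The string of lowered vectors below ⁅m, ⁅m, d⁆⁆, which turns out to have weight -3 and to be
  -- killed by ad l.
  set g : ℕ → A := fun k => ((LieAlgebra.ad ℝ A m) ^ k) ⁅m, ⁅m, d⁆⁆ with hg
  have gs : ∀ k, g (k + 1) = ⁅m, g k⁆ := by
    intro k
    simp only [hg]
    rw [pow_succ', Module.End.mul_apply, LieAlgebra.ad_apply]
  have gh : ∀ k, ⁅h, g k⁆ = (-3 - 2 * k : ℝ) • g k := by
    intro k
    induction k with
    | zero =>
      change ⁅h, ⁅m, ⁅m, d⁆⁆⁆ = _ • ⁅m, ⁅m, d⁆⁆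
      rw [leibniz_lie, hhm, hh1, smul_lie, lie_smul]
      push_cast
      module
    | succ k ih =>
      rw [gs, leibniz_lie, hhm, ih, smul_lie, lie_smul]
      push_cast
      module
  -- The general coefficient is (k + 1)(λ - k) for a string starting at weight λ. With λ = -3 it
  -- never vanishes, so the string could end only if it is zero from the start; nilpotency of ad m
  -- does make it end.
  have gl : ∀ k : ℕ, ⁅l, g (k + 1)⁆ = (-(k + 1) * (k + 3) : ℝ) • g k := by
    intro k
    induction k with
    | zero =>
      have h0 : ⁅l, g 0⁆ = 0 := by
        change ⁅l, ⁅m, ⁅m, d⁆⁆⁆ = 0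
        rw [leibniz_lie, hlm, hl1, hh1]
        module
      rw [gs, leibniz_lie, hlm, gh, h0, lie_zero]
      push_cast
      module
    | succ k ih =>
      rw [gs, leibniz_lie, hlm, gh, ih, lie_smul, ← gs]
      push_cast
      module
  obtain ⟨n, hn⟩ := LieAlgebra.ad_nilpotent_of_nilpotent (R := ℝ) hm
  have hn' : g n = 0 := by simp only [hg]; rw [hn]; rfl
  have desc : ∀ k, g k = 0 → g 0 = 0 := by
    intro k
    induction k with
    | zero => exact id
    | succ k ih =>
      intro hk
      refine ih ?_
      have := gl k
      rw [hk, lie_zero, eq_comm, smul_eq_zero] at this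
      refine this.resolve_left ?_
      have : (0:ℝ) < (k + 1) * (k + 3) := by positivity
      linarith
  exact desc n hn'

end Nexp

/-- Used to read exponentials of operators on basic forms fibre by fibre. -/
lemma nexp_apply_of_intertwine {V W : Type*} [AddCommGroup V] [Module ℝ V] [AddCommGroup W]
    [Module ℝ W] (f : V →ₗ[ℝ] W) {a : Module.End ℝ V} {b : Module.End ℝ W}
    (h : ∀ v, f (a v) = b (f v)) (N : ℕ) (v : V) : f (nexp N a v) = nexp N b (f v) := by
  have hp : ∀ m : ℕ, f ((a ^ m) v) = (b ^ m) (f v) := by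
    intro m
    induction m with
    | zero => rfl
    | succ m ih => rw [pow_succ', pow_succ', Module.End.mul_apply, Module.End.mul_apply, h, ih]
  simp [nexp, hp]

lemma nexp_apply_of_eq_zero {V : Type*} [AddCommGroup V] [Module ℝ V] {a : Module.End ℝ V} {v : V}
    (h : a v = 0) (N : ℕ) : nexp (N + 1) a v = v := by
  rw [nexp, Finset.sum_range_succ', LinearMap.add_apply, LinearMap.sum_apply,
    Finset.sum_eq_zero fun m _ => ?_]
  · simp
  · rw [LinearMap.smul_apply, pow_succ, Module.End.mul_apply, h, map_zero, smul_zero]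

lemma nexp_mem {V : Type*} [AddCommGroup V] [Module ℝ V] {a : Module.End ℝ V} (S : Submodule ℝ V)
    (h : ∀ v ∈ S, a v ∈ S) (N : ℕ) {v : V} (hv : v ∈ S) : nexp N a v ∈ S := by
  have hp : ∀ m : ℕ, (a ^ m) v ∈ S := by
    intro m
    induction m with
    | zero => exact hv
    | succ m ih => rw [pow_succ', Module.End.mul_apply]; exact h _ ih
  simp only [nexp, LinearMap.sum_apply, LinearMap.smul_apply]
  exact S.sum_mem fun m _ => S.smul_mem _ (hp m)

lemma weyl_apply_of_intertwine {V W : Type*} [AddCommGroup V] [Module ℝ V] [AddCommGroup W]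
    [Module ℝ W] (f : V →ₗ[ℝ] W) {a a' : Module.End ℝ V} {b b' : Module.End ℝ W}
    (h : ∀ v, f (a v) = b (f v)) (h' : ∀ v, f (a' v) = b' (f v)) (N : ℕ) (v : V) :
    f (weyl N a a' v) = weyl N b b' (f v) := by
  have h'' : ∀ v, f ((-a') v) = (-b') (f v) := fun v => by simp [h']
  simp only [weyl, Module.End.mul_apply]
  rw [nexp_apply_of_intertwine f h, nexp_apply_of_intertwine f h'', nexp_apply_of_intertwine f h]

/-! ### Degeneration of spectral sequences -/

namespace FiltComplex

variable {R : Type*} [CommRing R] {T : Type*} [AddCommGroup T] [Module R T] (C : FiltComplex R T)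

lemma F_anti_of_le {p p' : ℤ} (h : p ≤ p') (k : ℤ) : C.F p' k ≤ C.F p k := by
  induction p', h using Int.leInduction with
  | base => exact le_rfl
  | succ j _ ih => exact (C.F_anti j k).trans ih

/-- If a filtered automorphism conjugates the differential into one that splits off the lowest
step of the filtration, the spectral sequence degenerates at the first page. -/
lemma degeneratesAt_one_of_conj (d₀ Φ Ψ : T →ₗ[R] T) (hΨΦ : ∀ x, Ψ (Φ x) = x)
    (hΦ : ∀ p k x, x ∈ C.F p k → Φ x ∈ C.F p k) (hΨ : ∀ p k x, x ∈ C.F p k → Ψ x ∈ C.F p k)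
    (hΦD : ∀ x, Φ (C.D x) = d₀ (Φ x)) (hΨD : ∀ x, Ψ (d₀ x) = C.D (Ψ x))
    (hsplit : ∀ p k y, y ∈ C.F p k → d₀ y ∈ C.F (p + 1) (k + 1) →
      ∃ z ∈ C.F (p + 1) k, d₀ z = d₀ y) : C.DegeneratesAt 1 := by
  intro r hr p k
  refine LinearMap.ext fun x => ?_
  obtain ⟨⟨x, hx⟩, rfl⟩ := Submodule.Quotient.mk_surjective _ x
  have hx1 : x ∈ C.F p k := hx.1
  have hx2 : C.D x ∈ C.F (p + r) (k + 1) := hx.2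
  -- After conjugation the differential only sees the part of Φ x that lies one filtration step
  -- deeper, because D x already lies in `F (p + 1)` when r ≥ 1.
  obtain ⟨z, hz, hzy⟩ := hsplit p k (Φ x) (hΦ p k x hx1) (by
    rw [← hΦD]
    exact hΦ _ _ _ (C.F_anti_of_le (by omega) _ hx2))
  have hD : C.D (Ψ z) = C.D x := by
    rw [← hΨD, hzy, hΨD, hΨΦ]
  change Submodule.Quotient.mk _ = 0
  rw [Submodule.Quotient.mk_eq_zero]
  change C.D x ∈ C.bdry r (p + r) (k + 1)
  -- D x is also the differential of Ψ z, an element of filtration p + 1. This is exactly the kind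
  -- of boundary divided out on page r, so the class of D x is zero.
  refine Submodule.mem_sup_right (Submodule.mem_map.2 ⟨Ψ z, ?_, hD⟩)
  have h1 : p + r - r + 1 = p + 1 := by ring
  have h2 : k + 1 - 1 = k := by ring
  have h3 : p + 1 + (r - 1) = p + r := by ring
  rw [h1, h2]
  refine ⟨hΨ _ _ _ hz, ?_⟩
  rw [h3]
  change C.D (Ψ z) ∈ C.F (p + r) (k + 1)
  rw [hD]
  exact hx2

/-- The case of `degeneratesAt_one_of_conj` where the conjugation is the exponential of `-a`. -/
lemma degeneratesAt_one_of_commutator {T : Type*} [AddCommGroup T] [Module ℝ T]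
    (C : FiltComplex ℝ T) {a b c : Module.End ℝ T} {N : ℕ} (haN : a ^ N = 0) (hD : C.D = c + b)
    (hab : a * b = b * a) (hac : a * c = c * a - b) (hmem : ∀ p k x, x ∈ C.F p k → a x ∈ C.F p k)
    (hsplit : ∀ p k y, y ∈ C.F p k → c y ∈ C.F (p + 1) (k + 1) →
      ∃ z ∈ C.F (p + 1) k, c z = c y) : C.DegeneratesAt 1 := by
  -- Since [-a, c] = b and [a, b] = 0, conjugation by e^{-a} adds b to c and conjugation by e^a
  -- removes it again.
  have hΨ : nexp N (-a) * c = (c + b) * nexp N (-a) :=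
    nexp_mul_of_commutator (by rw [neg_pow, haN, mul_zero])
      (by rw [neg_mul, hac]; noncomm_ring) (by rw [neg_mul, hab, mul_neg])
  have hΦ : nexp N a * (c + b) = c * nexp N a := by
    rw [nexp_mul_of_commutator haN (y := -b) (by rw [mul_add, add_mul, hac, hab]; noncomm_ring)
      (by rw [mul_neg, hab, neg_mul])]
    noncomm_ring
  have hinv : nexp N (-a) * nexp N a = 1 := by
    have := nexp_mul_nexp_neg (a := -a) (by rw [neg_pow, haN, mul_zero] : (-a) ^ N = 0)
    rwa [neg_neg] at this
  refine C.degeneratesAt_one_of_conj c (nexp N a) (nexp N (-a))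
    (fun x => LinearMap.congr_fun hinv x) (fun p k x hx => nexp_mem _ (hmem p k) N hx)
    (fun p k x hx => nexp_mem _
      (fun v hv => by simpa using Submodule.neg_mem _ (hmem p k v hv)) N hx)
    (fun x => ?_) (fun x => ?_) hsplit
  · rw [hD]
    exact LinearMap.congr_fun hΦ x
  · rw [hD]
    exact LinearMap.congr_fun hΨ x

end FiltComplex

/-! ### Degeneration for the double complex of a bidifferential module -/

section DoubDegenerate

variable {V : Type*} [AddCommGroup V] [Module ℝ V] {𝒱 : ℤ → Submodule ℝ V} {d δ : V →ₗ[ℝ] V}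
  (h : IsBidifferential 𝒱 d δ 1 (-1))

/-- The components of an element of the total complex. -/
def doubCoords : (Doub h).Tot →ₗ[ℝ] (ℤ × ℤ → V) where
  toFun x i := (x i : V)
  map_add' x y := by funext i; rfl
  map_smul' c x := by funext i; rfl

lemma doubCoords_injective : Function.Injective (doubCoords h) := by
  intro x y hxy
  exact DFinsupp.ext fun i => Subtype.ext (congrFun hxy i)

lemma doubCoords_incl (p q : ℤ) (x : 𝒱 (1 * p + -1 * q)) (i : ℤ × ℤ) :
    doubCoords h ((Doub h).incl p q x) i = if i = (p, q) then (x : V) else 0 := by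
  change ((DirectSum.lof ℝ (ℤ × ℤ) (fun i => 𝒱 (1 * i.1 + -1 * i.2)) (p, q) x) i : V) = _
  split_ifs with hi
  · subst hi
    rw [DirectSum.lof_apply]
  · rw [DirectSum.lof_eq_of, DirectSum.of_eq_of_ne _ _ _ hi]
    rfl

/-- The endomorphism of bidegree `(r, s)` of the total complex induced by an endomorphism of degree
`r - s`. -/
def doubMap (T : V →ₗ[ℝ] V) (r s : ℤ) (hT : ∀ j x, x ∈ 𝒱 j → T x ∈ 𝒱 (j + (r - s))) :
    Module.End ℝ (Doub h).Tot :=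
  DirectSum.toModule ℝ (ℤ × ℤ) (Doub h).Tot fun i =>
    (Doub h).incl (i.1 + r) (i.2 + s) ∘ₗ T.restrict (fun x hx => by
      rw [show 1 * (i.1 + r) + -1 * (i.2 + s) = 1 * i.1 + -1 * i.2 + (r - s) by ring]
      exact hT _ x hx)

lemma doub_linearMap_ext {W : Type*} [AddCommGroup W] [Module ℝ W] {f g : (Doub h).Tot →ₗ[ℝ] W}
    (hfg : ∀ p q x, f ((Doub h).incl p q x) = g ((Doub h).incl p q x)) (x : (Doub h).Tot) :
    f x = g x := by
  refine LinearMap.congr_fun (DirectSum.linearMap_ext ℝ fun i => LinearMap.ext fun y => ?_) x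
  exact hfg i.1 i.2 y

/-- Components are compared in `V` rather than in the index-dependent submodules, so identities
between operators on the total complex reduce to identities in `V` and equalities of shifted
indices. -/
lemma doubCoords_doubMap (T : V →ₗ[ℝ] V) (r s : ℤ)
    (hT : ∀ j x, x ∈ 𝒱 j → T x ∈ 𝒱 (j + (r - s))) (x : (Doub h).Tot) (i : ℤ × ℤ) :
    doubCoords h (doubMap h T r s hT x) i = T (doubCoords h x (i.1 - r, i.2 - s)) := by
  refine doub_linearMap_ext h (f := LinearMap.proj i ∘ₗ doubCoords h ∘ₗ doubMap h T r s hT)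
    (g := T ∘ₗ LinearMap.proj (i.1 - r, i.2 - s) ∘ₗ doubCoords h) ?_ x
  intro p q y
  simp only [LinearMap.comp_apply, LinearMap.proj_apply]
  rw [doubCoords_incl]
  have : doubMap h T r s hT ((Doub h).incl p q y) = (Doub h).incl (p + r) (q + s)
      (T.restrict (p := 𝒱 (1 * p + -1 * q)) (q := 𝒱 (1 * (p + r) + -1 * (q + s))) (fun x hx => by
      rw [show 1 * (p + r) + -1 * (q + s) = 1 * p + -1 * q + (r - s) by ring]
      exact hT _ x hx) y) := by
    simp only [doubMap, DoubleCpx.incl]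
    rw [DirectSum.toModule_lof]
    rfl
  rw [this, doubCoords_incl]
  have : i = (p + r, q + s) ↔ (i.1 - r, i.2 - s) = (p, q) := by
    rw [Prod.ext_iff, Prod.ext_iff]
    constructor <;> rintro ⟨h1, h2⟩ <;> simp only at h1 h2 ⊢ <;> omega
  simp only [this]
  split_ifs <;> simp

lemma doubCoords_totD (x : (Doub h).Tot) (i : ℤ × ℤ) :
    doubCoords h ((Doub h).totD x) i =
      d (doubCoords h x (i.1 - 1, i.2)) + δ (doubCoords h x (i.1, i.2 - 1)) := by
  refine doub_linearMap_ext h (f := LinearMap.proj i ∘ₗ doubCoords h ∘ₗ (Doub h).totD)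
    (g := d ∘ₗ LinearMap.proj (i.1 - 1, i.2) ∘ₗ doubCoords h +
      δ ∘ₗ LinearMap.proj (i.1, i.2 - 1) ∘ₗ doubCoords h) ?_ x
  intro p q y
  simp only [LinearMap.comp_apply, LinearMap.add_apply, LinearMap.proj_apply]
  rw [DoubleCpx.totD_incl, map_add, Pi.add_apply, doubCoords_incl, doubCoords_incl,
    doubCoords_incl, doubCoords_incl]
  have h1 : i = (p + 1, q) ↔ (i.1 - 1, i.2) = (p, q) := by
    rw [Prod.ext_iff, Prod.ext_iff]
    constructor <;> rintro ⟨h1, h2⟩ <;> simp only at h1 h2 ⊢ <;> omega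
  have h2 : i = (p, q + 1) ↔ (i.1, i.2 - 1) = (p, q) := by
    rw [Prod.ext_iff, Prod.ext_iff]
    constructor <;> rintro ⟨h1, h2⟩ <;> simp only at h1 h2 ⊢ <;> omega
  simp only [h1, h2]
  congr 1 <;> split_ifs <;> simp [Doub]

lemma mem_doub_supp (S : Set (ℤ × ℤ)) (x : (Doub h).Tot) :
    x ∈ (Doub h).supp S ↔ ∀ i, i ∉ S → doubCoords h x i = 0 :=
  forall₂_congr fun _ _ => (Submodule.coe_eq_zero).symm

lemma doubMap_pow (T : V →ₗ[ℝ] V) (r s : ℤ) (hT : ∀ j x, x ∈ 𝒱 j → T x ∈ 𝒱 (j + (r - s)))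
    (m : ℕ) (x : (Doub h).Tot) (i : ℤ × ℤ) :
    doubCoords h ((doubMap h T r s hT ^ m) x) i =
      (T ^ m) (doubCoords h x (i.1 - m * r, i.2 - m * s)) := by
  induction m generalizing i with
  | zero => simp
  | succ m ih =>
    rw [pow_succ', pow_succ', Module.End.mul_apply, Module.End.mul_apply, doubCoords_doubMap, ih]
    congr 4 <;> (push_cast; ring_nf)

-- On the total complex `L` has bidegree (1, -1), so it respects the filtration by the first index,
-- and the relations say that e^L conjugates d + δ into δ.
include h in
theorem Doub.first_degeneratesAt_one (L : Module.End ℝ V) (hL : ∀ j x, x ∈ 𝒱 j → L x ∈ 𝒱 (j + 2))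
    {N : ℕ} (hN : L ^ N = 0) (hd : ∀ x, L (d x) = d (L x)) (hδ : ∀ x, L (δ x) = δ (L x) - d x) :
    (Doub h).first.DegeneratesAt 1 := by
  set a : Module.End ℝ (Doub h).Tot := doubMap h L 1 (-1) (by norm_num; exact hL) with ha
  set b : Module.End ℝ (Doub h).Tot := doubMap h d 1 0 (by simpa using h.order₁) with hb
  set c : Module.End ℝ (Doub h).Tot := doubMap h δ 0 1 (by simpa using h.order₂) with hc
  have haN : a ^ N = 0 := by
    refine LinearMap.ext fun x => doubCoords_injective h (funext fun i => ?_)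
    rw [doubMap_pow, hN]
    simp
  have hD : (Doub h).totD = c + b := by
    refine LinearMap.ext fun x => doubCoords_injective h (funext fun i => ?_)
    rw [doubCoords_totD, LinearMap.add_apply, map_add, Pi.add_apply, doubCoords_doubMap,
      doubCoords_doubMap, add_comm]
    simp
  have hab : a * b = b * a := by
    refine LinearMap.ext fun x => doubCoords_injective h (funext fun i => ?_)
    simp only [Module.End.mul_apply, ha, hb, doubCoords_doubMap, hd]
    congr 4 <;> ring_nf
  have hac : a * c = c * a - b := by
    refine LinearMap.ext fun x => doubCoords_injective h (funext fun i => ?_)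
    simp only [Module.End.mul_apply, LinearMap.sub_apply, map_sub, Pi.sub_apply, ha, hb, hc,
      doubCoords_doubMap, hδ]
    congr 4 <;> ring_nf
  have hmem : ∀ p k x, x ∈ (Doub h).first.F p k → a x ∈ (Doub h).first.F p k := by
    intro p k x hx
    refine (mem_doub_supp h _ _).2 fun i hi => ?_
    rw [ha, doubCoords_doubMap, (mem_doub_supp h _ _).1 hx _ ?_, map_zero]
    simp only [Set.mem_ofPred_eq] at hi ⊢
    omega
  refine FiltComplex.degeneratesAt_one_of_commutator _ haN hD hab hac hmem ?_
  · intro p k y hy hcy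
    -- The component in column p is removed. Since δ preserves columns, the hypothesis on `c y` says
    -- that δ kills this component.
    refine ⟨y - (Doub h).incl p (k - p) (y (p, k - p)), ?_, ?_⟩
    · refine (mem_doub_supp h _ _).2 fun i hi => ?_
      rw [map_sub, Pi.sub_apply, doubCoords_incl]
      split_ifs with hip
      · subst hip
        exact sub_self _
      · rw [sub_zero]
        refine (mem_doub_supp h _ _).1 hy _ fun hiy => ?_
        simp only [Set.mem_ofPred_eq, Prod.ext_iff] at hi hiy hip
        omega
    · rw [map_sub, sub_eq_self]
      refine doubCoords_injective h (funext fun i => ?_)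
      rw [hc, doubCoords_doubMap, doubCoords_incl, map_zero, Pi.zero_apply]
      split_ifs with hip
      · have h1 := (mem_doub_supp h _ _).1 hcy i (by
          simp only [Set.mem_ofPred_eq, Prod.ext_iff] at hip ⊢
          omega)
        rw [hc, doubCoords_doubMap, hip] at h1
        exact h1
      · exact map_zero _

-- The mirror image: `Λ` has bidegree (-1, 1), respects the filtration by the second index, and e^Λ
-- conjugates d + δ into d, which preserves rows.
include h in
theorem Doub.second_degeneratesAt_one (Λ : Module.End ℝ V)
    (hΛ : ∀ j x, x ∈ 𝒱 j → Λ x ∈ 𝒱 (j + -2))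
    {N : ℕ} (hN : Λ ^ N = 0) (hd : ∀ x, Λ (d x) = d (Λ x) - δ x) (hδ : ∀ x, Λ (δ x) = δ (Λ x)) :
    (Doub h).second.DegeneratesAt 1 := by
  set a : Module.End ℝ (Doub h).Tot := doubMap h Λ (-1) 1 (by norm_num; exact hΛ) with ha
  set b : Module.End ℝ (Doub h).Tot := doubMap h d 1 0 (by simpa using h.order₁) with hb
  set c : Module.End ℝ (Doub h).Tot := doubMap h δ 0 1 (by simpa using h.order₂) with hc
  have haN : a ^ N = 0 := by
    refine LinearMap.ext fun x => doubCoords_injective h (funext fun i => ?_)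
    rw [doubMap_pow, hN]
    simp
  have hD : (Doub h).totD = b + c := by
    refine LinearMap.ext fun x => doubCoords_injective h (funext fun i => ?_)
    rw [doubCoords_totD, LinearMap.add_apply, map_add, Pi.add_apply, doubCoords_doubMap,
      doubCoords_doubMap]
    simp
  have hac : a * c = c * a := by
    refine LinearMap.ext fun x => doubCoords_injective h (funext fun i => ?_)
    simp only [Module.End.mul_apply, ha, hc, doubCoords_doubMap, hδ]
    congr 4 <;> ring_nf
  have hab : a * b = b * a - c := by
    refine LinearMap.ext fun x => doubCoords_injective h (funext fun i => ?_)
    simp only [Module.End.mul_apply, LinearMap.sub_apply, map_sub, Pi.sub_apply, ha, hb, hc,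
      doubCoords_doubMap, hd]
    congr 4 <;> ring_nf
  have hmem : ∀ p k x, x ∈ (Doub h).second.F p k → a x ∈ (Doub h).second.F p k := by
    intro p k x hx
    refine (mem_doub_supp h _ _).2 fun i hi => ?_
    rw [ha, doubCoords_doubMap, (mem_doub_supp h _ _).1 hx _ ?_, map_zero]
    simp only [Set.mem_ofPred_eq] at hi ⊢
    omega
  refine FiltComplex.degeneratesAt_one_of_commutator _ haN hD hac hab hmem ?_
  · intro p k y hy hcy
    refine ⟨y - (Doub h).incl (k - p) p (y (k - p, p)), ?_, ?_⟩
    · refine (mem_doub_supp h _ _).2 fun i hi => ?_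
      rw [map_sub, Pi.sub_apply, doubCoords_incl]
      split_ifs with hip
      · subst hip
        exact sub_self _
      · rw [sub_zero]
        refine (mem_doub_supp h _ _).1 hy _ fun hiy => ?_
        simp only [Set.mem_ofPred_eq, Prod.ext_iff] at hi hiy hip
        omega
    · rw [map_sub, sub_eq_self]
      refine doubCoords_injective h (funext fun i => ?_)
      rw [hb, doubCoords_doubMap, doubCoords_incl, map_zero, Pi.zero_apply]
      split_ifs with hip
      · have h1 := (mem_doub_supp h _ _).1 hcy i (by
          simp only [Set.mem_ofPred_eq, Prod.ext_iff] at hip ⊢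
          omega)
        rw [hb, doubCoords_doubMap, hip] at h1
        exact h1
      · exact map_zero _

end DoubDegenerate

/-! ### Canonical anticommutation relations -/

/-- The families `e` and `i` satisfy the canonical anticommutation relations. -/
structure IsCAR {A : Type*} [Ring A] {ι : Type*} [DecidableEq ι] (e i : ι → A) : Prop where
  ee : ∀ a b, e a * e b = -(e b * e a)
  ii : ∀ a b, i a * i b = -(i b * i a)
  ie : ∀ a b, i a * e b = (if a = b then 1 else 0) - e b * i a

section CAR

variable {A : Type*} [Ring A] [Algebra ℝ A] {ι : Type*} [Fintype ι]

/-- The quadratic element `½ ∑ w_ab e_a e_b`. -/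
def quadElt (w : Matrix ι ι ℝ) (e : ι → A) : A := (2⁻¹ : ℝ) • ∑ a, ∑ b, w a b • (e a * e b)

/-- The element `∑ P_ab i_b`. -/
def sharpElt (P : Matrix ι ι ℝ) (i : ι → A) (a : ι) : A := ∑ b, P a b • i b

variable [DecidableEq ι] {e i : ι → A} {w P : Matrix ι ι ℝ}

-- The symmetry between creation and annihilation, through which relations for `Λ` are read off from
-- those for `L`.
omit [Fintype ι] [Algebra ℝ A] in
lemma IsCAR.symm (h : IsCAR e i) : IsCAR i e where
  ee := h.ii
  ii := h.ee
  ie a b := by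
    rw [h.ie b a]
    simp only [eq_comm, sub_sub_cancel]

lemma IsCAR.quadElt_mul (h : IsCAR e i) (c : ι) : quadElt w e * e c = e c * quadElt w e := by
  simp only [quadElt, smul_mul_assoc, mul_smul_comm, Finset.sum_mul, Finset.mul_sum]
  congr 1
  refine Finset.sum_congr rfl fun a _ => Finset.sum_congr rfl fun b _ => ?_
  rw [mul_assoc, h.ee b c, mul_neg, ← mul_assoc, h.ee a c, neg_mul, neg_neg, mul_assoc]

/-- Moving `i c` past the two factors produces one sum for each of them. Antisymmetry of `w` makes
the sums equal, which absorbs the factor ½. -/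
lemma IsCAR.quadElt_mul_contr (h : IsCAR e i) (hw : wᵀ = -w) (c : ι) :
    quadElt w e * i c = i c * quadElt w e - sharpElt w e c := by
  have hab : ∀ a b, e a * e b * i c =
      i c * (e a * e b) + ((if c = b then e a else 0) - (if c = a then e b else 0)) := by
    intro a b
    have h1 : e b * i c = (if c = b then 1 else 0) - i c * e b := by
      rw [h.ie c b]; abel
    have h2 : e a * i c = (if c = a then 1 else 0) - i c * e a := by
      rw [h.ie c a]; abel
    rw [mul_assoc, h1, mul_sub, ← mul_assoc, h2, sub_mul, mul_assoc]
    split_ifs <;> simp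
    all_goals abel
  have hs : ∑ a, ∑ b, w a b • ((if c = b then e a else 0) - (if c = a then e b else 0))
      = -(2 : ℝ) • sharpElt w e c := by
    have ht : ∀ a, w a c = -w c a := fun a => by
      have := congrFun (congrFun hw c) a
      simpa using this
    simp only [smul_sub, Finset.sum_sub_distrib, smul_ite, smul_zero]
    rw [Finset.sum_comm (f := fun a b => if c = a then w a b • e b else 0)]
    simp only [Finset.sum_ite_eq, Finset.mem_univ, if_true, ht, neg_smul, Finset.sum_neg_distrib,
      sharpElt]
    module
  simp only [quadElt, smul_mul_assoc, mul_smul_comm, Finset.sum_mul, Finset.mul_sum]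
  simp only [hab, smul_add, Finset.sum_add_distrib]
  rw [hs]
  module

/-- Combining the contractions with the inverse matrix undoes the matrix in `quadElt_mul_contr`, so
that a single `e a` remains. -/
lemma IsCAR.quadElt_mul_sharp (h : IsCAR e i) (hw : wᵀ = -w) (hPw : P * w = 1) (a : ι) :
    quadElt w e * sharpElt P i a = sharpElt P i a * quadElt w e - e a := by
  have h2 : ∑ b, P a b • sharpElt w e b = e a := by
    simp only [sharpElt, Finset.smul_sum, smul_smul]
    rw [Finset.sum_comm]
    simp only [← Finset.sum_smul, ← Matrix.mul_apply, hPw, Matrix.one_apply, ite_smul, one_smul,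
      zero_smul, Finset.sum_ite_eq, Finset.mem_univ, if_true]
  calc quadElt w e * sharpElt P i a = ∑ b, P a b • (quadElt w e * i b) := by
        simp only [sharpElt, Finset.mul_sum, mul_smul_comm]
    _ = ∑ b, (P a b • i b) * quadElt w e - ∑ b, P a b • sharpElt w e b := by
        simp only [h.quadElt_mul_contr hw, smul_sub, Finset.sum_sub_distrib, smul_mul_assoc]
    _ = _ := by rw [h2, sharpElt, Finset.sum_mul]

/-- The number operator `∑ e_a i_a`. -/
def numElt (e i : ι → A) : A := ∑ a, e a * i a

lemma IsCAR.sum_mul (h : IsCAR e i) :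
    ∑ a, i a * e a = algebraMap ℝ A (Fintype.card ι) - numElt e i := by
  simp [h.ie, Finset.sum_sub_distrib, numElt]

/-- The relation [L, Λ] = N - (dim)/2. The bracket with `L` is a derivation with known values on
both factors of the terms `i a * sharpElt P i a` that make up `Λ`. -/
lemma IsCAR.quadElt_mul_quadElt (h : IsCAR e i) (hw : wᵀ = -w) (hPw : P * w = 1) :
    quadElt w e * quadElt P i - quadElt P i * quadElt w e =
      numElt e i - algebraMap ℝ A (Fintype.card ι / 2) := by
  have hwP : w * P = 1 := mul_eq_one_comm.1 hPw
  have hΛ : quadElt P i = (2⁻¹ : ℝ) • ∑ a, i a * sharpElt P i a := by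
    simp only [quadElt, sharpElt, Finset.mul_sum, mul_smul_comm]
  -- The sum runs over the first index of both matrices; transposing `w` to form the product w P = 1
  -- gives the minus sign.
  have h1 : ∑ a, sharpElt w e a * sharpElt P i a = -numElt e i := by
    have ht : ∀ a b, w a b = -w b a := fun a b => by
      have := congrFun (congrFun hw b) a
      simpa using this
    calc ∑ a, sharpElt w e a * sharpElt P i a
        = ∑ a, ∑ b, ∑ c, (w a b * P a c) • (e b * i c) := by
          simp only [sharpElt, Finset.sum_mul_sum, smul_mul_smul_comm]
      _ = -∑ b, ∑ c, (∑ a, w b a * P a c) • (e b * i c) := by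
          rw [Finset.sum_comm]
          simp only [Finset.sum_smul]
          rw [← Finset.sum_neg_distrib]
          refine Finset.sum_congr rfl fun b _ => ?_
          rw [Finset.sum_comm, ← Finset.sum_neg_distrib]
          refine Finset.sum_congr rfl fun c _ => ?_
          rw [← Finset.sum_neg_distrib]
          refine Finset.sum_congr rfl fun a _ => ?_
          rw [ht a b, neg_mul, neg_smul]
      _ = _ := by
          simp only [← Matrix.mul_apply, hwP, Matrix.one_apply, ite_smul, one_smul, zero_smul,
            Finset.sum_ite_eq, Finset.mem_univ, if_true, numElt]
  have h2 : ∀ a, quadElt w e * (i a * sharpElt P i a) = i a * sharpElt P i a * quadElt w e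
      - i a * e a - sharpElt w e a * sharpElt P i a := by
    intro a
    rw [← mul_assoc, h.quadElt_mul_contr hw, sub_mul, mul_assoc, h.quadElt_mul_sharp hw hPw, mul_sub,
      mul_assoc]
  have h3 : quadElt w e * quadElt P i = quadElt P i * quadElt w e
      - (2⁻¹ : ℝ) • (algebraMap ℝ A (Fintype.card ι) - numElt e i) - (2⁻¹ : ℝ) • -numElt e i := by
    rw [hΛ, mul_smul_comm, Finset.mul_sum, ← h.sum_mul, ← h1]
    simp only [h2, Finset.sum_sub_distrib, smul_sub, Finset.sum_mul, smul_mul_assoc]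
  have h4 : algebraMap ℝ A (Fintype.card ι / 2)
      = (2⁻¹ : ℝ) • algebraMap ℝ A (Fintype.card ι) := by
    rw [div_eq_inv_mul, map_mul, ← Algebra.smul_def]
  rw [h3, h4]
  module

end CAR

/-! ### Operators on mixed exterior forms -/

section Forms

variable (V : Type*) [AddCommGroup V] [Module ℝ V] [TopologicalSpace V]

/-- Not necessarily homogeneous exterior forms on a vector space. -/
def ExtForms : Type _ := ∀ k : ℕ, V [⋀^Fin k]→L[ℝ] ℝ

instance : AddCommGroup (ExtForms V) := inferInstanceAs (AddCommGroup (∀ k : ℕ, V [⋀^Fin k]→L[ℝ] ℝ))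

instance : Module ℝ (ExtForms V) := inferInstanceAs (Module ℝ (∀ k : ℕ, V [⋀^Fin k]→L[ℝ] ℝ))

variable {V}

/-- The component of degree `k` of a mixed form. -/
def degPart (k : ℕ) : ExtForms V →ₗ[ℝ] (V [⋀^Fin k]→L[ℝ] ℝ) where
  toFun α := α k
  map_add' _ _ := rfl
  map_smul' _ _ := rfl

/-- The mixed form with given components. -/
def ofParts (f : ∀ k : ℕ, V [⋀^Fin k]→L[ℝ] ℝ) : ExtForms V := f

lemma degPart_ofParts (f : ∀ k : ℕ, V [⋀^Fin k]→L[ℝ] ℝ) (k : ℕ) : degPart k (ofParts f) = f k := rfl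

/-- A homogeneous form, considered as a mixed form. -/
def homog (k : ℕ) : (V [⋀^Fin k]→L[ℝ] ℝ) →ₗ[ℝ] ExtForms V :=
  LinearMap.single ℝ (fun k : ℕ => V [⋀^Fin k]→L[ℝ] ℝ) k

lemma degPart_homog (k : ℕ) (a : V [⋀^Fin k]→L[ℝ] ℝ) : degPart k (homog k a) = a :=
  Pi.single_eq_same (M := fun k : ℕ => V [⋀^Fin k]→L[ℝ] ℝ) k a

lemma degPart_homog_of_ne {k m : ℕ} (h : m ≠ k) (a : V [⋀^Fin k]→L[ℝ] ℝ) :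
    degPart m (homog k a) = 0 :=
  Pi.single_eq_of_ne (M := fun k : ℕ => V [⋀^Fin k]→L[ℝ] ℝ) h a

@[ext]
lemma ExtForms.ext {α β : ExtForms V} (h : ∀ k, degPart k α = degPart k β) : α = β := funext h

/-- Contraction of a `k + 1`-form with a vector. -/
def contr (X : V) (k : ℕ) : (V [⋀^Fin (k + 1)]→L[ℝ] ℝ) →ₗ[ℝ] (V [⋀^Fin k]→L[ℝ] ℝ) where
  toFun α :=
    { α.toAlternatingMap.curryLeft X with
      cont := by
        change Continuous fun v : Fin k → V => α (Matrix.vecCons X v)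
        exact α.cont.comp (continuous_const.matrixVecCons continuous_id) }
  map_add' _ _ := rfl
  map_smul' _ _ := rfl

lemma contr_apply (X : V) {k : ℕ} (α : V [⋀^Fin (k + 1)]→L[ℝ] ℝ) (v : Fin k → V) :
    contr X k α v = α (Matrix.vecCons X v) := rfl

/-- Exterior product of a covector with a `k`-form, as a plain function. -/
def extMulFun (ξ : V →L[ℝ] ℝ) {k : ℕ} (α : V [⋀^Fin k]→L[ℝ] ℝ) : V [⋀^Fin (k + 1)]→L[ℝ] ℝ :=
  { AlternatingMap.alternatizeUncurryFin (ξ.toLinearMap.smulRight α.toAlternatingMap) with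
    cont := by
      change Continuous fun v : Fin (k + 1) → V =>
        AlternatingMap.alternatizeUncurryFin (ξ.toLinearMap.smulRight α.toAlternatingMap) v
      simp only [AlternatingMap.alternatizeUncurryFin_apply]
      refine continuous_finsetSum _ fun p _ => ?_
      refine Continuous.const_smul (g := fun v : Fin (k + 1) → V => ξ (v p) • α (p.removeNth v)) ?_
        ((-1 : ℤ) ^ (p : ℕ))
      refine (ξ.continuous.comp (continuous_apply p)).smul (α.cont.comp ?_)
      exact continuous_pi fun j => continuous_apply _ }

lemma extMulFun_apply (ξ : V →L[ℝ] ℝ) {k : ℕ} (α : V [⋀^Fin k]→L[ℝ] ℝ) (v : Fin (k + 1) → V) :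
    extMulFun ξ α v = ∑ p : Fin (k + 1), (-1 : ℝ) ^ (p : ℕ) * (ξ (v p) * α (p.removeNth v)) := by
  change AlternatingMap.alternatizeUncurryFin _ v = _
  rw [AlternatingMap.alternatizeUncurryFin_apply]
  refine Finset.sum_congr rfl fun p _ => ?_
  change (-1 : ℤ) ^ (p : ℕ) • (ξ (v p) * α (p.removeNth v)) = _
  rw [zsmul_eq_mul]
  push_cast
  rfl

/-- Exterior product of a covector with a `k`-form. -/
def extMul (ξ : V →L[ℝ] ℝ) (k : ℕ) : (V [⋀^Fin k]→L[ℝ] ℝ) →ₗ[ℝ] (V [⋀^Fin (k + 1)]→L[ℝ] ℝ) where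
  toFun α := extMulFun ξ α
  map_add' α β := by
    ext v
    simp [extMulFun_apply, ← Finset.sum_add_distrib, mul_add]
  map_smul' c α := by
    ext v
    simp only [extMulFun_apply, ContinuousAlternatingMap.smul_apply, RingHom.id_apply, smul_eq_mul,
      Finset.mul_sum]
    exact Finset.sum_congr rfl fun p _ => by ring

lemma extMul_apply (ξ : V →L[ℝ] ℝ) {k : ℕ} (α : V [⋀^Fin k]→L[ℝ] ℝ) (v : Fin (k + 1) → V) :
    extMul ξ k α v = ∑ p : Fin (k + 1), (-1 : ℝ) ^ (p : ℕ) * (ξ (v p) * α (p.removeNth v)) :=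
  extMulFun_apply ξ α v

/-- Contraction with a vector, on mixed forms. -/
def iOp (X : V) : Module.End ℝ (ExtForms V) where
  toFun α k := contr X k (α (k + 1))
  map_add' _ _ := rfl
  map_smul' _ _ := rfl

/-- Exterior product with a covector, on mixed forms. -/
def eOp (ξ : V →L[ℝ] ℝ) : Module.End ℝ (ExtForms V) where
  toFun α
    | 0 => 0
    | k + 1 => extMul ξ k (α k)
  map_add' α β := by
    funext k
    cases k with
    | zero => exact (add_zero _).symm
    | succ k => exact map_add (extMul ξ k) (α k) (β k)
  map_smul' c α := by
    funext k
    cases k with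
    | zero => exact (smul_zero c).symm
    | succ k => exact map_smul (extMul ξ k) c (α k)

lemma iOp_apply (X : V) (α : ExtForms V) (k : ℕ) :
    degPart k (iOp X α) = contr X k (degPart (k + 1) α) := rfl

lemma eOp_apply_zero (ξ : V →L[ℝ] ℝ) (α : ExtForms V) : degPart 0 (eOp ξ α) = 0 := rfl

lemma eOp_apply_succ (ξ : V →L[ℝ] ℝ) (α : ExtForms V) (k : ℕ) :
    degPart (k + 1) (eOp ξ α) = extMul ξ k (degPart k α) := rfl

/-- Peeling off the first argument as a contraction is what allows inductions on the degree. -/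
lemma degPart_succ_apply (α : ExtForms V) (k : ℕ) (v : Fin (k + 1) → V) :
    degPart (k + 1) α v = degPart k (iOp (v 0) α) (Fin.tail v) := by
  rw [iOp_apply, contr_apply]
  congr 1
  exact (Fin.cons_self_tail v).symm

lemma iOp_add (X Y : V) : iOp (X + Y) = iOp X + iOp Y := by
  ext α k v
  exact (degPart (k + 1) α).toAlternatingMap.map_vecCons_add v X Y

lemma iOp_smul (c : ℝ) (X : V) : iOp (c • X) = c • iOp X := by
  ext α k v
  exact (degPart (k + 1) α).toAlternatingMap.map_vecCons_smul v c X

/-- `iOp` as a linear map. -/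
def iOpₗ : V →ₗ[ℝ] Module.End ℝ (ExtForms V) where
  toFun := iOp
  map_add' := iOp_add
  map_smul' := iOp_smul

lemma iOp_sum {ι : Type*} (s : Finset ι) (c : ι → ℝ) (X : ι → V) :
    iOp (∑ a ∈ s, c a • X a) = ∑ a ∈ s, c a • iOp (X a) := by
  change iOpₗ _ = ∑ a ∈ s, c a • iOpₗ (X a)
  simp

/-- Polarisation of the fact that contracting twice with the same vector gives zero. -/
lemma iOp_mul_iOp (X Y : V) : iOp X * iOp Y = -(iOp Y * iOp X) := by
  have h : ∀ Z : V, iOp Z * iOp Z = 0 := by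
    intro Z
    ext α k v
    exact (degPart (k + 2) α).map_eq_zero_of_eq (v := Matrix.vecCons Z (Matrix.vecCons Z v))
      (i := 0) (j := 1) rfl Fin.zero_ne_one
  have := h (X + Y)
  rw [iOp_add, add_mul, mul_add, mul_add, h, h, zero_add, add_zero] at this
  exact eq_neg_of_add_eq_zero_left this

/-- In the alternating sum for ξ ∧ α, the term where ξ takes the first argument gives ξ(X) α; the
others form -ξ ∧ ι_X α. -/
lemma iOp_mul_eOp (X : V) (ξ : V →L[ℝ] ℝ) :
    iOp X * eOp ξ = algebraMap ℝ _ (ξ X) - eOp ξ * iOp X := by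
  ext α k v
  change extMul ξ k (degPart k α) (Matrix.vecCons X v)
    = ξ X * degPart k α v - degPart k (eOp ξ (iOp X α)) v
  rw [extMul_apply, Fin.sum_univ_succ]
  congr 1
  · simp
  · cases k with
    | zero => simp [eOp_apply_zero]
    | succ k =>
      rw [eOp_apply_succ, extMul_apply, ← Finset.sum_neg_distrib]
      refine Finset.sum_congr rfl fun p _ => ?_
      have : p.succ.removeNth (Matrix.vecCons X v) = Matrix.vecCons X (p.removeNth v) := by
        funext j
        refine Fin.cases ?_ (fun j => ?_) j
        · simp [Fin.removeNth]
        · simp [Fin.removeNth]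
      rw [this, Matrix.cons_val_succ, iOp_apply, contr_apply]
      simp [pow_succ]

/-- A form of positive degree is determined by its contractions, so vanishing propagates from degree
0 upwards. -/
lemma eq_zero_of_commute_iOp {T : Module.End ℝ (ExtForms V)} (hT : ∀ X, iOp X * T = T * iOp X)
    (h0 : ∀ α, degPart 0 (T α) = 0) : T = 0 := by
  have key : ∀ k : ℕ, ∀ α, degPart k (T α) = 0 := by
    intro k
    induction k with
    | zero => exact h0
    | succ k ih =>
      intro α
      ext v
      rw [degPart_succ_apply, ← Module.End.mul_apply, hT, Module.End.mul_apply, ih]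
      rfl
  exact LinearMap.ext fun α => ExtForms.ext fun k => key k α

/-- The anticommutator commutes with all contractions and has no component in degree 0, which avoids
any manipulation of double alternating sums. -/
lemma eOp_mul_eOp (ξ η : V →L[ℝ] ℝ) : eOp ξ * eOp η = -(eOp η * eOp ξ) := by
  refine eq_neg_of_add_eq_zero_left (eq_zero_of_commute_iOp (fun X => ?_) fun α => ?_)
  · have h1 : iOp X * (eOp ξ * eOp η) = ξ X • eOp η - η X • eOp ξ + eOp ξ * eOp η * iOp X := by
      rw [← mul_assoc, iOp_mul_eOp, sub_mul, mul_assoc, iOp_mul_eOp, mul_sub, ← Algebra.commutes,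
        ← Algebra.smul_def, ← Algebra.smul_def, mul_assoc]
      abel
    have h2 : iOp X * (eOp η * eOp ξ) = η X • eOp ξ - ξ X • eOp η + eOp η * eOp ξ * iOp X := by
      rw [← mul_assoc, iOp_mul_eOp, sub_mul, mul_assoc, iOp_mul_eOp, mul_sub, ← Algebra.commutes,
        ← Algebra.smul_def, ← Algebra.smul_def, mul_assoc]
      abel
    rw [mul_add, add_mul, h1, h2]
    abel
  · exact add_zero _

/-- The mixed forms that are concentrated in degree `j`. -/
def degForms (V : Type*) [AddCommGroup V] [Module ℝ V] [TopologicalSpace V] (j : ℤ) :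
    Submodule ℝ (ExtForms V) where
  carrier := {α | ∀ k : ℕ, (k : ℤ) ≠ j → degPart k α = 0}
  add_mem' ha hb k hk := by rw [map_add, ha k hk, hb k hk, add_zero]
  zero_mem' _ _ := map_zero _
  smul_mem' r _ ha k hk := by rw [map_smul, ha k hk, smul_zero]

lemma eOp_mem_degForms (ξ : V →L[ℝ] ℝ) {j : ℤ} {α : ExtForms V} (h : α ∈ degForms V j) :
    eOp ξ α ∈ degForms V (j + 1) := by
  intro k hk
  cases k with
  | zero => rfl
  | succ k =>
    rw [eOp_apply_succ, h k (by push_cast at hk; omega), map_zero]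

lemma iOp_mem_degForms (X : V) {j : ℤ} {α : ExtForms V} (h : α ∈ degForms V j) :
    iOp X α ∈ degForms V (j - 1) := by
  intro k hk
  rw [iOp_apply, h (k + 1) (by push_cast; omega), map_zero]

lemma homog_mem_degForms (k : ℕ) (a : V [⋀^Fin k]→L[ℝ] ℝ) : homog k a ∈ degForms V k := by
  intro m hm
  exact degPart_homog_of_ne (by exact_mod_cast hm) a

lemma eq_homog_of_mem_degForms {k : ℕ} {α : ExtForms V} (h : α ∈ degForms V k) :
    α = homog k (degPart k α) := by
  ext m : 1
  by_cases hm : m = k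
  · subst hm
    rw [degPart_homog]
  · rw [degPart_homog_of_ne hm, h m (by exact_mod_cast hm)]

end Forms

/-! ### Horizontal forms -/

section Horizontal

variable {V : Type*} [AddCommGroup V] [Module ℝ V] [TopologicalSpace V] {K : Submodule ℝ V}

/-- The mixed forms that are killed by the contractions with the vectors of `K`. -/
def horForms (K : Submodule ℝ V) : Submodule ℝ (ExtForms V) where
  carrier := {α | ∀ X ∈ K, iOp X α = 0}
  add_mem' ha hb X hX := by rw [map_add, ha X hX, hb X hX, add_zero]
  zero_mem' X _ := map_zero _
  smul_mem' c α ha X hX := by rw [map_smul, ha X hX, smul_zero]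

lemma iOp_mem_horForms {α : ExtForms V} (h : α ∈ horForms K) (X : V) : iOp X α ∈ horForms K := by
  intro Y hY
  rw [← Module.End.mul_apply, iOp_mul_iOp, LinearMap.neg_apply, Module.End.mul_apply, h Y hY,
    map_zero, neg_zero]

lemma eOp_mem_horForms {α : ExtForms V} (h : α ∈ horForms K) {ξ : V →L[ℝ] ℝ}
    (hξ : ∀ v ∈ K, ξ v = 0) : eOp ξ α ∈ horForms K := by
  intro Y hY
  rw [← Module.End.mul_apply, iOp_mul_eOp, LinearMap.sub_apply, Module.End.mul_apply, h Y hY,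
    map_zero, hξ Y hY, map_zero, LinearMap.zero_apply, sub_zero]

lemma iOp_eq_of_sub_mem {α : ExtForms V} (h : α ∈ horForms K) {X Y : V} (hXY : X - Y ∈ K) :
    iOp X α = iOp Y α := by
  have := h _ hXY
  rwa [show iOp (X - Y) = iOp X - iOp Y from map_sub iOpₗ X Y, LinearMap.sub_apply,
    sub_eq_zero] at this

/-- Contractions of horizontal forms are horizontal, so the arguments can be changed modulo K one
after the other. -/
lemma apply_eq_of_mem_horForms {k : ℕ} {α : ExtForms V} (h : α ∈ horForms K) {v u : Fin k → V}
    (hvu : ∀ i, v i - u i ∈ K) : degPart k α v = degPart k α u := by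
  induction k generalizing α with
  | zero => congr 1; exact Subsingleton.elim _ _
  | succ k ih =>
    rw [degPart_succ_apply, degPart_succ_apply α k u, iOp_eq_of_sub_mem h (hvu 0)]
    exact ih (iOp_mem_horForms h _) fun i => hvu i.succ

lemma mem_horForms_iff (α : ExtForms V) :
    α ∈ horForms K ↔ ∀ k, FibreAlg.Horizontal K (degPart k α).toAlternatingMap := by
  constructor
  · rintro h k v ⟨i, hi⟩
    change degPart k α v = 0
    have h1 := apply_eq_of_mem_horForms h (v := v) (u := Function.update v i 0) (fun j => by
      by_cases hj : j = i
      · subst hj; simpa using hi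
      · simp [hj])
    rw [h1]
    exact (degPart k α).map_coord_zero i (by simp)
  · intro h X hX
    ext k v
    exact h (k + 1) (Matrix.vecCons X v) ⟨0, hX⟩

lemma homog_mem_horForms {k : ℕ} {a : V [⋀^Fin k]→L[ℝ] ℝ}
    (h : FibreAlg.Horizontal K a.toAlternatingMap) : homog k a ∈ horForms K := by
  rw [mem_horForms_iff]
  intro m
  by_cases hm : m = k
  · subst hm
    rwa [degPart_homog]
  · rw [degPart_homog_of_ne hm]
    exact fun _ _ => rfl

/-- The form `1` of degree `0`. -/
def oneForm (V : Type*) [AddCommGroup V] [Module ℝ V] [TopologicalSpace V] : ExtForms V :=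
  homog 0 (ContinuousAlternatingMap.constOfIsEmpty ℝ V (Fin 0) 1)

lemma oneForm_mem_degForms : oneForm V ∈ degForms V 0 := homog_mem_degForms 0 _

lemma oneForm_apply_zero (v : Fin 0 → V) : degPart 0 (oneForm V) v = 1 := by
  rw [oneForm, degPart_homog]
  rfl

lemma iOp_oneForm (X : V) : iOp X (oneForm V) = 0 := by
  ext k : 1
  rw [iOp_apply, oneForm_mem_degForms (k + 1) (by omega), map_zero, map_zero]

lemma oneForm_mem_horForms : oneForm V ∈ horForms K := fun X _ => iOp_oneForm X

lemma eq_smul_oneForm {α : ExtForms V} (h : α ∈ degForms V 0) :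
    α = (degPart 0 α ![]) • oneForm V := by
  ext k v
  rw [map_smul]
  cases k with
  | zero =>
    have : v = ![] := Subsingleton.elim _ _
    rw [this, ContinuousAlternatingMap.smul_apply, oneForm_apply_zero, smul_eq_mul, mul_one]
  | succ k =>
    rw [h (k + 1) (by omega), oneForm_mem_degForms (k + 1) (by omega), smul_zero]

/-- A basis of `V` modulo `K`, with the dual covectors. -/
structure NormalFrame (K : Submodule ℝ V) (ι : Type*) [Fintype ι] [DecidableEq ι] where
  X : ι → V
  e : ι → V →L[ℝ] ℝ
  e_X : ∀ a b, e a (X b) = if a = b then 1 else 0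
  e_eq_zero : ∀ a, ∀ v ∈ K, e a v = 0
  sub_mem : ∀ v, v - ∑ a, e a v • X a ∈ K

namespace NormalFrame

variable {ι : Type*} [Fintype ι] [DecidableEq ι] (D : NormalFrame K ι)

/-- Exterior product with the elements of the dual frame. -/
def eo (a : ι) : Module.End ℝ (ExtForms V) := eOp (D.e a)

/-- Contraction with the elements of the frame. -/
def io (a : ι) : Module.End ℝ (ExtForms V) := iOp (D.X a)

lemma isCAR : IsCAR D.eo D.io where
  ee _ _ := eOp_mul_eOp _ _
  ii _ _ := iOp_mul_iOp _ _
  ie a b := by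
    rw [io, eo, iOp_mul_eOp, D.e_X]
    simp only [eq_comm (a := b)]
    split_ifs <;> simp

variable {D} {α : ExtForms V}

lemma eo_mem (h : α ∈ horForms K) (a : ι) : D.eo a α ∈ horForms K :=
  eOp_mem_horForms h (D.e_eq_zero a)

lemma io_mem (h : α ∈ horForms K) (a : ι) : D.io a α ∈ horForms K := iOp_mem_horForms h _

lemma iOp_eq_sum (h : α ∈ horForms K) (v : V) : iOp v α = ∑ a, D.e a v • D.io a α := by
  rw [iOp_eq_of_sub_mem h (D.sub_mem v), iOp_sum]
  simp [io]

/-- Euler's identity. For each position p the sum over the frame rebuilds the contraction with `v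
p`; putting `v p` back in its place costs (-1)^p, which cancels the sign of the term. There are k
equal terms. -/
lemma numElt_apply (h : α ∈ horForms K) (k : ℕ) :
    degPart k (numElt D.eo D.io α) = (k : ℝ) • degPart k α := by
  have h0 : numElt D.eo D.io α = ∑ a, D.eo a (D.io a α) := by simp [numElt]
  rw [h0, map_sum]
  cases k with
  | zero => simp [eo, eOp_apply_zero]
  | succ k =>
    ext v
    simp only [eo, eOp_apply_succ, ContinuousAlternatingMap.sum_apply, extMul_apply]
    rw [Finset.sum_comm]
    have h2 : ∀ p : Fin (k + 1), ∑ a, (-1 : ℝ) ^ (p : ℕ) *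
        (D.e a (v p) * degPart k (D.io a α) (p.removeNth v)) = degPart (k + 1) α v := by
      intro p
      rw [← Finset.mul_sum]
      have h3 : ∑ a, D.e a (v p) * degPart k (D.io a α) (p.removeNth v)
          = degPart k (iOp (v p) α) (p.removeNth v) := by
        rw [iOp_eq_sum (D := D) h, map_sum, ContinuousAlternatingMap.sum_apply]
        simp
      rw [h3, iOp_apply, contr_apply]
      have h4 := (degPart (k + 1) α).toAlternatingMap.neg_one_pow_smul_map_insertNth p (v p)
        (p.removeNth v)
      rw [Fin.insertNth_self_removeNth, zsmul_eq_mul] at h4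
      have h5 : degPart (k + 1) α (Matrix.vecCons (v p) (p.removeNth v))
          = (-1 : ℝ) ^ (p : ℕ) * degPart (k + 1) α v := by
        refine h4.symm.trans ?_
        push_cast
        rfl
      rw [h5, ← mul_assoc, ← mul_pow]
      norm_num
    simp only [h2, Finset.sum_const, Finset.card_univ, Fintype.card_fin]
    simp

lemma numElt_eq_smul {j : ℤ} (h : α ∈ horForms K) (hj : α ∈ degForms V j) :
    numElt D.eo D.io α = (j : ℝ) • α := by
  ext k : 1
  rw [numElt_apply h, map_smul]
  by_cases hk : (k : ℤ) = j
  · rw [← hk]; push_cast; rfl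
  · rw [hj k hk, smul_zero, smul_zero]

/-- The degree is recovered as the eigenvalue of the number operator. -/
lemma mem_degForms_of_numElt {j : ℕ} (h : α ∈ horForms K)
    (hN : numElt D.eo D.io α = (j : ℝ) • α) : α ∈ degForms V j := by
  intro k hk
  have h1 := congrArg (degPart k) hN
  rw [numElt_apply h, map_smul] at h1
  ext v
  have h2 := DFunLike.congr_fun h1 v
  simp only [ContinuousAlternatingMap.smul_apply, smul_eq_mul] at h2
  exact (mul_eq_mul_right_iff.1 h2).resolve_left (by exact_mod_cast hk)

/-- Horizontal forms of positive degree are sums of products. -/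
lemma eq_sum_eo_io {k : ℕ} (h : α ∈ horForms K) (hk : α ∈ degForms V (k + 1 : ℕ)) :
    α = ∑ a, D.eo a (((k + 1 : ℕ) : ℝ)⁻¹ • D.io a α) := by
  have h1 := numElt_eq_smul (D := D) h hk
  have h2 : ((k + 1 : ℕ) : ℝ) ≠ 0 := by exact_mod_cast k.succ_ne_zero
  calc α = ((k + 1 : ℕ) : ℝ)⁻¹ • (((k + 1 : ℕ) : ℝ) • α) := by
        rw [smul_smul, inv_mul_cancel₀ h2, one_smul]
    _ = _ := by
        rw [show ((k + 1 : ℕ) : ℝ) • α = numElt D.eo D.io α by rw [h1]; rfl]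
        simp [numElt, Finset.smul_sum]

/-- Modulo K the arguments come from ℝ^ι, where more than |ι| vectors are linearly dependent. -/
lemma apply_eq_zero_of_card_lt (D : NormalFrame K ι) (h : α ∈ horForms K) {k : ℕ}
    (hk : Fintype.card ι < k) : degPart k α = 0 := by
  ext v
  set T : (ι → ℝ) →ₗ[ℝ] V := Fintype.linearCombination ℝ D.X with hT
  rw [apply_eq_of_mem_horForms h (u := fun i => T fun a => D.e a (v i)) (fun i => by
    rw [hT, Fintype.linearCombination_apply]; exact D.sub_mem (v i))]
  refine ((degPart k α).toAlternatingMap.compLinearMap T).map_linearDependent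
    (fun i a => D.e a (v i)) fun hli => ?_
  have := hli.fintype_card_le_finrank
  simp at this
  omega

lemma eq_zero_of_mem_degForms (D : NormalFrame K ι) (h : α ∈ horForms K) {j : ℤ}
    (hj : α ∈ degForms V j) (hj' : j < 0 ∨ (Fintype.card ι : ℤ) < j) : α = 0 := by
  ext k : 1
  by_cases hk : (k : ℤ) = j
  · exact D.apply_eq_zero_of_card_lt h (by omega)
  · exact hj k hk

end NormalFrame

end Horizontal

/-! ### The Lefschetz operators of a symplectic form -/

section Quad

variable {V : Type*} [AddCommGroup V] [Module ℝ V] [TopologicalSpace V] {ι : Type*} [Fintype ι]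

lemma degPart_quadElt_iOp (P : Matrix ι ι ℝ) (X : ι → V) (α : ExtForms V) (k : ℕ) :
    degPart k (quadElt P (fun a => iOp (X a)) α) = (2⁻¹ : ℝ) • ∑ a, ∑ b,
      P a b • contr (X a) k (contr (X b) (k + 1) (degPart (k + 2) α)) := by
  simp only [quadElt, LinearMap.smul_apply, LinearMap.sum_apply, map_smul, map_sum]
  rfl

lemma degPart_quadElt_eOp (w : Matrix ι ι ℝ) (ξ : ι → V →L[ℝ] ℝ) (α : ExtForms V) (k : ℕ) :
    degPart (k + 2) (quadElt w (fun a => eOp (ξ a)) α) = (2⁻¹ : ℝ) • ∑ a, ∑ b,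
      w a b • extMul (ξ a) (k + 1) (extMul (ξ b) k (degPart k α)) := by
  simp only [quadElt, LinearMap.smul_apply, LinearMap.sum_apply, map_smul, map_sum]
  rfl

lemma degPart_zero_quadElt_eOp (w : Matrix ι ι ℝ) (ξ : ι → V →L[ℝ] ℝ) (α : ExtForms V) :
    degPart 0 (quadElt w (fun a => eOp (ξ a)) α) = 0 := by
  simp [quadElt, eOp_apply_zero]

lemma degPart_one_quadElt_eOp (w : Matrix ι ι ℝ) (ξ : ι → V →L[ℝ] ℝ) (α : ExtForms V) :
    degPart 1 (quadElt w (fun a => eOp (ξ a)) α) = 0 := by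
  simp only [quadElt, LinearMap.smul_apply, LinearMap.sum_apply, map_smul, map_sum,
    Module.End.mul_apply, eOp_apply_succ, eOp_apply_zero, map_zero, smul_zero,
    Finset.sum_const_zero]

lemma quadElt_mem {T : Type*} [AddCommGroup T] [Module ℝ T] {p q r : Submodule ℝ T}
    {f : ι → Module.End ℝ T} (w : Matrix ι ι ℝ) (hp : ∀ a, ∀ x ∈ p, f a x ∈ q)
    (hq : ∀ a, ∀ x ∈ q, f a x ∈ r) {x : T} (hx : x ∈ p) : quadElt w f x ∈ r := by
  simp only [quadElt, LinearMap.smul_apply, LinearMap.sum_apply, Module.End.mul_apply]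
  exact Submodule.smul_mem _ _ (Submodule.sum_mem _ fun a _ => Submodule.sum_mem _ fun b _ =>
    Submodule.smul_mem _ _ (hq a _ (hp b x hx)))

lemma quadElt_iOp_mem_degForms (P : Matrix ι ι ℝ) (X : ι → V) {α : ExtForms V} {j : ℤ}
    (h : α ∈ degForms V j) : quadElt P (fun a => iOp (X a)) α ∈ degForms V (j - 2) := by
  rw [show j - 2 = j - 1 - 1 by ring]
  exact quadElt_mem P (fun a _ hx => iOp_mem_degForms (X a) hx)
    (fun a _ hx => iOp_mem_degForms (X a) hx) h

lemma quadElt_eOp_mem_degForms (w : Matrix ι ι ℝ) (ξ : ι → V →L[ℝ] ℝ) {α : ExtForms V} {j : ℤ}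
    (h : α ∈ degForms V j) : quadElt w (fun a => eOp (ξ a)) α ∈ degForms V (j + 2) := by
  rw [show j + 2 = j + 1 + 1 by ring]
  exact quadElt_mem w (fun a _ hx => eOp_mem_degForms (ξ a) hx)
    (fun a _ hx => eOp_mem_degForms (ξ a) hx) h

lemma sharpElt_iOp (P : Matrix ι ι ℝ) (X : ι → V) (a : ι) :
    sharpElt P (fun a => iOp (X a)) a = iOp (∑ b, P a b • X b) := by
  rw [iOp_sum, sharpElt]

variable [FiniteDimensional ℝ V]

lemma degPart_eq_zero_of_finrank_lt (α : ExtForms V) {k : ℕ} (hk : Module.finrank ℝ V < k) :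
    degPart k α = 0 := by
  ext v
  refine (degPart k α).toAlternatingMap.map_linearDependent v fun hli => ?_
  have := hli.fintype_card_le_finrank
  simp at this
  omega

lemma eq_sum_homog (α : ExtForms V) :
    α = ∑ k ∈ Finset.range (Module.finrank ℝ V + 1), homog k (degPart k α) := by
  ext m : 1
  rw [map_sum]
  by_cases hm : m < Module.finrank ℝ V + 1
  · rw [Finset.sum_eq_single_of_mem m (Finset.mem_range.2 hm), degPart_homog]
    exact fun k _ hk => degPart_homog_of_ne hk.symm _
  · rw [degPart_eq_zero_of_finrank_lt α (by omega), Finset.sum_eq_zero]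
    intro k hk
    exact degPart_homog_of_ne (by have := Finset.mem_range.1 hk; omega) _

/-- Each factor lowers the degree by two, and there are no forms above the dimension. -/
lemma quadElt_iOp_pow (P : Matrix ι ι ℝ) (X : ι → V) :
    quadElt P (fun a => iOp (X a)) ^ (Module.finrank ℝ V + 1) = 0 := by
  have key : ∀ (m : ℕ) (α : ExtForms V) (k : ℕ), Module.finrank ℝ V < k + 2 * m →
      degPart k ((quadElt P (fun a => iOp (X a)) ^ m) α) = 0 := by
    intro m α
    induction m with
    | zero => exact fun k hk => degPart_eq_zero_of_finrank_lt _ hk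
    | succ m ih =>
      intro k hk
      rw [pow_succ', Module.End.mul_apply, degPart_quadElt_iOp, ih (k + 2) (by omega)]
      simp
  exact LinearMap.ext fun α => ExtForms.ext fun k => key _ α k (by omega)

lemma quadElt_eOp_pow (w : Matrix ι ι ℝ) (ξ : ι → V →L[ℝ] ℝ) :
    quadElt w (fun a => eOp (ξ a)) ^ (Module.finrank ℝ V + 1) = 0 := by
  have key : ∀ (m : ℕ) (α : ExtForms V) (k : ℕ), k < 2 * m →
      degPart k ((quadElt w (fun a => eOp (ξ a)) ^ m) α) = 0 := by
    intro m α
    induction m with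
    | zero => exact fun k hk => absurd hk (by omega)
    | succ m ih =>
      intro k hk
      rw [pow_succ', Module.End.mul_apply]
      match k with
      | 0 => exact degPart_zero_quadElt_eOp _ _ _
      | 1 => exact degPart_one_quadElt_eOp _ _ _
      | k + 2 =>
        rw [degPart_quadElt_eOp, ih k (by omega)]
        simp
  refine LinearMap.ext fun α => ExtForms.ext fun k => ?_
  by_cases hk : Module.finrank ℝ V < k
  · exact degPart_eq_zero_of_finrank_lt _ hk
  · exact key _ α k (by omega)

end Quad

section Symplectic

variable {V : Type*} [AddCommGroup V] [Module ℝ V] [TopologicalSpace V] {K : Submodule ℝ V}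

lemma eOp_sum {κ : Type*} (s : Finset κ) (c : κ → ℝ) (ξ : κ → V →L[ℝ] ℝ) :
    eOp (∑ a ∈ s, c a • ξ a) = ∑ a ∈ s, c a • eOp (ξ a) := by
  ext α k v
  simp only [LinearMap.sum_apply, LinearMap.smul_apply, map_sum, map_smul,
    ContinuousAlternatingMap.sum_apply, ContinuousAlternatingMap.smul_apply, smul_eq_mul]
  cases k with
  | zero => simp [eOp_apply_zero]
  | succ k =>
    simp only [eOp_apply_succ, extMul_apply, _root_.sum_apply,
      _root_.smul_apply, Finset.mul_sum, Finset.sum_mul, smul_eq_mul]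
    rw [Finset.sum_comm]
    exact Finset.sum_congr rfl fun p _ => Finset.sum_congr rfl fun p _ => by ring

/-- The covector `w(Y, ·)`. -/
def flat (w : V [⋀^Fin 2]→L[ℝ] ℝ) (Y : V) : V →L[ℝ] ℝ where
  toFun u := w ![Y, u]
  map_add' u v := (contr Y 1 w).toAlternatingMap.map_vecCons_add ![] u v
  map_smul' c u := (contr Y 1 w).toAlternatingMap.map_vecCons_smul ![] c u
  cont := by
    exact w.cont.comp (by fun_prop)

lemma flat_apply (w : V [⋀^Fin 2]→L[ℝ] ℝ) (Y u : V) : flat w Y u = w ![Y, u] := rfl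

lemma flat_add (w : V [⋀^Fin 2]→L[ℝ] ℝ) (Y Z : V) : flat w (Y + Z) = flat w Y + flat w Z :=
  ContinuousLinearMap.ext fun u => w.toAlternatingMap.map_vecCons_add ![u] Y Z

lemma flat_smul (w : V [⋀^Fin 2]→L[ℝ] ℝ) (c : ℝ) (Y : V) : flat w (c • Y) = c • flat w Y :=
  ContinuousLinearMap.ext fun u => w.toAlternatingMap.map_vecCons_smul ![u] c Y

/-- `flat` as a linear map. -/
def flatₗ (w : V [⋀^Fin 2]→L[ℝ] ℝ) : V →ₗ[ℝ] V →L[ℝ] ℝ where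
  toFun := flat w
  map_add' := flat_add w
  map_smul' := flat_smul w

lemma flat_self (w : V [⋀^Fin 2]→L[ℝ] ℝ) (Y : V) : flat w Y Y = 0 :=
  w.map_eq_zero_of_eq (v := ![Y, Y]) (i := 0) (j := 1) rfl Fin.zero_ne_one

lemma flat_swap (w : V [⋀^Fin 2]→L[ℝ] ℝ) (Y u : V) : flat w Y u = -flat w u Y := by
  have := flat_self w (Y + u)
  rw [flat_add, _root_.add_apply, map_add, map_add, flat_self, flat_self, zero_add,
    add_zero] at this
  exact eq_neg_of_add_eq_zero_left this

/-- The 2-form `w` induces a symplectic form on `V ⧸ K`. -/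
structure IsFibreSymplectic (K : Submodule ℝ V) (w : V [⋀^Fin 2]→L[ℝ] ℝ) : Prop where
  flat_eq_zero : ∀ v ∈ K, flat w v = 0
  mem_of_flat : ∀ v, flat w v = 0 → v ∈ K

namespace NormalFrame

variable {ι : Type*} [Fintype ι] [DecidableEq ι] (D : NormalFrame K ι) (w : V [⋀^Fin 2]→L[ℝ] ℝ)

/-- The matrix of a 2-form in a frame. -/
def gram : Matrix ι ι ℝ := Matrix.of fun a b => w ![D.X a, D.X b]

/-- Exterior product with `w`. -/
def lef : Module.End ℝ (ExtForms V) := quadElt (D.gram w) D.eo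

/-- Contraction with the bivector inverse to `w`. -/
def lam : Module.End ℝ (ExtForms V) := quadElt (D.gram w)⁻¹ D.io

/-- Contraction with the vectors that correspond to the dual frame under `w`. -/
def so : ι → Module.End ℝ (ExtForms V) := sharpElt (D.gram w)⁻¹ D.io

lemma gram_apply (a b : ι) : D.gram w a b = flat w (D.X a) (D.X b) := rfl

lemma gram_transpose : (D.gram w)ᵀ = -D.gram w := by
  ext a b
  rw [Matrix.transpose_apply, Matrix.neg_apply, gram_apply, gram_apply, flat_swap]

lemma so_eq (a : ι) : D.so w a = iOp (∑ b, (D.gram w)⁻¹ a b • D.X b) := sharpElt_iOp _ _ _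

variable {D w}

/-- K lies in the radical of `w`, so both arguments may be replaced by their frame components, the
second one by antisymmetry. -/
lemma flat_eq (hw : IsFibreSymplectic K w) (Y : V) :
    flat w Y = ∑ a, D.e a Y • ∑ b, D.gram w a b • D.e b := by
  have h1 : ∀ Y, flat w Y = ∑ a, D.e a Y • flat w (D.X a) := by
    intro Y
    have h2 := hw.flat_eq_zero _ (D.sub_mem Y)
    change flatₗ w _ = 0 at h2
    rw [map_sub, sub_eq_zero] at h2
    change flatₗ w Y = ∑ a, D.e a Y • flatₗ w (D.X a)
    rw [h2]
    simp
  rw [h1]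
  refine Finset.sum_congr rfl fun a _ => congrArg _ (ContinuousLinearMap.ext fun u => ?_)
  rw [flat_swap, h1 u]
  simp [gram_apply, flat_swap w (D.X a), mul_comm]

/-- A vector in the kernel of the matrix gives a combination of the frame lying in the radical,
hence in K, where the dual covectors vanish. -/
lemma isUnit_det_gram (hw : IsFibreSymplectic K w) : IsUnit (D.gram w).det := by
  rw [← Matrix.isUnit_iff_isUnit_det, ← Matrix.mulVec_injective_iff_isUnit]
  rw [← Matrix.coe_mulVecLin, ← LinearMap.ker_eq_bot, LinearMap.ker_eq_bot']
  intro c hc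
  have h1 : flat w (∑ b, c b • D.X b) = 0 := by
    have h0 : ∀ a, D.e a (∑ b, c b • D.X b) = c a := fun a => by simp [D.e_X]
    rw [flat_eq (D := D) hw]
    simp only [h0]
    ext u
    have h2 : ∀ b, ∑ a, c a * D.gram w a b = 0 := by
      intro b
      have := congrFun hc b
      simp only [Matrix.mulVecLin_apply, Matrix.mulVec, dotProduct, Pi.zero_apply] at this
      rw [← neg_eq_zero, ← Finset.sum_neg_distrib, ← this]
      refine Finset.sum_congr rfl fun a _ => ?_
      have h3 := congrFun (congrFun (D.gram_transpose w) a) b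
      rw [Matrix.transpose_apply, Matrix.neg_apply] at h3
      rw [← neg_eq_iff_eq_neg.2 h3]
      ring
    simp only [_root_.sum_apply, _root_.smul_apply, smul_eq_mul,
      Finset.mul_sum]
    rw [Finset.sum_comm]
    simp only [← mul_assoc, ← Finset.sum_mul, h2]
    simp
  have h4 := hw.mem_of_flat _ h1
  funext a
  have := D.e_eq_zero a _ h4
  simpa [D.e_X] using this

lemma inv_gram_mul (hw : IsFibreSymplectic K w) : (D.gram w)⁻¹ * D.gram w = 1 :=
  Matrix.nonsing_inv_mul _ (isUnit_det_gram hw)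

lemma inv_gram_transpose (hw : IsFibreSymplectic K w) : ((D.gram w)⁻¹)ᵀ = -(D.gram w)⁻¹ := by
  rw [Matrix.transpose_nonsing_inv, gram_transpose]
  refine Matrix.inv_eq_left_inv ?_
  rw [neg_mul_neg, inv_gram_mul hw]

/-- This and the next three relations state that `eo a` and `so w a` form a copy of the standard
representation of the Lefschetz sl₂, as `weyl_mul_left` requires. -/
lemma lef_mul_eo (a : ι) : D.lef w * D.eo a = D.eo a * D.lef w := D.isCAR.quadElt_mul a

lemma lef_mul_so (hw : IsFibreSymplectic K w) (a : ι) :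
    D.lef w * D.so w a = D.so w a * D.lef w - D.eo a :=
  D.isCAR.quadElt_mul_sharp (D.gram_transpose w) (inv_gram_mul hw) a

lemma lam_mul_eo (hw : IsFibreSymplectic K w) (a : ι) :
    D.lam w * D.eo a = D.eo a * D.lam w - D.so w a :=
  D.isCAR.symm.quadElt_mul_contr (inv_gram_transpose hw) a

lemma lam_mul_so (a : ι) : D.lam w * D.so w a = D.so w a * D.lam w := by
  simp only [so, sharpElt, Finset.mul_sum, Finset.sum_mul, mul_smul_comm, smul_mul_assoc]
  exact Finset.sum_congr rfl fun b _ => congrArg _ (D.isCAR.symm.quadElt_mul b)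

lemma lef_mul_lam (hw : IsFibreSymplectic K w) :
    D.lef w * D.lam w - D.lam w * D.lef w =
      numElt D.eo D.io - algebraMap ℝ _ (Fintype.card ι / 2) :=
  D.isCAR.quadElt_mul_quadElt (D.gram_transpose w) (inv_gram_mul hw)

/-- For an arbitrary vector, split into its K-part, whose contraction commutes with `lef`, and its
frame part. It serves to identify L(1) with `w`. -/
lemma lef_mul_iOp (hw : IsFibreSymplectic K w) (Y : V) :
    D.lef w * iOp Y = iOp Y * D.lef w - eOp (flat w Y) := by
  have hK : ∀ Z ∈ K, D.lef w * iOp Z = iOp Z * D.lef w := by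
    intro Z hZ
    have h1 : ∀ a, D.eo a * iOp Z = -(iOp Z * D.eo a) := by
      intro a
      rw [eo, iOp_mul_eOp, D.e_eq_zero a Z hZ]
      simp
    simp only [lef, quadElt, smul_mul_assoc, mul_smul_comm, Finset.sum_mul, Finset.mul_sum]
    congr 1
    refine Finset.sum_congr rfl fun a _ => Finset.sum_congr rfl fun b _ => ?_
    rw [mul_assoc, h1, mul_neg, ← mul_assoc, h1, neg_mul, neg_neg, mul_assoc]
  have h1 : iOp Y = iOp (Y - ∑ a, D.e a Y • D.X a) + ∑ a, D.e a Y • D.io a := by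
    rw [show iOp (Y - ∑ a, D.e a Y • D.X a) = iOp Y - iOp (∑ a, D.e a Y • D.X a) from
      map_sub iOpₗ _ _, iOp_sum]
    simp [io]
  have h2 : ∀ a, D.lef w * D.io a = D.io a * D.lef w - sharpElt (D.gram w) D.eo a := fun a =>
    D.isCAR.quadElt_mul_contr (D.gram_transpose w) a
  have h3 : eOp (flat w Y) = ∑ a, D.e a Y • sharpElt (D.gram w) D.eo a := by
    rw [flat_eq (D := D) hw, eOp_sum]
    simp only [eOp_sum]
    rfl
  rw [h3, h1, mul_add, hK _ (D.sub_mem Y), add_mul, Finset.mul_sum, Finset.sum_mul]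
  simp only [mul_smul_comm, smul_mul_assoc, h2, smul_sub, Finset.sum_sub_distrib]
  abel

variable {α : ExtForms V}

lemma lef_mem (h : α ∈ horForms K) : D.lef w α ∈ horForms K :=
  quadElt_mem (D.gram w) (fun a _ hx => eo_mem hx a) (fun a _ hx => eo_mem hx a) h

lemma lam_mem (h : α ∈ horForms K) : D.lam w α ∈ horForms K :=
  quadElt_mem (D.gram w)⁻¹ (fun a _ hx => io_mem hx a) (fun a _ hx => io_mem hx a) h

lemma lef_mem_degForms {j : ℤ} (h : α ∈ degForms V j) : D.lef w α ∈ degForms V (j + 2) :=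
  quadElt_eOp_mem_degForms _ _ h

lemma lam_mem_degForms {j : ℤ} (h : α ∈ degForms V j) : D.lam w α ∈ degForms V (j - 2) :=
  quadElt_iOp_mem_degForms _ _ h

/-! ### Independence of the Lefschetz operators from the frame -/

section Change

variable {ι' : Type*} [Fintype ι'] [DecidableEq ι'] (D' : NormalFrame K ι')

/-- The transition matrix between two frames. -/
def transition (D : NormalFrame K ι) (D' : NormalFrame K ι') : Matrix ι' ι ℝ :=
  Matrix.of fun a c => D.e c (D'.X a)

lemma e_eq_sum_transition (c : ι) : D.e c = ∑ a, D.transition D' a c • D'.e a := by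
  ext v
  have := D.e_eq_zero c _ (D'.sub_mem v)
  rw [map_sub, sub_eq_zero] at this
  rw [this]
  simp [transition, mul_comm]

lemma transition_mul_transition : D'.transition D * D.transition D' = 1 := by
  ext c d
  have := congrArg (fun ξ => ξ (D.X c)) (e_eq_sum_transition (D := D) D' d)
  simp only [D.e_X, _root_.sum_apply, _root_.smul_apply] at this
  simp only [Matrix.mul_apply, Matrix.one_apply, eq_comm (a := c)]
  rw [this]
  exact Finset.sum_congr rfl fun a _ => mul_comm _ _

lemma gram_change (hw : IsFibreSymplectic K w) :
    D'.gram w = transition D D' * D.gram w * (transition D D')ᵀ := by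
  ext a b
  rw [gram_apply, flat_eq (D := D) hw]
  simp only [_root_.sum_apply, _root_.smul_apply, Matrix.mul_apply,
    Matrix.transpose_apply, transition, Matrix.of_apply, smul_eq_mul, Finset.sum_mul,
    Finset.mul_sum]
  rw [Finset.sum_comm]
  exact Finset.sum_congr rfl fun c _ => Finset.sum_congr rfl fun d _ => by ring

/-- The bivector inverse to `w` is intrinsic: its matrix transforms contragrediently to that of `w`.
-/
lemma inv_gram_change (hw : IsFibreSymplectic K w) :
    (transition D D')ᵀ * (D'.gram w)⁻¹ * transition D D' = (D.gram w)⁻¹ := by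
  symm
  refine Matrix.inv_eq_left_inv ?_
  have h1 : (transition D D')ᵀ * (D'.gram w)⁻¹ * D'.gram w = (transition D D')ᵀ := by
    rw [Matrix.mul_assoc, inv_gram_mul hw, Matrix.mul_one]
  have h2 : (transition D D')ᵀ * (transition D' D)ᵀ = 1 := by
    rw [← Matrix.transpose_mul, transition_mul_transition, Matrix.transpose_one]
  have h3 : (transition D D')ᵀ * (D'.gram w)⁻¹ * D'.gram w * (transition D' D)ᵀ = 1 := by
    rw [h1, h2]
  generalize (D'.gram w)⁻¹ = P at h3 ⊢
  rw [gram_change (D := D) D' hw] at h3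
  simp only [Matrix.mul_assoc] at h3 ⊢
  rwa [h2, Matrix.mul_one] at h3

lemma quadElt_change {A : Type*} [Ring A] [Algebra ℝ A] {κ κ' : Type*} [Fintype κ] [Fintype κ']
    (w : Matrix κ κ ℝ) (E : Matrix κ' κ ℝ) (f : κ' → A) :
    quadElt w (fun c => ∑ a, E a c • f a) = quadElt (E * w * Eᵀ) f := by
  simp only [quadElt]
  congr 1
  simp only [Finset.sum_mul, Finset.mul_sum, smul_mul_smul_comm, Finset.smul_sum, smul_smul,
    Matrix.mul_apply, Matrix.transpose_apply, Finset.sum_smul]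
  calc _ = ∑ c, ∑ a, ∑ d, ∑ b, (w c d * (E a c * E b d)) • (f a * f b) :=
        Finset.sum_congr rfl fun c _ =>
          (Finset.sum_congr rfl fun d _ => Finset.sum_comm).trans Finset.sum_comm
    _ = ∑ a, ∑ c, ∑ b, ∑ d, (w c d * (E a c * E b d)) • (f a * f b) := by
        rw [Finset.sum_comm]
        exact Finset.sum_congr rfl fun a _ => Finset.sum_congr rfl fun c _ => Finset.sum_comm
    _ = ∑ a, ∑ b, ∑ d, ∑ c, (w c d * (E a c * E b d)) • (f a * f b) := by
        refine Finset.sum_congr rfl fun a _ => ?_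
        rw [Finset.sum_comm]
        exact Finset.sum_congr rfl fun b _ => Finset.sum_comm
    _ = _ := by
        refine Finset.sum_congr rfl fun a _ => Finset.sum_congr rfl fun b _ =>
          Finset.sum_congr rfl fun d _ => Finset.sum_congr rfl fun c _ => ?_
        congr 1
        ring

/-- Frames are chosen separately at each point of the manifold; independence allows a constant frame
to be used throughout a chart. -/
lemma lef_change (hw : IsFibreSymplectic K w) : D.lef w = D'.lef w := by
  have : D.eo = fun c => ∑ a, transition D D' a c • D'.eo a := by
    funext c
    rw [eo, e_eq_sum_transition D' c, eOp_sum]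
    rfl
  rw [lef, lef, gram_change (D := D) D' hw, this, quadElt_change]

/-- Frame vectors matter only modulo K, so here agreement is obtained on horizontal forms, not on
all forms. -/
lemma lam_change (hw : IsFibreSymplectic K w) (h : α ∈ horForms K) :
    D.lam w α = D'.lam w α := by
  have h1 : ∀ β ∈ horForms K, ∀ a, D'.io a β = (∑ c, (transition D D')ᵀ c a • D.io c) β := by
    intro β hβ a
    rw [io, iOp_eq_sum (D := D) hβ]
    simp [transition]
  have h2 : quadElt (D'.gram w)⁻¹ D'.io α
      = quadElt (D'.gram w)⁻¹ (fun a => ∑ c, (transition D D')ᵀ c a • D.io c) α := by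
    unfold quadElt
    rw [LinearMap.smul_apply, LinearMap.smul_apply, LinearMap.sum_apply, LinearMap.sum_apply]
    congr 1
    refine Finset.sum_congr rfl fun a _ => ?_
    rw [LinearMap.sum_apply, LinearMap.sum_apply]
    refine Finset.sum_congr rfl fun b _ => ?_
    rw [LinearMap.smul_apply, LinearMap.smul_apply, Module.End.mul_apply, Module.End.mul_apply,
      ← h1 _ h b, ← h1 _ (io_mem h b) a]
  rw [lam, lam, h2, quadElt_change, Matrix.transpose_transpose, inv_gram_change D' hw]

end Change

end NormalFrame

end Symplectic

/-! ### The Weyl element of the Lefschetz `sl₂` on a symplectic vector space -/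

namespace NormalFrame

variable {V : Type*} [AddCommGroup V] [Module ℝ V] [TopologicalSpace V] {K : Submodule ℝ V}
  {ι : Type*} [Fintype ι] [DecidableEq ι] {D : NormalFrame K ι} {w : V [⋀^Fin 2]→L[ℝ] ℝ}
  {α : ExtForms V}

lemma card_le_finrank [FiniteDimensional ℝ V] (D : NormalFrame K ι) :
    Fintype.card ι ≤ Module.finrank ℝ V := by
  have h : Function.Injective (Fintype.linearCombination ℝ D.X) := by
    rw [injective_iff_map_eq_zero]
    intro c hc
    funext a
    have := congrArg (D.e a) hc
    rw [Fintype.linearCombination_apply] at this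
    simpa [D.e_X] using this
  simpa using LinearMap.finrank_le_finrank_of_injective h

lemma so_mem (h : α ∈ horForms K) (a : ι) : D.so w a α ∈ horForms K := by
  rw [so_eq]
  exact iOp_mem_horForms h _

lemma so_mem_degForms {j : ℤ} (h : α ∈ degForms V j) (a : ι) : D.so w a α ∈ degForms V (j - 1) := by
  rw [so_eq]
  exact iOp_mem_degForms _ h

lemma eo_mem_degForms {j : ℤ} (h : α ∈ degForms V j) (a : ι) : D.eo a α ∈ degForms V (j + 1) :=
  eOp_mem_degForms _ h

lemma io_mem_degForms {k : ℕ} (h : α ∈ degForms V (k + 1 : ℕ)) (a : ι) :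
    D.io a α ∈ degForms V k :=
  (by push_cast; ring : ((k + 1 : ℕ) : ℤ) - 1 = k) ▸ iOp_mem_degForms (D.X a) h

lemma io_eq_sum_so (hw : IsFibreSymplectic K w) (a : ι) :
    D.io a = ∑ b, D.gram w a b • D.so w b := by
  simp only [so, sharpElt, Finset.smul_sum, smul_smul]
  rw [Finset.sum_comm]
  have h : D.gram w * (D.gram w)⁻¹ = 1 := Matrix.mul_nonsing_inv _ (isUnit_det_gram hw)
  simp only [← Finset.sum_smul, ← Matrix.mul_apply, h,
    Matrix.one_apply, ite_smul, one_smul, zero_smul, Finset.sum_ite_eq, Finset.mem_univ, if_true]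

lemma mem_degForms_zero_of_so (hw : IsFibreSymplectic K w) (h : α ∈ horForms K)
    (hs : ∀ a, D.so w a α = 0) : α ∈ degForms V 0 := by
  refine mem_degForms_of_numElt (D := D) (j := 0) h ?_
  have h1 : ∀ a, D.io a α = 0 := fun a => by
    rw [io_eq_sum_so hw, LinearMap.sum_apply]
    exact Finset.sum_eq_zero fun b _ => by rw [LinearMap.smul_apply, hs, smul_zero]
  simp [numElt, h1]

/-- ∑ ι_a e_a equals the rank minus the number operator, so a form killed by all `e_a` has top
degree. -/
lemma mem_degForms_card_of_eo (h : α ∈ horForms K) (he : ∀ a, D.eo a α = 0) :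
    α ∈ degForms V (Fintype.card ι) := by
  have h1 : (∑ a, D.io a * D.eo a) α = 0 := by simp [he]
  rw [D.isCAR.sum_mul, LinearMap.sub_apply, sub_eq_zero] at h1
  exact mem_degForms_of_numElt (D := D) h h1.symm

/-! ### The sl₂-string through the form 1 -/

section Pow

lemma lef_pow_mem (m : ℕ) (h : α ∈ horForms K) : (D.lef w ^ m) α ∈ horForms K := by
  induction m with
  | zero => exact h
  | succ m ih => rw [pow_succ', Module.End.mul_apply]; exact lef_mem ih

lemma lef_pow_one_mem_degForms (m : ℕ) : (D.lef w ^ m) (oneForm V) ∈ degForms V (2 * m : ℕ) := by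
  induction m with
  | zero => exact oneForm_mem_degForms
  | succ m ih =>
    rw [pow_succ', Module.End.mul_apply]
    exact (by push_cast; ring : ((2 * (m + 1) : ℕ) : ℤ) = (2 * m : ℕ) + 2) ▸ lef_mem_degForms ih

variable {q : ℕ}

lemma lef_mul_lam_apply (hw : IsFibreSymplectic K w) (hq : Fintype.card ι = 2 * q) {j : ℤ}
    (h : α ∈ horForms K) (hj : α ∈ degForms V j) :
    D.lam w (D.lef w α) = D.lef w (D.lam w α) - ((j : ℝ) - q) • α := by
  have h1 := LinearMap.congr_fun (lef_mul_lam (D := D) hw) α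
  simp only [LinearMap.sub_apply, Module.End.mul_apply] at h1
  rw [numElt_eq_smul h hj, Module.algebraMap_end_apply, hq] at h1
  have h2 : ((2 * q : ℕ) : ℝ) / 2 = q := by push_cast; ring
  rw [h2] at h1
  rw [sub_smul, ← h1]
  abel

lemma lam_oneForm : D.lam w (oneForm V) = 0 := by
  simp [lam, quadElt, io, iOp_oneForm]

/-- The form 1 is a lowest weight vector of weight -q. -/
lemma lam_lef_pow_succ (hw : IsFibreSymplectic K w) (hq : Fintype.card ι = 2 * q) (m : ℕ) :
    D.lam w ((D.lef w ^ (m + 1)) (oneForm V)) =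
      ((m + 1 : ℝ) * (q - m)) • (D.lef w ^ m) (oneForm V) := by
  induction m with
  | zero =>
    rw [pow_succ', Module.End.mul_apply, lef_mul_lam_apply hw hq (lef_pow_mem _ oneForm_mem_horForms)
      (lef_pow_one_mem_degForms 0), pow_zero, Module.End.one_apply, lam_oneForm, map_zero]
    push_cast
    module
  | succ m ih =>
    rw [pow_succ' _ (m + 1), Module.End.mul_apply, lef_mul_lam_apply hw hq
      (lef_pow_mem _ oneForm_mem_horForms) (lef_pow_one_mem_degForms (m + 1)), ih, map_smul,
      ← Module.End.mul_apply, ← pow_succ']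
    push_cast
    module

lemma lam_pow_lef_pow (hw : IsFibreSymplectic K w) (hq : Fintype.card ι = 2 * q) (m : ℕ)
    (hm : m ≤ q) : (D.lam w ^ m) ((D.lef w ^ m) (oneForm V)) =
      ((m ! : ℝ) * (q.descFactorial m : ℝ)) • oneForm V := by
  induction m with
  | zero => simp
  | succ m ih =>
    rw [pow_succ, Module.End.mul_apply, lam_lef_pow_succ hw hq, map_smul, ih (by omega), smul_smul,
      Nat.factorial_succ, Nat.descFactorial_succ, ← Nat.cast_sub (by omega)]
    push_cast
    congr 1
    ring

end Pow

/-! ### The Weyl element in degrees 0 and top, and its square -/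

section Weyl

variable [FiniteDimensional ℝ V]

variable (D w) in
/-- The Weyl element of the Lefschetz `sl₂`. -/
def weylOp : Module.End ℝ (ExtForms V) := weyl (Module.finrank ℝ V + 1) (D.lef w) (D.lam w)

lemma lef_pow_eq_zero : D.lef w ^ (Module.finrank ℝ V + 1) = 0 := quadElt_eOp_pow _ _

lemma lam_pow_eq_zero : D.lam w ^ (Module.finrank ℝ V + 1) = 0 := quadElt_iOp_pow _ _

lemma weylOp_eo (hw : IsFibreSymplectic K w) (a : ι) (β : ExtForms V) :
    D.weylOp w (D.eo a β) = D.so w a (D.weylOp w β) :=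
  LinearMap.congr_fun (weyl_mul_left lef_pow_eq_zero lam_pow_eq_zero (lef_mul_eo a)
    (lam_mul_eo hw a) (lef_mul_so hw a) (lam_mul_so a)) β

lemma weylOp_so (hw : IsFibreSymplectic K w) (a : ι) (β : ExtForms V) :
    D.weylOp w (D.so w a β) = -D.eo a (D.weylOp w β) := by
  have := LinearMap.congr_fun (weyl_mul_right (lef_pow_eq_zero (D := D) (w := w)) lam_pow_eq_zero (lef_mul_eo a)
    (lam_mul_eo hw a) (lef_mul_so hw a) (lam_mul_so a)) β
  rw [Module.End.mul_apply, Module.End.mul_apply, LinearMap.neg_apply] at this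
  exact this

lemma weylOp_mem (h : α ∈ horForms K) : D.weylOp w α ∈ horForms K := by
  have hL : ∀ β ∈ horForms K, D.lef w β ∈ horForms K := fun β hβ => lef_mem hβ
  have hΛ : ∀ β ∈ horForms K, (-D.lam w) β ∈ horForms K := fun β hβ =>
    Submodule.neg_mem _ (lam_mem hβ)
  exact nexp_mem _ hL _ (nexp_mem _ hΛ _ (nexp_mem _ hL _ h))

variable (D w) in
/-- The volume form `w ^ q / q!`. -/
def volForm (q : ℕ) : ExtForms V := ((q ! : ℝ))⁻¹ • (D.lef w ^ q) (oneForm V)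

lemma volForm_mem (q : ℕ) : D.volForm w q ∈ horForms K :=
  Submodule.smul_mem _ _ (lef_pow_mem _ oneForm_mem_horForms)

lemma volForm_mem_degForms (q : ℕ) : D.volForm w q ∈ degForms V (2 * q : ℕ) :=
  Submodule.smul_mem _ _ (lef_pow_one_mem_degForms _)

variable {q : ℕ}

lemma lef_volForm (hq : Fintype.card ι = 2 * q) : D.lef w (D.volForm w q) = 0 :=
  D.eq_zero_of_mem_degForms (lef_mem (volForm_mem q)) (lef_mem_degForms (volForm_mem_degForms q))
    (Or.inr (by omega))

lemma eo_volForm (hq : Fintype.card ι = 2 * q) (a : ι) : D.eo a (D.volForm w q) = 0 :=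
  D.eq_zero_of_mem_degForms (eo_mem (volForm_mem q) a) (eo_mem_degForms (volForm_mem_degForms q) a)
    (Or.inr (by omega))

lemma degPart_lam_eq_zero (hq : Fintype.card ι = 2 * q) (h : α ∈ horForms K) :
    degPart (2 * q) (D.lam w α) = 0 := by
  refine (degPart_quadElt_iOp _ _ _ _).trans ?_
  rw [D.apply_eq_zero_of_card_lt h (by omega)]
  simp

lemma degPart_nexp_lam (hq : Fintype.card ι = 2 * q) (h : α ∈ horForms K) (N : ℕ) :
    degPart (2 * q) (nexp (N + 1) (-D.lam w) α) = degPart (2 * q) α := by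
  have h0 : ∀ m : ℕ, ((-D.lam w) ^ m) α ∈ horForms K := by
    intro m
    induction m with
    | zero => exact h
    | succ m ih =>
      rw [pow_succ', Module.End.mul_apply]
      exact Submodule.neg_mem _ (lam_mem ih)
  have h1 : ∀ m : ℕ, degPart (2 * q) (((-D.lam w) ^ (m + 1)) α) = 0 := by
    intro m
    rw [pow_succ', Module.End.mul_apply, LinearMap.neg_apply, map_neg,
      degPart_lam_eq_zero hq (h0 m), neg_zero]
  rw [nexp, Finset.sum_range_succ', LinearMap.add_apply, LinearMap.sum_apply, map_add, map_sum,
    Finset.sum_eq_zero fun m _ => by rw [LinearMap.smul_apply, map_smul, h1, smul_zero]]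
  simp

lemma degPart_nexp_lef_one {N : ℕ} (hN : q < N) :
    degPart (2 * q) (nexp N (D.lef w) (oneForm V)) = degPart (2 * q) (D.volForm w q) := by
  rw [nexp, LinearMap.sum_apply, map_sum, Finset.sum_eq_single_of_mem q (Finset.mem_range.2 hN)]
  · rfl
  · intro m _ hm
    rw [LinearMap.smul_apply, map_smul,
      lef_pow_one_mem_degForms m (2 * q) (by push_cast; omega), smul_zero]

/-- By `mul_nexp_mul_nexp` every `e_a` kills this form, because every contraction kills 1. It is
therefore of top degree, where e^{-Λ} changes nothing and e^L contributes only ω^q/q!. -/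
lemma nexp_lam_nexp_lef_one (hw : IsFibreSymplectic K w) (hq : Fintype.card ι = 2 * q) :
    nexp (Module.finrank ℝ V + 1) (-D.lam w) (nexp (Module.finrank ℝ V + 1) (D.lef w) (oneForm V)) =
      D.volForm w q := by
  have hL : nexp (Module.finrank ℝ V + 1) (D.lef w) (oneForm V) ∈ horForms K :=
    nexp_mem _ (fun β hβ => lef_mem hβ) _ oneForm_mem_horForms
  have hu := nexp_mem (a := -D.lam w) (horForms K)
    (fun β hβ => Submodule.neg_mem _ (lam_mem hβ)) (Module.finrank ℝ V + 1) hL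
  have hdeg := mem_degForms_card_of_eo (D := D) hu fun a => by
    have h1 := LinearMap.congr_fun (mul_nexp_mul_nexp (lef_pow_eq_zero (D := D) (w := w))
      lam_pow_eq_zero (lef_mul_eo a) (lam_mul_eo hw a) (lef_mul_so hw a) (lam_mul_so a)) (oneForm V)
    simp only [Module.End.mul_apply, LinearMap.neg_apply] at h1
    rw [h1, so_eq, iOp_oneForm, map_zero, map_zero, neg_zero]
  rw [hq] at hdeg
  have := D.card_le_finrank
  rw [eq_homog_of_mem_degForms hdeg, eq_homog_of_mem_degForms (volForm_mem_degForms (D := D) q),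
    degPart_nexp_lam hq hL, degPart_nexp_lef_one (by omega)]

lemma weylOp_one (hw : IsFibreSymplectic K w) (hq : Fintype.card ι = 2 * q) :
    D.weylOp w (oneForm V) = D.volForm w q := by
  rw [weylOp, weyl, mul_assoc, Module.End.mul_apply, Module.End.mul_apply,
    nexp_lam_nexp_lef_one hw hq, nexp_apply_of_eq_zero (lef_volForm hq)]

lemma degPart_zero_nexp_lef (N : ℕ) :
    degPart 0 (nexp (N + 1) (D.lef w) α) = degPart 0 α := by
  have h1 : ∀ m : ℕ, degPart 0 ((D.lef w ^ (m + 1)) α) = 0 := by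
    intro m
    rw [pow_succ', Module.End.mul_apply]
    exact degPart_zero_quadElt_eOp _ _ _
  rw [nexp, Finset.sum_range_succ', LinearMap.add_apply, LinearMap.sum_apply, map_add, map_sum,
    Finset.sum_eq_zero fun m _ => by rw [LinearMap.smul_apply, map_smul, h1, smul_zero]]
  simp

lemma lam_pow_mem_degForms (m : ℕ) {j : ℤ} (h : α ∈ degForms V j) :
    (D.lam w ^ m) α ∈ degForms V (j - 2 * m) := by
  induction m with
  | zero => simpa using h
  | succ m ih =>
    rw [pow_succ', Module.End.mul_apply]
    exact (by push_cast; ring : j - 2 * (m + 1 : ℕ) = j - 2 * m - 2) ▸ lam_mem_degForms ih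

/-- Exterior products kill the volume form, so contractions kill its image, which is thus a
constant. Only the q-th term of e^{-Λ} reaches degree 0, and its coefficient is (-1)^q (q!)² /
(q!)². -/
lemma weylOp_volForm (hw : IsFibreSymplectic K w) (hq : Fintype.card ι = 2 * q) :
    D.weylOp w (D.volForm w q) = (-1 : ℝ) ^ q • oneForm V := by
  have h0 := mem_degForms_zero_of_so hw (weylOp_mem (D := D) (w := w) (volForm_mem (w := w) q)) fun a => by
    rw [← weylOp_eo hw, eo_volForm hq, map_zero]
  have hqN : q < Module.finrank ℝ V + 1 := by
    have := D.card_le_finrank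
    omega
  have h1 : degPart 0 (D.weylOp w (D.volForm w q)) = (-1 : ℝ) ^ q • degPart 0 (oneForm V) := by
    rw [weylOp, weyl, mul_assoc, Module.End.mul_apply, Module.End.mul_apply,
      nexp_apply_of_eq_zero (lef_volForm hq), degPart_zero_nexp_lef, nexp, LinearMap.sum_apply,
      map_sum, Finset.sum_eq_single_of_mem q (Finset.mem_range.2 hqN)]
    · have hf : (q ! : ℝ) ≠ 0 := by exact_mod_cast q.factorial_ne_zero
      rw [LinearMap.smul_apply, volForm, map_smul, ← neg_one_smul ℝ (D.lam w), smul_pow,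
        LinearMap.smul_apply, map_smul (D.lam w ^ q), lam_pow_lef_pow hw hq q le_rfl, Nat.descFactorial_self]
      simp only [map_smul, smul_smul]
      congr 1
      field_simp
    · intro m _ hm
      rw [LinearMap.smul_apply, ← neg_one_smul ℝ (D.lam w), smul_pow, LinearMap.smul_apply,
        map_smul, map_smul, lam_pow_mem_degForms m (volForm_mem_degForms q) 0
          (by push_cast; omega), smul_zero, smul_zero]
  rw [eq_homog_of_mem_degForms (k := 0) h0, h1, ← map_smul]
  rw [eq_homog_of_mem_degForms (k := 0)
    (Submodule.smul_mem _ ((-1 : ℝ) ^ q) oneForm_mem_degForms), degPart_homog]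

/-- W turns each exterior factor into a contraction, starting from W(1) in degree 2q. -/
lemma weylOp_mem_degForms (hw : IsFibreSymplectic K w) (hq : Fintype.card ι = 2 * q) {k : ℕ}
    (h : α ∈ horForms K) (hk : α ∈ degForms V k) : D.weylOp w α ∈ degForms V (2 * q - k) := by
  induction k generalizing α with
  | zero =>
    rw [eq_smul_oneForm hk, map_smul, weylOp_one hw hq]
    exact Submodule.smul_mem _ _ (by simpa using volForm_mem_degForms q)
  | succ k ih =>
    rw [eq_sum_eo_io (D := D) h hk, map_sum]
    refine Submodule.sum_mem _ fun a _ => ?_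
    rw [weylOp_eo hw]
    have h1 := so_mem_degForms (D := D) (w := w) (ih (Submodule.smul_mem _ (((k + 1 : ℕ) : ℝ)⁻¹)
      (io_mem (D := D) h a)) (Submodule.smul_mem _ _ (io_mem_degForms hk a))) a
    exact (by push_cast; ring : (2 * q - (k + 1 : ℕ) : ℤ) = 2 * q - k - 1) ▸ h1

/-- W² anticommutes with each exterior product, so every degree adds a sign to the value (-1)^q on
constants. -/
lemma weylOp_weylOp (hw : IsFibreSymplectic K w) (hq : Fintype.card ι = 2 * q) {k : ℕ}
    (h : α ∈ horForms K) (hk : α ∈ degForms V k) :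
    D.weylOp w (D.weylOp w α) = (-1 : ℝ) ^ (k + q) • α := by
  induction k generalizing α with
  | zero =>
    rw [eq_smul_oneForm hk, map_smul, map_smul, weylOp_one hw hq, weylOp_volForm hw hq, zero_add,
      smul_comm]
  | succ k ih =>
    have h1 : ∀ a, D.weylOp w (D.weylOp w (D.eo a (((k + 1 : ℕ) : ℝ)⁻¹ • D.io a α))) =
        (-1 : ℝ) ^ (k + 1 + q) • D.eo a (((k + 1 : ℕ) : ℝ)⁻¹ • D.io a α) := by
      intro a
      rw [weylOp_eo hw, weylOp_so hw, ih (Submodule.smul_mem _ _ (io_mem h a))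
        (Submodule.smul_mem _ _ (io_mem_degForms hk a)), map_smul, ← neg_smul]
      congr 1
      ring
    have h2 := eq_sum_eo_io (D := D) h hk
    calc _ = D.weylOp w (D.weylOp w (∑ a, D.eo a (((k + 1 : ℕ) : ℝ)⁻¹ • D.io a α))) := by rw [← h2]
      _ = (-1 : ℝ) ^ (k + 1 + q) • ∑ a, D.eo a (((k + 1 : ℕ) : ℝ)⁻¹ • D.io a α) := by
        rw [map_sum, map_sum, Finset.smul_sum]
        exact Finset.sum_congr rfl fun a _ => h1 a
      _ = _ := by rw [← h2]

end Weyl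

end NormalFrame

/-! ### Exterior products of covectors -/

section Wedge

variable {V : Type*} [AddCommGroup V] [Module ℝ V]

namespace FibreAlg

lemma wedge_eq {k l : ℕ} (a : V [⋀^Fin k]→ₗ[ℝ] ℝ) (b : V [⋀^Fin l]→ₗ[ℝ] ℝ) (v : Fin (k + l) → V) :
    wedge a b v = LinearMap.mul' ℝ ℝ
      (AlternatingMap.domCoprod' (a ⊗ₜ[ℝ] b) (fun i => v (finSumFinEquiv i))) := rfl

/-- The exterior product as a bilinear map. -/
def wedgeₗ (k l : ℕ) : (V [⋀^Fin k]→ₗ[ℝ] ℝ) →ₗ[ℝ] (V [⋀^Fin l]→ₗ[ℝ] ℝ) →ₗ[ℝ]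
    (V [⋀^Fin (k + l)]→ₗ[ℝ] ℝ) :=
  LinearMap.mk₂ ℝ wedge
    (fun a a' b => by ext v; simp [wedge_eq, TensorProduct.add_tmul])
    (fun c a b => by ext v; simp [wedge_eq, ← TensorProduct.smul_tmul'])
    (fun a b b' => by ext v; simp [wedge_eq, TensorProduct.tmul_add])
    (fun c a b => by ext v; simp [wedge_eq, TensorProduct.tmul_smul])

lemma wedgeₗ_apply {k l : ℕ} (a : V [⋀^Fin k]→ₗ[ℝ] ℝ) (b : V [⋀^Fin l]→ₗ[ℝ] ℝ) :
    wedgeₗ k l a b = wedge a b := rfl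

end FibreAlg

/-- The exterior product of covectors. -/
def detForm {κ : Type*} [Fintype κ] [DecidableEq κ] (ξ : κ → V →ₗ[ℝ] ℝ) : V [⋀^κ]→ₗ[ℝ] ℝ :=
  MultilinearMap.alternatization ((MultilinearMap.mkPiAlgebra ℝ κ ℝ).compLinearMap ξ)

lemma detForm_apply {κ : Type*} [Fintype κ] [DecidableEq κ] (ξ : κ → V →ₗ[ℝ] ℝ) (v : κ → V) :
    detForm ξ v = (Matrix.of fun i j => ξ i (v j)).det := by
  rw [detForm, MultilinearMap.alternatization_apply, ← Matrix.det_transpose, Matrix.det_apply]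
  refine Finset.sum_congr rfl fun σ _ => ?_
  simp

/-- Both sides are the alternatization of the same product of covectors. This ties the shuffle
definition of `wedge` to operators of exterior multiplication. -/
lemma wedge_detForm {k l : ℕ} (ξ : Fin k → V →ₗ[ℝ] ℝ) (η : Fin l → V →ₗ[ℝ] ℝ) :
    FibreAlg.wedge (detForm ξ) (detForm η) = detForm (Fin.append ξ η) := by
  ext v
  rw [FibreAlg.wedge, AlternatingMap.domDomCongr_apply, LinearMap.compAlternatingMap_apply, detForm,
    detForm, ← MultilinearMap.domCoprod_alternization, MultilinearMap.alternatization_apply,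
    map_sum, detForm_apply, ← Matrix.det_submatrix_equiv_self finSumFinEquiv,
    ← Matrix.det_transpose, Matrix.det_apply]
  refine Finset.sum_congr rfl fun σ _ => ?_
  rw [Units.smul_def, map_zsmul, ← Units.smul_def]
  simp [Fintype.prod_sum_type]

variable [TopologicalSpace V]

/-- The operator of exterior product with `ξ₁ ∧ ⋯ ∧ ξ_k`. -/
def eProd {k : ℕ} (ξ : Fin k → V →L[ℝ] ℝ) : Module.End ℝ (ExtForms V) :=
  (List.ofFn fun i => eOp (ξ i)).prod

lemma eProd_succ {k : ℕ} (ξ : Fin (k + 1) → V →L[ℝ] ℝ) :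
    eProd ξ = eOp (ξ 0) * eProd fun i => ξ i.succ := by
  rw [eProd, List.ofFn_succ, List.prod_cons, eProd]

lemma eProd_append {k l : ℕ} (ξ : Fin k → V →L[ℝ] ℝ) (η : Fin l → V →L[ℝ] ℝ) :
    eProd (Fin.append ξ η) = eProd ξ * eProd η := by
  rw [eProd, eProd, eProd, ← List.prod_append, ← List.ofFn_fin_append]
  congr 2
  funext i
  refine Fin.addCases (fun i => ?_) (fun i => ?_) i <;> simp

/-- Multiplication by one more covector is the Laplace expansion along the first row. -/
lemma degPart_eProd_one {k : ℕ} (ξ : Fin k → V →L[ℝ] ℝ) :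
    (degPart k (eProd ξ (oneForm V))).toAlternatingMap = detForm fun i => (ξ i).toLinearMap := by
  induction k with
  | zero =>
    ext v
    rw [detForm_apply, Matrix.det_isEmpty]
    exact oneForm_apply_zero v
  | succ k ih =>
    ext v
    rw [eProd_succ, detForm_apply, Matrix.det_succ_row_zero]
    change degPart (k + 1) (eOp (ξ 0) (eProd _ (oneForm V))) v = _
    rw [eOp_apply_succ, extMul_apply]
    refine Finset.sum_congr rfl fun p _ => ?_
    rw [mul_assoc]
    have := DFunLike.congr_fun (ih fun i => ξ i.succ) (p.removeNth v)
    rw [detForm_apply] at this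
    exact congrArg _ (congrArg _ this)

lemma eProd_mem_degForms {k : ℕ} (ξ : Fin k → V →L[ℝ] ℝ) {j : ℤ} {α : ExtForms V}
    (h : α ∈ degForms V j) : eProd ξ α ∈ degForms V (j + k) := by
  induction k with
  | zero => simpa [eProd] using h
  | succ k ih =>
    rw [eProd_succ, Module.End.mul_apply]
    exact (by push_cast; ring : j + (k + 1 : ℕ) = j + k + 1) ▸ eOp_mem_degForms _ (ih _)

lemma wedge_eProd_eProd {k l : ℕ} (ξ : Fin k → V →L[ℝ] ℝ) (η : Fin l → V →L[ℝ] ℝ) :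
    FibreAlg.wedge (degPart k (eProd ξ (oneForm V))).toAlternatingMap
      (degPart l (eProd η (oneForm V))).toAlternatingMap =
      (degPart (k + l) (eProd ξ (eProd η (oneForm V)))).toAlternatingMap := by
  rw [degPart_eProd_one, degPart_eProd_one, wedge_detForm, ← Module.End.mul_apply, ← eProd_append,
    degPart_eProd_one]
  congr 1
  funext i
  refine Fin.addCases (fun i => ?_) (fun i => ?_) i <;> simp

lemma domDomCongr_degPart {k m : ℕ} (h : k = m) (α : ExtForms V) :
    (degPart k α).toAlternatingMap.domDomCongr (finCongr h) = (degPart m α).toAlternatingMap := by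
  subst h
  rfl

/-- `degPart` with values in the algebraic alternating maps. -/
def degPartAlt (V : Type*) [AddCommGroup V] [Module ℝ V] [TopologicalSpace V] (k : ℕ) :
    ExtForms V →ₗ[ℝ] (V [⋀^Fin k]→ₗ[ℝ] ℝ) where
  toFun α := (degPart k α).toAlternatingMap
  map_add' _ _ := rfl
  map_smul' _ _ := rfl

end Wedge

namespace NormalFrame

open FibreAlg

variable {V : Type*} [AddCommGroup V] [Module ℝ V] [TopologicalSpace V] {K : Submodule ℝ V}
  {ι : Type*} [Fintype ι] [DecidableEq ι] {D : NormalFrame K ι} {w : V [⋀^Fin 2]→L[ℝ] ℝ}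
  {α β : ExtForms V} {k l : ℕ}

variable (D) in
/-- The operator of exterior product with a product of elements of the dual frame. -/
def ePr (I : Fin k → ι) : Module.End ℝ (ExtForms V) := eProd fun s => D.e (I s)

variable (D w) in
/-- The composition of the contractions with vectors of the frame that is dual with respect to `w`. -/
def sPr (I : Fin k → ι) : Module.End ℝ (ExtForms V) := (List.ofFn fun s => D.so w (I s)).prod

lemma ePr_succ (I : Fin (k + 1) → ι) : D.ePr I = D.eo (I 0) * D.ePr (fun s => I s.succ) :=
  eProd_succ _

lemma sPr_succ (I : Fin (k + 1) → ι) : D.sPr w I = D.so w (I 0) * D.sPr w (fun s => I s.succ) := by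
  rw [sPr, List.ofFn_succ, List.prod_cons, sPr]

lemma mem_span_ePr (h : α ∈ horForms K) (hk : α ∈ degForms V k) :
    α ∈ Submodule.span ℝ (Set.range fun I : Fin k → ι => D.ePr I (oneForm V)) := by
  induction k generalizing α with
  | zero =>
    rw [eq_smul_oneForm hk]
    exact Submodule.smul_mem _ _ (Submodule.subset_span ⟨Fin.elim0, rfl⟩)
  | succ k ih =>
    rw [eq_sum_eo_io (D := D) h hk]
    refine Submodule.sum_mem _ fun a _ => ?_
    have h1 := ih (Submodule.smul_mem _ (((k + 1 : ℕ) : ℝ)⁻¹) (io_mem (D := D) h a))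
      (Submodule.smul_mem _ _ (io_mem_degForms hk a))
    have h2 := Submodule.mem_map_of_mem (f := D.eo a) h1
    rw [Submodule.map_span, ← Set.range_comp] at h2
    refine Submodule.span_mono ?_ h2
    rintro _ ⟨I, rfl⟩
    refine ⟨Fin.cons a I, ?_⟩
    simp only [ePr_succ, Fin.cons_zero, Fin.cons_succ, Function.comp_apply, Module.End.mul_apply]

/-- Both sides are linear in β, and horizontal forms are spanned by monomials in the dual frame. -/
lemma wedge_eProd (D : NormalFrame K ι) (ξ : Fin k → V →L[ℝ] ℝ) (h : β ∈ horForms K)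
    (hl : β ∈ degForms V l) :
    wedge (degPart k (eProd ξ (oneForm V))).toAlternatingMap (degPart l β).toAlternatingMap =
      (degPart (k + l) (eProd ξ β)).toAlternatingMap := by
  have key : ∀ β ∈ Submodule.span ℝ (Set.range fun J : Fin l → ι => D.ePr J (oneForm V)),
      (wedgeₗ k l (degPart k (eProd ξ (oneForm V))).toAlternatingMap ∘ₗ degPartAlt V l) β =
        (degPartAlt V (k + l) ∘ₗ eProd ξ) β := by
    intro β hβ
    refine LinearMap.eqOn_span (s := Set.range fun J : Fin l → ι => D.ePr J (oneForm V)) ?_ hβ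
    rintro _ ⟨J, rfl⟩
    exact wedge_eProd_eProd _ _
  exact key β (mem_span_ePr h hl)

lemma wedge_ePr (I : Fin k → ι) (h : β ∈ horForms K) (hl : β ∈ degForms V l) :
    wedge (degPart k (D.ePr I (oneForm V))).toAlternatingMap (degPart l β).toAlternatingMap =
      (degPart (k + l) (D.ePr I β)).toAlternatingMap :=
  D.wedge_eProd _ h hl

lemma lef_one (hw : IsFibreSymplectic K w) : D.lef w (oneForm V) = homog 2 w := by
  rw [eq_homog_of_mem_degForms (k := 2) (lef_mem_degForms (D := D) (w := w) oneForm_mem_degForms)]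
  congr 1
  ext v
  have h1 := LinearMap.congr_fun (lef_mul_iOp (D := D) hw (v 0)) (oneForm V)
  rw [Module.End.mul_apply, iOp_oneForm, map_zero, LinearMap.sub_apply, Module.End.mul_apply,
    eq_comm, sub_eq_zero] at h1
  rw [degPart_succ_apply, h1, eOp_apply_succ, extMul_apply]
  simp only [Fin.sum_univ_succ, Finset.univ_eq_empty, Finset.sum_empty, oneForm_apply_zero]
  simp only [Fin.val_zero, pow_zero, flat_apply, mul_one, one_mul, add_zero]
  congr 1
  funext i
  fin_cases i <;> rfl

lemma lef_ePr (I : Fin k → ι) (α : ExtForms V) : D.lef w (D.ePr I α) = D.ePr I (D.lef w α) := by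
  induction k with
  | zero => rfl
  | succ k ih =>
    have h1 := LinearMap.congr_fun (lef_mul_eo (D := D) (w := w) (I 0)) (D.ePr (fun s => I s.succ) α)
    rw [Module.End.mul_apply, Module.End.mul_apply] at h1
    rw [ePr_succ, Module.End.mul_apply, h1, ih, Module.End.mul_apply]

/-- `wedgePow` multiplies by `w` on the right while `lef` multiplies on the left; on monomials they
agree because `lef` commutes with exterior products. -/
lemma wedge_self_eq_lef (hw : IsFibreSymplectic K w) (h : α ∈ horForms K)
    (hk : α ∈ degForms V k) :
    wedge (degPart k α).toAlternatingMap w.toAlternatingMap =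
      (degPart (k + 2) (D.lef w α)).toAlternatingMap := by
  have key : ∀ β ∈ Submodule.span ℝ (Set.range fun J : Fin k → ι => D.ePr J (oneForm V)),
      ((wedgeₗ k 2).flip w.toAlternatingMap ∘ₗ degPartAlt V k) β =
        (degPartAlt V (k + 2) ∘ₗ D.lef w) β := by
    intro β hβ
    refine LinearMap.eqOn_span (s := Set.range fun J : Fin k → ι => D.ePr J (oneForm V)) ?_ hβ
    rintro _ ⟨J, rfl⟩
    have h1 := wedge_ePr (D := D) J (lef_mem (D := D) (w := w) oneForm_mem_horForms)
      (lef_mem_degForms (D := D) (w := w) oneForm_mem_degForms)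
    rw [← lef_ePr] at h1
    change wedge _ (degPart 2 _).toAlternatingMap = _ at h1
    rw [lef_one hw, degPart_homog] at h1
    exact h1
  exact key α (mem_span_ePr h hk)

lemma wedgePow_eq (hw : IsFibreSymplectic K w) (q : ℕ) :
    wedgePow w.toAlternatingMap q =
      (degPart (2 * q) ((D.lef w ^ q) (oneForm V))).toAlternatingMap := by
  induction q with
  | zero =>
    ext v
    exact (oneForm_apply_zero v).symm
  | succ q ih =>
    rw [wedgePow, ih, wedge_self_eq_lef (D := D) hw (lef_pow_mem _ oneForm_mem_horForms)
      (lef_pow_one_mem_degForms q), ← Module.End.mul_apply, ← pow_succ']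
    rfl

lemma sPr_mem_degForms (I : Fin k → ι) {j : ℤ} (h : α ∈ degForms V j) :
    D.sPr w I α ∈ degForms V (j - k) := by
  induction k with
  | zero => simpa [sPr] using h
  | succ k ih =>
    rw [sPr_succ, Module.End.mul_apply]
    exact (by push_cast; ring : j - (k + 1 : ℕ) = j - k - 1) ▸ so_mem_degForms (ih _) _

lemma so_mul_so (a b : ι) : D.so w a * D.so w b = -(D.so w b * D.so w a) := by
  rw [so_eq, so_eq, iOp_mul_iOp]

lemma so_mul_sPr (a : ι) (I : Fin k → ι) :
    D.so w a * D.sPr w I = (-1 : ℝ) ^ k • (D.sPr w I * D.so w a) := by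
  induction k with
  | zero => simp [sPr]
  | succ k ih =>
    rw [sPr_succ, ← mul_assoc, so_mul_so (D := D) a, neg_mul, mul_assoc, ih, mul_smul_comm, pow_succ,
      ← mul_assoc, mul_neg_one, neg_smul]

variable (D w) in
/-- The vectors that correspond to the dual frame under `w`. -/
def Y (a : ι) : V := ∑ b, (D.gram w)⁻¹ a b • D.X b

/-- The contractions insert the vectors in reversed order; (-1)^{k(k-1)/2} is the sign of the
reversal. -/
lemma degPart_zero_sPr (I : Fin k → ι) (α : ExtForms V) :
    degPart 0 (D.sPr w I α) ![] = (-1 : ℝ) ^ (k.choose 2) * degPart k α (fun s => D.Y w (I s)) := by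
  induction k generalizing α with
  | zero =>
    simp only [sPr, List.ofFn_zero, List.prod_nil, Module.End.one_apply, Nat.choose_zero_succ,
      pow_zero, one_mul]
    congr 1
    exact Subsingleton.elim _ _
  | succ k ih =>
    rw [sPr_succ, so_mul_sPr, LinearMap.smul_apply, Module.End.mul_apply, map_smul,
      ContinuousAlternatingMap.smul_apply, ih, Nat.choose_succ_succ' k 1, Nat.choose_one_right,
      pow_add, smul_eq_mul, mul_assoc, degPart_succ_apply α, so_eq]
    rfl

variable [FiniteDimensional ℝ V] {q : ℕ}

lemma ePr_weylOp (hw : IsFibreSymplectic K w) (I : Fin k → ι) (β : ExtForms V) :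
    D.ePr I (D.weylOp w β) = (-1 : ℝ) ^ k • D.weylOp w (D.sPr w I β) := by
  induction k with
  | zero => simp [ePr, eProd, sPr]
  | succ k ih =>
    rw [ePr_succ, Module.End.mul_apply, ih, map_smul, sPr_succ, Module.End.mul_apply, weylOp_so hw,
      pow_succ, mul_neg_one, smul_neg, neg_smul, neg_neg]

/-- Moving W to the left turns the k exterior factors into contractions at the cost of (-1)^k. These
reduce β to a constant, and W(1) is the volume form. With the sign of the reversal the exponent
becomes k(k+1)/2. -/
lemma wedge_ePr_weylOp (hw : IsFibreSymplectic K w) (hq : Fintype.card ι = 2 * q)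
    (h : k + l = 2 * q) (I : Fin k → ι) (hβ : β ∈ horForms K) (hk : β ∈ degForms V k) :
    (wedge (degPart k (D.ePr I (oneForm V))).toAlternatingMap
      (degPart l (D.weylOp w β)).toAlternatingMap).domDomCongr (finCongr h) =
      ((-1 : ℝ) ^ ((k + 1).choose 2) * degPart k β (fun s => D.Y w (I s)) * ((q ! : ℝ))⁻¹) •
        wedgePow w.toAlternatingMap q := by
  have hl : D.weylOp w β ∈ degForms V l :=
    (by omega : (2 * q - k : ℤ) = l) ▸ weylOp_mem_degForms hw hq hβ hk
  rw [wedge_ePr I (weylOp_mem hβ) hl, domDomCongr_degPart h, ePr_weylOp hw,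
    eq_smul_oneForm (α := D.sPr w I β) (by simpa using sPr_mem_degForms I hk), degPart_zero_sPr,
    map_smul (D.weylOp w), weylOp_one hw hq, volForm, wedgePow_eq (D := D) hw, Nat.choose_succ_succ' k 1,
    Nat.choose_one_right, pow_add, smul_smul, smul_smul, map_smul]
  have : (-1 : ℝ) ^ k * ((-1) ^ k.choose 2 * degPart k β fun s => D.Y w (I s)) * ((q ! : ℝ))⁻¹ =
    (-1 : ℝ) ^ k * (-1) ^ k.choose 2 * (degPart k β fun s => D.Y w (I s)) * ((q ! : ℝ))⁻¹ := by ring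
  rw [this]
  rfl

/-- The vectors `Y` span V modulo K, since the matrix relating them to the frame is invertible. -/
lemma eq_zero_of_apply_Y (hw : IsFibreSymplectic K w) (h : α ∈ horForms K) (hk : α ∈ degForms V k)
    (h0 : ∀ I : Fin k → ι, degPart k α (fun s => D.Y w (I s)) = 0) : α = 0 := by
  induction k generalizing α with
  | zero =>
    rw [eq_smul_oneForm hk]
    have := h0 Fin.elim0
    rw [show (fun s => D.Y w (Fin.elim0 s)) = ![] from Subsingleton.elim _ _] at this
    rw [this, zero_smul]
  | succ k ih =>
    have h1 : ∀ a, D.so w a α = 0 := fun a =>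
      ih (so_mem h a) ((by push_cast; ring : ((k + 1 : ℕ) : ℤ) - 1 = k) ▸ so_mem_degForms hk a)
        fun I => by
          have := h0 (Fin.cons a I)
          rw [degPart_succ_apply] at this
          rw [so_eq]
          exact this
    have h2 := mem_degForms_zero_of_so hw h h1
    ext m : 1
    by_cases hm : (m : ℤ) = 0
    · rw [hk m (by push_cast; omega), map_zero]
    · rw [h2 m hm, map_zero]

end NormalFrame

/-! ### The symplectic star operator in terms of the Weyl element -/

namespace FibreAlg

open NormalFrame

variable {V : Type*} [AddCommGroup V] [Module ℝ V] [FiniteDimensional ℝ V] [TopologicalSpace V]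
  [IsTopologicalAddGroup V] [ContinuousSMul ℝ V] [T2Space V]

/-- The frame of `V` modulo `K` that is given by `frame K`. -/
def normalFrame (K : Submodule ℝ V) : NormalFrame K (Fin (Module.finrank ℝ (V ⧸ K))) where
  X := frame K
  e a := LinearMap.toContinuousLinearMap ((Module.finBasis ℝ (V ⧸ K)).coord a ∘ₗ K.mkQ)
  e_X a b := by
    simp only [LinearMap.coe_toContinuousLinearMap', LinearMap.comp_apply, frame,
      Function.surjInv_eq]
    simp [Finsupp.single_apply, eq_comm]
  e_eq_zero a v hv := by
    simp [(Submodule.Quotient.mk_eq_zero K).2 hv]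
  sub_mem v := by
    rw [← Submodule.Quotient.mk_eq_zero, ← Submodule.mkQ_apply, map_sub, map_sum, sub_eq_zero]
    have h : ∀ a, K.mkQ (frame K a) = Module.finBasis ℝ (V ⧸ K) a := fun a =>
      Function.surjInv_eq K.mkQ_surjective _
    simp only [map_smul, h]
    exact ((Module.finBasis ℝ (V ⧸ K)).sum_repr _).symm

variable {K : Submodule ℝ V} {w : V [⋀^Fin 2]→L[ℝ] ℝ} {k l q : ℕ}

lemma sum_gram_eq (b : V [⋀^Fin k]→L[ℝ] ℝ) (I : Fin k → Fin (Module.finrank ℝ (V ⧸ K))) :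
    ∑ J : Fin k → Fin (Module.finrank ℝ (V ⧸ K)),
      (∏ s, (gram K w.toAlternatingMap)⁻¹ (I s) (J s)) * b (fun s => frame K (J s)) =
        b fun s => (normalFrame K).Y w (I s) := by
  simp only [Y]
  refine Eq.trans ?_ (b.toMultilinearMap.map_sum
    (fun s c => ((normalFrame K).gram w)⁻¹ (I s) c • (normalFrame K).X c)).symm
  refine Finset.sum_congr rfl fun J _ => ?_
  rw [MultilinearMap.map_smul_univ]
  rfl

lemma detForm_frame (I J : Fin k → Fin (Module.finrank ℝ (V ⧸ K))) :
    degPart k ((normalFrame K).ePr I (oneForm V)) (fun s => frame K (J s)) =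
      ∑ τ : Equiv.Perm (Fin k), (Equiv.Perm.sign τ : ℤ) • if J ∘ τ = I then (1 : ℝ) else 0 := by
  have h := DFunLike.congr_fun (degPart_eProd_one fun s => (normalFrame K).e (I s))
    (fun s => frame K (J s))
  refine h.trans ?_
  rw [detForm_apply, ← Matrix.det_transpose, Matrix.det_apply]
  refine Finset.sum_congr rfl fun τ _ => ?_
  rw [Units.smul_def]
  congr 1
  have h1 : ∀ i, (Matrix.of fun i j => ((normalFrame K).e (I i)).toLinearMap (frame K (J j)))ᵀ
      (τ i) i = if J (τ i) = I i then (1 : ℝ) else 0 := fun i => by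
    refine ((normalFrame K).e_X (I i) (J (τ i))).trans ?_
    simp [eq_comm]
  simp only [h1, Finset.prod_ite_zero, Finset.prod_const_one, funext_iff, Function.comp_apply,
    Finset.mem_univ, true_imp_iff]

/-- A monomial takes the values 0, ±1 on frame vectors. The k! permutations give equal
contributions, which cancels the factor 1/k!. -/
lemma pairing_ePr (b : V [⋀^Fin k]→L[ℝ] ℝ) (I : Fin k → Fin (Module.finrank ℝ (V ⧸ K))) :
    pairing K w.toAlternatingMap
      (degPart k ((normalFrame K).ePr I (oneForm V))).toAlternatingMap b.toAlternatingMap =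
        b fun s => (normalFrame K).Y w (I s) := by
  have h1 : ∀ J : Fin k → Fin (Module.finrank ℝ (V ⧸ K)),
      ∑ L : Fin k → Fin (Module.finrank ℝ (V ⧸ K)),
      (∏ s, (gram K w.toAlternatingMap)⁻¹ (J s) (L s)) *
        (degPart k ((normalFrame K).ePr I (oneForm V))).toAlternatingMap (fun s => frame K (J s)) *
        b.toAlternatingMap (fun s => frame K (L s)) =
      ∑ τ : Equiv.Perm (Fin k), if J = I ∘ ⇑τ⁻¹ then
        (Equiv.Perm.sign τ : ℤ) • b (fun s => (normalFrame K).Y w (J s)) else 0 := by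
    intro J
    have h2 := detForm_frame I J
    rw [← sum_gram_eq]
    calc _ = (∑ τ : Equiv.Perm (Fin k), (Equiv.Perm.sign τ : ℤ) • if J ∘ τ = I then (1 : ℝ) else 0)
          * ∑ L : Fin k → Fin (Module.finrank ℝ (V ⧸ K)),
            (∏ s, (gram K w.toAlternatingMap)⁻¹ (J s) (L s)) * b (fun s => frame K (L s)) := by
          rw [← h2, Finset.mul_sum]
          refine Finset.sum_congr rfl fun L _ => ?_
          change _ * degPart k ((normalFrame K).ePr I (oneForm V)) (fun s => frame K (J s)) *
            b (fun s => frame K (L s)) = _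
          ring
      _ = _ := by
          rw [Finset.sum_mul]
          refine Finset.sum_congr rfl fun τ _ => ?_
          have : J ∘ ⇑τ = I ↔ J = I ∘ ⇑τ⁻¹ := by
            constructor
            · rintro rfl
              funext s
              simp
            · rintro rfl
              funext s
              simp
          simp only [this]
          split_ifs <;> simp
  have h3 : ∀ τ : Equiv.Perm (Fin k), (Equiv.Perm.sign τ : ℤ) •
      b (fun s => (normalFrame K).Y w ((I ∘ ⇑τ⁻¹) s)) = b fun s => (normalFrame K).Y w (I s) := by
    intro τ
    have h4 := b.toAlternatingMap.map_perm (fun s => (normalFrame K).Y w (I s)) τ⁻¹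
    change b (fun s => (normalFrame K).Y w ((I ∘ ⇑τ⁻¹) s)) = _ • b _ at h4
    rw [h4, Equiv.Perm.sign_inv, Units.smul_def, smul_smul]
    simp
  have hf : (k ! : ℝ) ≠ 0 := by exact_mod_cast k.factorial_ne_zero
  rw [pairing, Finset.sum_congr rfl fun J _ => h1 J, Finset.sum_comm]
  simp only [Finset.sum_ite_eq', Finset.mem_univ, if_true, h3, Finset.sum_const, Finset.card_univ,
    Fintype.card_perm, Fintype.card_fin, nsmul_eq_mul]
  rw [← mul_assoc, inv_mul_cancel₀ hf, one_mul]

/-- The pairing as a linear map in the first argument. -/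
def pairingₗ (K : Submodule ℝ V) (w : V [⋀^Fin 2]→ₗ[ℝ] ℝ) (b : V [⋀^Fin k]→ₗ[ℝ] ℝ) :
    (V [⋀^Fin k]→ₗ[ℝ] ℝ) →ₗ[ℝ] ℝ where
  toFun a := pairing K w a b
  map_add' a a' := by
    simp only [pairing, AlternatingMap.add_apply, mul_add, add_mul, Finset.sum_add_distrib]
  map_smul' c a := by
    simp only [pairing, AlternatingMap.smul_apply, Finset.mul_sum, smul_eq_mul, RingHom.id_apply]
    exact Finset.sum_congr rfl fun _ _ => Finset.sum_congr rfl fun _ _ => by ring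

lemma mem_span_ePr_of_horizontal {a : V [⋀^Fin k]→L[ℝ] ℝ} (ha : Horizontal K a.toAlternatingMap) :
    homog k a ∈ Submodule.span ℝ (Set.range fun I : Fin k → Fin (Module.finrank ℝ (V ⧸ K)) =>
      (normalFrame K).ePr I (oneForm V)) :=
  mem_span_ePr (homog_mem_horForms ha) (homog_mem_degForms k a)

/-- By linearity in `a` it is enough to test monomials, where pairing and exterior product are both
evaluation of `b` on the vectors `Y`; the two signs cancel. -/
lemma isStar_weylOp (hw : IsFibreSymplectic K w) (hq : Module.finrank ℝ (V ⧸ K) = 2 * q)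
    (h : k + l = 2 * q) {b : V [⋀^Fin k]→L[ℝ] ℝ} (hb : Horizontal K b.toAlternatingMap) :
    IsStar K w.toAlternatingMap q h b
      ((-1 : ℝ) ^ ((k + 1).choose 2) • degPart l ((normalFrame K).weylOp w (homog k b))) := by
  have hh := homog_mem_horForms hb
  refine ⟨?_, fun a ha => ?_⟩
  · have := (mem_horForms_iff _).1 (Submodule.smul_mem _ ((-1 : ℝ) ^ ((k + 1).choose 2))
      (weylOp_mem (D := normalFrame K) (w := w) hh)) l
    rwa [map_smul] at this
  · set c := degPart l ((normalFrame K).weylOp w (homog k b)) with hc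
    have key : ((AlternatingMap.domDomCongrₗ ℝ (finCongr h)).toLinearMap ∘ₗ
        (wedgeₗ k l).flip ((-1 : ℝ) ^ ((k + 1).choose 2) • c).toAlternatingMap ∘ₗ
        degPartAlt V k) (homog k a) =
        ((pairingₗ K w.toAlternatingMap b.toAlternatingMap ∘ₗ degPartAlt V k).smulRight
          (((q ! : ℝ))⁻¹ • wedgePow w.toAlternatingMap q)) (homog k a) := by
      refine LinearMap.eqOn_span ?_ (mem_span_ePr_of_horizontal ha)
      rintro _ ⟨I, rfl⟩
      have h1 := wedge_ePr_weylOp (D := normalFrame K) hw (by simpa using hq) h I hh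
        (homog_mem_degForms k b)
      rw [← hc, degPart_homog] at h1
      have h2 := pairing_ePr (w := w) b I
      have h3 : wedge (degPart k ((normalFrame K).ePr I (oneForm V))).toAlternatingMap
          ((-1 : ℝ) ^ ((k + 1).choose 2) • c).toAlternatingMap =
          (-1 : ℝ) ^ ((k + 1).choose 2) • wedge
            (degPart k ((normalFrame K).ePr I (oneForm V))).toAlternatingMap c.toAlternatingMap :=
        map_smul (wedgeₗ k l (degPart k ((normalFrame K).ePr I (oneForm V))).toAlternatingMap) _
          c.toAlternatingMap
      change (wedge (degPart k ((normalFrame K).ePr I (oneForm V))).toAlternatingMap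
          ((-1 : ℝ) ^ ((k + 1).choose 2) • c).toAlternatingMap).domDomCongr (finCongr h) =
        pairing K w.toAlternatingMap (degPart k ((normalFrame K).ePr I (oneForm V))).toAlternatingMap
          b.toAlternatingMap • ((q ! : ℝ))⁻¹ • wedgePow w.toAlternatingMap q
      rw [h3, h2, AlternatingMap.domDomCongr_smul, h1, smul_smul, smul_smul, ← mul_assoc,
        ← mul_assoc, ← pow_add, Even.neg_one_pow ⟨_, rfl⟩, one_mul]
    have h4 : (degPartAlt V k) (homog k a) = a.toAlternatingMap := by
      change (degPart k (homog k a)).toAlternatingMap = _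
      rw [degPart_homog]
    simp only [LinearMap.comp_apply, LinearMap.smulRight_apply, h4, smul_smul] at key
    exact key

/-- W maps ω^q/q! to ±1. -/
lemma wedgePow_ne_zero (hw : IsFibreSymplectic K w) (hq : Module.finrank ℝ (V ⧸ K) = 2 * q) :
    wedgePow w.toAlternatingMap q ≠ 0 := by
  intro h0
  rw [wedgePow_eq (D := normalFrame K) hw] at h0
  have hcard : Fintype.card (Fin (Module.finrank ℝ (V ⧸ K))) = 2 * q := by simpa using hq
  have h1 : ((normalFrame K).lef w ^ q) (oneForm V) = 0 := by
    rw [eq_homog_of_mem_degForms (lef_pow_one_mem_degForms (D := normalFrame K) (w := w) q)]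
    have : degPart (2 * q) (((normalFrame K).lef w ^ q) (oneForm V)) = 0 := by
      ext v
      exact DFunLike.congr_fun h0 v
    rw [this, map_zero]
  have h2 := weylOp_volForm (D := normalFrame K) hw hcard
  rw [volForm, h1, smul_zero, map_zero, eq_comm, smul_eq_zero] at h2
  have h3 := congrArg (fun α => degPart 0 α ![]) (h2.resolve_left (pow_ne_zero _ (by norm_num)))
  simp only [oneForm_apply_zero, map_zero] at h3
  exact one_ne_zero h3

lemma horizontal_ePr (I : Fin k → Fin (Module.finrank ℝ (V ⧸ K))) :
    Horizontal K (degPart k ((normalFrame K).ePr I (oneForm V))).toAlternatingMap := by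
  refine (mem_horForms_iff _).1 ?_ k
  induction k with
  | zero => exact oneForm_mem_horForms
  | succ k ih =>
    rw [ePr_succ, Module.End.mul_apply]
    exact eo_mem (ih _) _

/-- Uniqueness is the nondegeneracy of the exterior product. If γ = c - c' has zero product with all
monomials, then, γ being ±W(Wγ), the form Wγ vanishes on all tuples of `Y`; hence Wγ = 0 and γ = 0.
-/
lemma eq_of_isStar (hw : IsFibreSymplectic K w) (hq : Module.finrank ℝ (V ⧸ K) = 2 * q)
    (h : k + l = 2 * q) {b : V [⋀^Fin k]→L[ℝ] ℝ} {c c' : V [⋀^Fin l]→L[ℝ] ℝ}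
    (hc : IsStar K w.toAlternatingMap q h b c) (hc' : IsStar K w.toAlternatingMap q h b c') :
    c = c' := by
  set γ : ExtForms V := homog l (c - c') with hγ
  have hhor : γ ∈ horForms K := by
    rw [hγ, map_sub]
    exact Submodule.sub_mem _ (homog_mem_horForms hc.1) (homog_mem_horForms hc'.1)
  have hdeg : γ ∈ degForms V l := homog_mem_degForms _ _
  have hcard : Fintype.card (Fin (Module.finrank ℝ (V ⧸ K))) = 2 * q := by simpa using hq
  have hWdeg : (normalFrame K).weylOp w γ ∈ degForms V k :=
    (by omega : (2 * q - l : ℤ) = k) ▸ weylOp_mem_degForms hw hcard hhor hdeg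
  have hW : (normalFrame K).weylOp w γ = 0 := by
    refine eq_zero_of_apply_Y (D := normalFrame K) (k := k) hw (weylOp_mem hhor) hWdeg fun I => ?_
    have h1 := wedge_ePr_weylOp (D := normalFrame K) hw hcard h I (weylOp_mem (w := w) hhor) hWdeg
    have h2 : wedge (degPart k ((normalFrame K).ePr I (oneForm V))).toAlternatingMap
        (degPart l ((normalFrame K).weylOp w ((normalFrame K).weylOp w γ))).toAlternatingMap = 0 := by
      have h3 := (hc.2 _ (horizontal_ePr I)).trans (hc'.2 _ (horizontal_ePr I)).symm
      have h4 := (AlternatingMap.domDomCongrₗ ℝ (finCongr h)).injective h3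
      rw [weylOp_weylOp hw hcard hhor hdeg, map_smul, hγ, degPart_homog]
      change wedgeₗ k l (degPart k ((normalFrame K).ePr I (oneForm V))).toAlternatingMap
        ((-1 : ℝ) ^ (l + q) • (c.toAlternatingMap - c'.toAlternatingMap)) = 0
      rw [map_smul, map_sub, wedgeₗ_apply, wedgeₗ_apply, h4, sub_self, smul_zero]
    rw [h2, AlternatingMap.domDomCongr_zero, eq_comm, smul_eq_zero] at h1
    have h3 := h1.resolve_right (wedgePow_ne_zero hw hq)
    simpa [Nat.factorial_ne_zero] using h3
  have h2 := weylOp_weylOp (D := normalFrame K) hw hcard hhor hdeg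
  rw [hW, map_zero, eq_comm, smul_eq_zero] at h2
  have h3 := congrArg (degPart l) (h2.resolve_left (pow_ne_zero _ (by norm_num)))
  rw [hγ, degPart_homog, map_zero] at h3
  exact sub_eq_zero.1 h3

theorem star_eq (hw : IsFibreSymplectic K w) (hq : Module.finrank ℝ (V ⧸ K) = 2 * q)
    (h : k + l = 2 * q) {b : V [⋀^Fin k]→L[ℝ] ℝ} (hb : Horizontal K b.toAlternatingMap) :
    star K w.toAlternatingMap q h b =
      (-1 : ℝ) ^ ((k + 1).choose 2) • degPart l ((normalFrame K).weylOp w (homog k b)) := by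
  have h1 := isStar_weylOp hw hq h hb
  have h2 : ∃ c, IsStar K w.toAlternatingMap q h b c := ⟨_, h1⟩
  rw [star, dif_pos h2]
  exact eq_of_isStar hw hq h h2.choose_spec h1

end FibreAlg

/-! ### Differential calculus of basic forms on a vector space -/

section Local

variable {E : Type*} [NormedAddCommGroup E] [NormedSpace ℝ E]

section BasicOn

variable {F G : Type*} [NormedAddCommGroup F] [NormedSpace ℝ F] [NormedAddCommGroup G]
  [NormedSpace ℝ G]

/-- The function `g` is smooth on `Ω` and its derivative vanishes in the directions of `K`. -/
structure BasicOn (K : Submodule ℝ E) (Ω : Set E) (g : E → F) : Prop where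
  smooth : ContDiffOn ℝ ∞ g Ω
  fderiv_eq_zero : ∀ y ∈ Ω, ∀ u ∈ K, fderiv ℝ g y u = 0

variable {K : Submodule ℝ E} {Ω : Set E} {f g : E → F}

lemma BasicOn.contDiffAt (h : BasicOn K Ω g) (hΩ : IsOpen Ω) {y : E} (hy : y ∈ Ω) :
    ContDiffAt ℝ ∞ g y := h.smooth.contDiffAt (hΩ.mem_nhds hy)

lemma BasicOn.differentiableAt (h : BasicOn K Ω g) (hΩ : IsOpen Ω) {y : E} (hy : y ∈ Ω) :
    DifferentiableAt ℝ g y := (h.contDiffAt hΩ hy).differentiableAt (by simp)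

lemma BasicOn.congr (h : BasicOn K Ω g) (hΩ : IsOpen Ω) (hfg : ∀ y ∈ Ω, f y = g y) :
    BasicOn K Ω f where
  smooth := h.smooth.congr hfg
  fderiv_eq_zero y hy u hu := by
    have : f =ᶠ[nhds y] g := Filter.eventuallyEq_of_mem (hΩ.mem_nhds hy) hfg
    rw [this.fderiv_eq, h.fderiv_eq_zero y hy u hu]

lemma basicOn_const (c : F) : BasicOn K Ω fun _ => c where
  smooth := contDiffOn_const
  fderiv_eq_zero y _ u _ := by simp

lemma BasicOn.comp (h : BasicOn K Ω g) (hΩ : IsOpen Ω) {Φ : F → G}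
    (hΦ : ∀ y ∈ Ω, ContDiffAt ℝ ∞ Φ (g y)) : BasicOn K Ω fun y => Φ (g y) where
  smooth y hy := ((hΦ y hy).comp y (h.contDiffAt hΩ hy)).contDiffWithinAt
  fderiv_eq_zero y hy u hu := by
    rw [fderiv_fun_comp y ((hΦ y hy).differentiableAt (by simp)) (h.differentiableAt hΩ hy),
      ContinuousLinearMap.comp_apply, h.fderiv_eq_zero y hy u hu, map_zero]

lemma BasicOn.clm_apply (h : BasicOn K Ω g) (hΩ : IsOpen Ω) (Φ : F →L[ℝ] G) :
    BasicOn K Ω fun y => Φ (g y) := h.comp hΩ fun _ _ => Φ.contDiff.contDiffAt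

lemma BasicOn.prodMk {h : E → G} (hf : BasicOn K Ω f) (hh : BasicOn K Ω h) (hΩ : IsOpen Ω) :
    BasicOn K Ω fun y => (f y, h y) where
  smooth := hf.smooth.prodMk hh.smooth
  fderiv_eq_zero y hy u hu := by
    rw [(hf.differentiableAt hΩ hy).fderiv_prodMk (hh.differentiableAt hΩ hy),
      ContinuousLinearMap.prod_apply, hf.fderiv_eq_zero y hy u hu, hh.fderiv_eq_zero y hy u hu]
    rfl

lemma BasicOn.smul {c : E → ℝ} (hc : BasicOn K Ω c) (hf : BasicOn K Ω f) (hΩ : IsOpen Ω) :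
    BasicOn K Ω fun y => c y • f y :=
  (hc.prodMk hf hΩ).comp hΩ (Φ := fun p : ℝ × F => p.1 • p.2)
    fun _ _ => (contDiff_fst.smul contDiff_snd).contDiffAt

lemma BasicOn.add (hf : BasicOn K Ω f) (hg : BasicOn K Ω g) (hΩ : IsOpen Ω) :
    BasicOn K Ω fun y => f y + g y :=
  (hf.prodMk hg hΩ).comp hΩ (Φ := fun p : F × F => p.1 + p.2)
    fun _ _ => (contDiff_fst.add contDiff_snd).contDiffAt

lemma BasicOn.sum {κ : Type*} (s : Finset κ) {f : κ → E → F} (h : ∀ a, BasicOn K Ω (f a))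
    (hΩ : IsOpen Ω) : BasicOn K Ω fun y => ∑ a ∈ s, f a y := by
  classical
  induction s using Finset.induction_on with
  | empty => simpa using basicOn_const (0 : F)
  | insert a s ha ih =>
    simp only [Finset.sum_insert ha]
    exact (h a).add ih hΩ

lemma BasicOn.prod {κ : Type*} (s : Finset κ) {f : κ → E → ℝ} (h : ∀ a, BasicOn K Ω (f a))
    (hΩ : IsOpen Ω) : BasicOn K Ω fun y => ∏ a ∈ s, f a y := by
  classical
  induction s using Finset.induction_on with
  | empty => simpa using basicOn_const (1 : ℝ)
  | insert a s ha ih =>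
    simp only [Finset.prod_insert ha]
    exact (h a).smul ih hΩ

lemma BasicOn.inv {c : E → ℝ} (hc : BasicOn K Ω c) (hΩ : IsOpen Ω) (h0 : ∀ y ∈ Ω, c y ≠ 0) :
    BasicOn K Ω fun y => (c y)⁻¹ :=
  hc.comp hΩ (Φ := fun t : ℝ => t⁻¹) fun y hy => contDiffAt_inv ℝ (h0 y hy)

lemma BasicOn.det {κ : Type*} [Fintype κ] [DecidableEq κ] {A : E → Matrix κ κ ℝ}
    (h : ∀ a b, BasicOn K Ω fun y => A y a b) (hΩ : IsOpen Ω) : BasicOn K Ω fun y => (A y).det := by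
  simp only [Matrix.det_apply, Units.smul_def, ← Int.cast_smul_eq_zsmul ℝ]
  exact BasicOn.sum _ (fun τ => (basicOn_const _).smul
    (BasicOn.prod _ (fun a => h (τ a) a) hΩ) hΩ) hΩ

/-- By Cramer's rule the entries are quotients of determinants. -/
lemma BasicOn.matrix_inv {κ : Type*} [Fintype κ] [DecidableEq κ] {A : E → Matrix κ κ ℝ}
    (h : ∀ a b, BasicOn K Ω fun y => A y a b) (hΩ : IsOpen Ω)
    (h0 : ∀ y ∈ Ω, IsUnit (A y).det) (a b : κ) : BasicOn K Ω fun y => (A y)⁻¹ a b := by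
  have h1 : BasicOn K Ω fun y => (A y).det⁻¹ := (BasicOn.det h hΩ).inv hΩ fun y hy => (h0 y hy).ne_zero
  have h2 : BasicOn K Ω fun y => ((A y).updateRow b (Pi.single a 1)).det := by
    refine BasicOn.det (fun c d => ?_) hΩ
    by_cases hc : c = b
    · subst hc
      simpa using basicOn_const _
    · simpa [Matrix.updateRow_ne hc] using h c d
  refine (h1.smul h2 hΩ).congr hΩ fun y hy => ?_
  rw [Matrix.inv_def, Matrix.smul_apply, Matrix.adjugate_apply, Ring.inverse_eq_inv]

end BasicOn

instance finiteDimensional_continuousAlternatingMap [FiniteDimensional ℝ E] (k : ℕ) :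
    FiniteDimensional ℝ (E [⋀^Fin k]→L[ℝ] ℝ) := by
  let b := Module.finBasis ℝ E
  let T : (E [⋀^Fin k]→L[ℝ] ℝ) →ₗ[ℝ] ((Fin k → Fin (Module.finrank ℝ E)) → ℝ) :=
    { toFun := fun α J => α fun s => b (J s)
      map_add' := fun _ _ => rfl
      map_smul' := fun _ _ => rfl }
  refine FiniteDimensional.of_injective T fun α β h => ?_
  have h1 : α.toAlternatingMap.toMultilinearMap = β.toAlternatingMap.toMultilinearMap :=
    Module.Basis.ext_multilinear (fun _ => b) fun J => congrFun h J
  ext v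
  exact DFunLike.congr_fun h1 v

end Local

section LocalForms

variable {E : Type*} [NormedAddCommGroup E] [NormedSpace ℝ E] [FiniteDimensional ℝ E]
  {K : Submodule ℝ E} {Ω : Set E} {k : ℕ}

/-- A linear map between finite dimensional spaces, as a continuous linear map. -/
abbrev toCLM {F G : Type*} [NormedAddCommGroup F] [NormedSpace ℝ F] [FiniteDimensional ℝ F]
    [NormedAddCommGroup G] [NormedSpace ℝ G] (T : F →ₗ[ℝ] G) : F →L[ℝ] G :=
  LinearMap.toContinuousLinearMap T

/-- Evaluation of a form on given vectors. -/
def evalForm (v : Fin k → E) : (E [⋀^Fin k]→L[ℝ] ℝ) →ₗ[ℝ] ℝ where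
  toFun α := α v
  map_add' _ _ := rfl
  map_smul' _ _ := rfl

lemma fderiv_apply_form {a : E → E [⋀^Fin k]→L[ℝ] ℝ} {y : E} (ha : DifferentiableAt ℝ a y)
    (u : E) (v : Fin k → E) : fderiv ℝ a y u v = fderiv ℝ (fun z => a z v) y u := by
  have := (toCLM (evalForm v)).hasFDerivAt.comp y ha.hasFDerivAt
  exact (DFunLike.congr_fun this.fderiv u).symm

/-- K does not depend on the point, so the values on fixed arguments can be differentiated. -/
lemma horizontal_fderiv {a : E → E [⋀^Fin k]→L[ℝ] ℝ} (hΩ : IsOpen Ω)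
    (ha : ∀ y ∈ Ω, FibreAlg.Horizontal K (a y).toAlternatingMap) {y : E} (hy : y ∈ Ω) (u : E)
    (hd : DifferentiableAt ℝ a y) : FibreAlg.Horizontal K (fderiv ℝ a y u).toAlternatingMap := by
  intro v hv
  change fderiv ℝ a y u v = 0
  rw [fderiv_apply_form hd]
  have : (fun z => a z v) =ᶠ[nhds y] fun _ => 0 :=
    Filter.eventuallyEq_of_mem (hΩ.mem_nhds hy) fun z hz => ha z hz v hv
  rw [this.fderiv_eq]
  simp

lemma extDeriv_eq_sum (a : E → E [⋀^Fin k]→L[ℝ] ℝ) (y : E) (v : Fin (k + 1) → E) :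
    extDeriv a y v = ∑ p : Fin (k + 1), (-1 : ℝ) ^ (p : ℕ) * fderiv ℝ a y (v p) (p.removeNth v) := by
  rw [extDeriv, ContinuousAlternatingMap.alternatizeUncurryFin_apply]
  refine Finset.sum_congr rfl fun p _ => ?_
  rw [zsmul_eq_mul]
  push_cast
  rfl

/-- For `u` in K, the contraction of dα with `u` is the derivative of α along `u` plus terms in
which `u` is inserted into derivatives of α. The latter vanish because those derivatives are
horizontal. -/
lemma basicOn_of_horizontal {a : E → E [⋀^Fin k]→L[ℝ] ℝ} (hΩ : IsOpen Ω)
    (hs : ContDiffOn ℝ ∞ a Ω) (ha : ∀ y ∈ Ω, FibreAlg.Horizontal K (a y).toAlternatingMap)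
    (hd : ∀ y ∈ Ω, FibreAlg.Horizontal K (extDeriv a y).toAlternatingMap) : BasicOn K Ω a where
  smooth := hs
  fderiv_eq_zero y hy u hu := by
    have hdiff : DifferentiableAt ℝ a y :=
      (hs.contDiffAt (hΩ.mem_nhds hy)).differentiableAt (by simp)
    ext v
    have h1 : extDeriv a y (Matrix.vecCons u v) = 0 := hd y hy _ ⟨0, hu⟩
    rw [extDeriv_eq_sum, Fin.sum_univ_succ, Finset.sum_eq_zero] at h1
    · simpa using h1
    · intro p _
      refine mul_eq_zero_of_right _ (horizontal_fderiv hΩ ha hy _ hdiff _ ?_)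
      cases k with
      | zero => exact p.elim0
      | succ k => exact ⟨0, by simpa [Fin.removeNth] using hu⟩

lemma BasicOn.horizontal_extDeriv {a : E → E [⋀^Fin k]→L[ℝ] ℝ} (h : BasicOn K Ω a) (hΩ : IsOpen Ω)
    (ha : ∀ y ∈ Ω, FibreAlg.Horizontal K (a y).toAlternatingMap) {y : E} (hy : y ∈ Ω) :
    FibreAlg.Horizontal K (extDeriv a y).toAlternatingMap := by
  rintro v ⟨j, hj⟩
  change extDeriv a y v = 0
  rw [extDeriv_eq_sum]
  refine Finset.sum_eq_zero fun p _ => mul_eq_zero_of_right _ ?_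
  by_cases hp : p = j
  · subst hp
    rw [h.fderiv_eq_zero y hy _ hj]
    rfl
  · obtain ⟨i, rfl⟩ := Fin.exists_succAbove_eq (Ne.symm hp)
    exact horizontal_fderiv hΩ ha hy _ (h.differentiableAt hΩ hy) _ ⟨i, hj⟩

/-- The exterior derivative of a mixed form. -/
def extDerivMix (α : E → ExtForms E) (y : E) : ExtForms E :=
  ofParts fun
    | 0 => 0
    | k + 1 => extDeriv (fun z => degPart k (α z)) y

/-- The derivative of a mixed form in the direction of a vector. -/
def dirDeriv (α : E → ExtForms E) (y u : E) : ExtForms E :=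
  ofParts fun k => fderiv ℝ (fun z => degPart k (α z)) y u

/-- The formula d = ∑ dxⁱ ∧ ∂ᵢ, which reduces commutation with d to the Leibniz rule for the ∂ᵢ. -/
lemma eq_sum_basis {κ : Type*} [Fintype κ] (b : Module.Basis κ ℝ E) (α : E → ExtForms E) (y : E) :
    extDerivMix α y = ∑ i, eOp (toCLM (b.coord i)) (dirDeriv α y (b i)) := by
  ext k v
  simp only [map_sum]
  cases k with
  | zero => simp [eOp_apply_zero]; rfl
  | succ k =>
    change extDeriv (fun z => degPart k (α z)) y v = _
    rw [extDeriv_eq_sum]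
    simp only [eOp_apply_succ, ContinuousAlternatingMap.sum_apply, extMul_apply]
    rw [Finset.sum_comm]
    refine Finset.sum_congr rfl fun p _ => ?_
    rw [← Finset.mul_sum]
    congr 1
    have h1 : v p = ∑ i, b.coord i (v p) • b i := (b.sum_repr _).symm
    conv_lhs => rw [h1, map_sum]
    simp only [map_smul, ContinuousAlternatingMap.sum_apply, ContinuousAlternatingMap.smul_apply]
    rfl

/-- A mixed form on `Ω` is smooth and basic for the foliation by the translates of `K`. -/
structure LocBasic (K : Submodule ℝ E) (Ω : Set E) (α : E → ExtForms E) : Prop where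
  hor : ∀ y ∈ Ω, α y ∈ horForms K
  basic : ∀ k, BasicOn K Ω fun y => degPart k (α y)

namespace NormalFrame

variable {ι : Type*} [Fintype ι] [DecidableEq ι] (D : NormalFrame K ι)
  {σ : E → E [⋀^Fin 2]→L[ℝ] ℝ} {α : E → ExtForms E}

lemma basicOn_gram (hσ : BasicOn K Ω σ) (hΩ : IsOpen Ω) (a b : ι) :
    BasicOn K Ω fun y => D.gram (σ y) a b :=
  hσ.clm_apply hΩ (toCLM (evalForm ![D.X a, D.X b]))

lemma locBasic_lef (hσ : BasicOn K Ω σ) (hΩ : IsOpen Ω) (hα : LocBasic K Ω α) :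
    LocBasic K Ω fun y => D.lef (σ y) (α y) where
  hor y hy := lef_mem (hα.hor y hy)
  basic k := by
    match k with
    | 0 =>
      have : (fun y => degPart 0 (D.lef (σ y) (α y))) = fun _ => 0 :=
        funext fun y => degPart_zero_quadElt_eOp _ _ _
      rw [this]
      exact basicOn_const _
    | 1 =>
      have : (fun y => degPart 1 (D.lef (σ y) (α y))) = fun _ => 0 :=
        funext fun y => degPart_one_quadElt_eOp _ _ _
      rw [this]
      exact basicOn_const _
    | k + 2 =>
      have : (fun y => degPart (k + 2) (D.lef (σ y) (α y))) = fun y => (2⁻¹ : ℝ) • ∑ a, ∑ b,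
          D.gram (σ y) a b • extMul (D.e a) (k + 1) (extMul (D.e b) k (degPart k (α y))) :=
        funext fun y => degPart_quadElt_eOp _ _ _ _
      rw [this]
      exact (basicOn_const _).smul (BasicOn.sum _ (fun a => BasicOn.sum _ (fun b =>
        (D.basicOn_gram hσ hΩ a b).smul ((hα.basic k).clm_apply hΩ
          (toCLM (extMul (D.e a) (k + 1) ∘ₗ extMul (D.e b) k))) hΩ) hΩ) hΩ) hΩ

lemma locBasic_lam (hσ : BasicOn K Ω σ) (hΩ : IsOpen Ω) (hα : LocBasic K Ω α)
    (hs : ∀ y ∈ Ω, IsFibreSymplectic K (σ y)) :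
    LocBasic K Ω fun y => D.lam (σ y) (α y) where
  hor y hy := lam_mem (hα.hor y hy)
  basic k := by
    have : (fun y => degPart k (D.lam (σ y) (α y))) = fun y => (2⁻¹ : ℝ) • ∑ a, ∑ b,
        (D.gram (σ y))⁻¹ a b • contr (D.X a) k (contr (D.X b) (k + 1) (degPart (k + 2) (α y))) :=
      funext fun y => degPart_quadElt_iOp _ _ _ _
    rw [this]
    exact (basicOn_const _).smul (BasicOn.sum _ (fun a => BasicOn.sum _ (fun b =>
      (BasicOn.matrix_inv (D.basicOn_gram hσ hΩ) hΩ (fun y hy => isUnit_det_gram (hs y hy)) a b).smul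
        ((hα.basic (k + 2)).clm_apply hΩ (toCLM (contr (D.X a) k ∘ₗ contr (D.X b) (k + 1)))) hΩ)
          hΩ) hΩ) hΩ

/-- Exterior product with a 2-form, as a bilinear map. -/
def lefB (k : ℕ) : (E [⋀^Fin 2]→L[ℝ] ℝ) →ₗ[ℝ] (E [⋀^Fin k]→L[ℝ] ℝ) →ₗ[ℝ]
    (E [⋀^Fin (k + 2)]→L[ℝ] ℝ) :=
  (2⁻¹ : ℝ) • ∑ a, ∑ b, (evalForm ![D.X a, D.X b]).smulRight
    (extMul (D.e a) (k + 1) ∘ₗ extMul (D.e b) k)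

lemma lefB_apply (w : E [⋀^Fin 2]→L[ℝ] ℝ) (α : ExtForms E) :
    degPart (k + 2) (D.lef w α) = D.lefB k w (degPart k α) := by
  refine (degPart_quadElt_eOp _ _ _ _).trans ?_
  simp only [lefB, LinearMap.smul_apply, LinearMap.sum_apply, LinearMap.smulRight_apply]
  rfl

lemma dirDeriv_lef {y : E} (hσ : DifferentiableAt ℝ σ y)
    (hα : ∀ k, DifferentiableAt ℝ (fun z => degPart k (α z)) y) (u : E) :
    dirDeriv (fun z => D.lef (σ z) (α z)) y u =
      D.lef (σ y) (dirDeriv α y u) + D.lef (fderiv ℝ σ y u) (α y) := by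
  ext k : 1
  match k with
  | 0 =>
    have : (fun z => degPart 0 (D.lef (σ z) (α z))) = fun _ => 0 :=
      funext fun y => degPart_zero_quadElt_eOp _ _ _
    change fderiv ℝ (fun z => degPart 0 (D.lef (σ z) (α z))) y u = _
    rw [this, map_add, lef, lef]
    unfold eo
    rw [degPart_zero_quadElt_eOp, degPart_zero_quadElt_eOp]
    simp
  | 1 =>
    have : (fun z => degPart 1 (D.lef (σ z) (α z))) = fun _ => 0 :=
      funext fun y => degPart_one_quadElt_eOp _ _ _
    change fderiv ℝ (fun z => degPart 1 (D.lef (σ z) (α z))) y u = _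
    rw [this, map_add, lef, lef]
    unfold eo
    rw [degPart_one_quadElt_eOp, degPart_one_quadElt_eOp]
    simp
  | k + 2 =>
    set B : (E [⋀^Fin 2]→L[ℝ] ℝ) →L[ℝ] (E [⋀^Fin k]→L[ℝ] ℝ) →L[ℝ] (E [⋀^Fin (k + 2)]→L[ℝ] ℝ) :=
      toCLM
        { toFun := fun w => toCLM (D.lefB k w)
          map_add' := fun w w' => by rw [map_add]; rfl
          map_smul' := fun c w => by rw [map_smul]; rfl }
    have h1 : (fun z => degPart (k + 2) (D.lef (σ z) (α z))) =
        fun z => B (σ z) (degPart k (α z)) := funext fun z => D.lefB_apply _ _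
    change fderiv ℝ (fun z => degPart (k + 2) (D.lef (σ z) (α z))) y u = _
    rw [h1, (B.hasFDerivAt_of_bilinear hσ.hasFDerivAt (hα k).hasFDerivAt).fderiv, map_add,
      lefB_apply, lefB_apply]
    rfl

lemma eOp_lef (w : E [⋀^Fin 2]→L[ℝ] ℝ) (ξ : E →L[ℝ] ℝ) (α : ExtForms E) :
    eOp ξ (D.lef w α) = D.lef w (eOp ξ α) := by
  have h : eOp ξ * D.lef w = D.lef w * eOp ξ := by
    simp only [lef, quadElt, smul_mul_assoc, mul_smul_comm, Finset.sum_mul, Finset.mul_sum]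
    congr 1
    refine Finset.sum_congr rfl fun a _ => Finset.sum_congr rfl fun b _ => ?_
    rw [← mul_assoc, eo, eOp_mul_eOp, neg_mul, mul_assoc, eo, eOp_mul_eOp ξ, mul_neg, neg_neg,
      mul_assoc]
  exact LinearMap.congr_fun h α

/-- The Leibniz rule before closedness is used: the operator in the last summand is exterior
multiplication by dσ. -/
lemma extDerivMix_lef_eq_add {κ : Type*} [Fintype κ] (c : Module.Basis κ ℝ E) {y : E}
    (hσ : DifferentiableAt ℝ σ y) (hα : ∀ k, DifferentiableAt ℝ (fun z => degPart k (α z)) y) :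
    extDerivMix (fun z => D.lef (σ z) (α z)) y = D.lef (σ y) (extDerivMix α y) +
      (∑ i, eOp (toCLM (c.coord i)) * D.lef (fderiv ℝ σ y (c i))) (α y) := by
  rw [eq_sum_basis c, eq_sum_basis c, map_sum, LinearMap.sum_apply, ← Finset.sum_add_distrib]
  refine Finset.sum_congr rfl fun i _ => ?_
  rw [dirDeriv_lef D hσ hα, map_add, eOp_lef, Module.End.mul_apply]

end NormalFrame

/-- A combination of exterior products with `m` covectors vanishes if it kills `1`. -/
lemma sum_eProd_eq_zero {κ : Type*} [Fintype κ] {m : ℕ} (c : κ → ℝ) (ξ : κ → Fin m → E →L[ℝ] ℝ)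
    (h : (∑ j, c j • eProd (ξ j)) (oneForm E) = 0) : ∑ j, c j • eProd (ξ j) = 0 := by
  have key : ∀ (l : ℕ) (β : ExtForms E), β ∈ degForms E l → (∑ j, c j • eProd (ξ j)) β = 0 := by
    intro l β hβ
    have hdeg : (∑ j, c j • eProd (ξ j)) β ∈ degForms E (m + l : ℕ) := by
      rw [LinearMap.sum_apply]
      refine Submodule.sum_mem _ fun j _ => Submodule.smul_mem _ _ ?_
      exact (by push_cast; ring : (l : ℤ) + m = (m + l : ℕ)) ▸ eProd_mem_degForms _ hβ
    -- With K = 0 every form is horizontal, so `wedge_eProd` applies to arbitrary forms.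
    have hbot : β ∈ horForms (⊥ : Submodule ℝ E) := by
      intro X hX
      rw [(Submodule.mem_bot ℝ).1 hX, show (0 : E) = (0 : ℝ) • 0 by simp, iOp_smul, zero_smul]
      rfl
    have h1 : degPartAlt E (m + l) ((∑ j, c j • eProd (ξ j)) β) =
        (FibreAlg.wedgeₗ m l).flip (degPartAlt E l β)
          (degPartAlt E m ((∑ j, c j • eProd (ξ j)) (oneForm E))) := by
      simp only [LinearMap.sum_apply, LinearMap.smul_apply, map_sum, map_smul]
      refine Finset.sum_congr rfl fun j _ => congrArg _ ?_
      exact ((FibreAlg.normalFrame (⊥ : Submodule ℝ E)).wedge_eProd (ξ j) hbot hβ).symm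
    rw [h, map_zero, map_zero] at h1
    rw [eq_homog_of_mem_degForms hdeg]
    have h2 : degPart (m + l) ((∑ j, c j • eProd (ξ j)) β) = 0 := by
      ext v
      exact DFunLike.congr_fun h1 v
    rw [h2, map_zero]
  refine LinearMap.ext fun α => ?_
  rw [eq_sum_homog α, map_sum]
  exact Finset.sum_eq_zero fun k _ => key k _ (homog_mem_degForms k _)

lemma extDerivMix_congr {α β : E → ExtForms E} {y : E} (h : ∀ᶠ z in nhds y, α z = β z) :
    extDerivMix α y = extDerivMix β y := by
  ext k : 1
  cases k with
  | zero => rfl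
  | succ k => exact Filter.EventuallyEq.extDeriv_eq (h.mono fun z hz => congrArg (degPart k) hz)

lemma extDerivMix_homog (a : E → E [⋀^Fin k]→L[ℝ] ℝ) (y : E) :
    extDerivMix (fun z => homog k (a z)) y = homog (k + 1) (extDeriv a y) := by
  ext m : 1
  cases m with
  | zero => exact (degPart_homog_of_ne (by omega) _).symm
  | succ m =>
    change extDeriv (fun z => degPart m (homog k (a z))) y = _
    by_cases hm : m = k
    · subst hm
      simp only [degPart_homog]
    · rw [degPart_homog_of_ne (by omega)]
      simp only [degPart_homog_of_ne hm]
      ext v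
      rw [extDeriv_eq_sum]
      simp

namespace NormalFrame

variable {ι : Type*} [Fintype ι] [DecidableEq ι] (D : NormalFrame K ι)
  {σ : E → E [⋀^Fin 2]→L[ℝ] ℝ} {α : E → ExtForms E}

/-- Exterior product with a closed 2-form commutes with the exterior derivative. -/
lemma extDerivMix_lef (hΩ : IsOpen Ω) (hσ : BasicOn K Ω σ)
    (hs : ∀ y ∈ Ω, IsFibreSymplectic K (σ y)) {y : E} (hy : y ∈ Ω) (hd : extDeriv σ y = 0)
    (hα : ∀ k, DifferentiableAt ℝ (fun z => degPart k (α z)) y) :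
    extDerivMix (fun z => D.lef (σ z) (α z)) y = D.lef (σ y) (extDerivMix α y) := by
  have c := Module.finBasis ℝ E
  have hσy := hσ.differentiableAt hΩ hy
  -- The Leibniz rule is applied to the constant form 1 first. As dσ = 0, the error operator kills
  -- 1; being a combination of triple exterior products, it is then zero on all forms.
  have h1 := D.extDerivMix_lef_eq_add c (α := fun _ => oneForm E) hσy fun k =>
    differentiableAt_const _
  have h2 : extDerivMix (fun _ => oneForm E) y = 0 := by
    rw [eq_sum_basis c]
    refine Finset.sum_eq_zero fun i _ => ?_
    have : dirDeriv (fun _ => oneForm E) y (c i) = 0 := by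
      ext k : 1
      change fderiv ℝ (fun _ => degPart k (oneForm E)) y (c i) = 0
      simp
    rw [this, map_zero]
  have h3 : extDerivMix (fun z => D.lef (σ z) (oneForm E)) y = 0 := by
    rw [extDerivMix_congr (β := fun z => homog 2 (σ z))
      (Filter.eventually_of_mem (hΩ.mem_nhds hy) fun z hz => lef_one (hs z hz)),
      extDerivMix_homog, hd, map_zero]
  rw [h2, h3, map_zero, zero_add] at h1
  have h4 : ∑ i, eOp (toCLM (c.coord i)) * D.lef (fderiv ℝ σ y (c i)) =
      ∑ j : Fin (Module.finrank ℝ E) × ι × ι,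
        ((2⁻¹ : ℝ) * D.gram (fderiv ℝ σ y (c j.1)) j.2.1 j.2.2) •
          eProd ![toCLM (c.coord j.1), D.e j.2.1, D.e j.2.2] := by
    simp only [Fintype.sum_prod_type]
    refine Finset.sum_congr rfl fun i _ => ?_
    simp only [lef, quadElt, mul_smul_comm, Finset.mul_sum, Finset.smul_sum, smul_smul]
    refine Finset.sum_congr rfl fun a _ => Finset.sum_congr rfl fun b _ => ?_
    simp [eProd, eo]
  have h5 := sum_eProd_eq_zero (fun j : Fin (Module.finrank ℝ E) × ι × ι =>
    (2⁻¹ : ℝ) * D.gram (fderiv ℝ σ y (c j.1)) j.2.1 j.2.2)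
    (fun j => ![toCLM (c.coord j.1), D.e j.2.1, D.e j.2.2]) (by rw [← h4, ← h1])
  rw [D.extDerivMix_lef_eq_add c hσy hα, h4, h5, LinearMap.zero_apply, add_zero]

end NormalFrame

end LocalForms

/-! ### Pullback of forms under linear isomorphisms -/

section Pullback

variable {V V' : Type*} [AddCommGroup V] [Module ℝ V] [TopologicalSpace V]
  [AddCommGroup V'] [Module ℝ V'] [TopologicalSpace V']

/-- The pullback of mixed forms under a linear map. -/
def pb (A : V →L[ℝ] V') : ExtForms V' →ₗ[ℝ] ExtForms V where
  toFun α := ofParts fun k => (degPart k α).compContinuousLinearMap A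
  map_add' _ _ := rfl
  map_smul' _ _ := rfl

lemma degPart_pb (A : V →L[ℝ] V') (α : ExtForms V') (k : ℕ) :
    degPart k (pb A α) = (degPart k α).compContinuousLinearMap A := rfl

lemma iOp_pb (A : V →L[ℝ] V') (X : V) (α : ExtForms V') : iOp X (pb A α) = pb A (iOp (A X) α) := by
  ext k v
  change degPart (k + 1) α (fun i => A (Matrix.vecCons X v i)) = degPart (k + 1) α _
  congr 1
  funext i
  refine Fin.cases rfl (fun i => rfl) i

lemma eOp_pb (A : V →L[ℝ] V') (ξ : V' →L[ℝ] ℝ) (α : ExtForms V') :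
    eOp (ξ.comp A) (pb A α) = pb A (eOp ξ α) := by
  ext k v
  cases k with
  | zero => rfl
  | succ k =>
    rw [eOp_apply_succ, degPart_pb, degPart_pb, eOp_apply_succ, extMul_apply]
    exact (extMul_apply ξ (degPart k α) fun i => A (v i)).symm

lemma pb_pb_of_comp_eq_id {A : V →L[ℝ] V'} {B : V' →L[ℝ] V} (hAB : ∀ v, A (B v) = v)
    (α : ExtForms V') : pb B (pb A α) = α := by
  ext k v
  change degPart k α (fun i => A (B (v i))) = degPart k α v
  simp only [hAB]

lemma pb_mem_horForms {A : V →L[ℝ] V'} {K : Submodule ℝ V'} {α : ExtForms V'}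
    (h : α ∈ horForms K) : pb A α ∈ horForms (K.comap A.toLinearMap) := by
  intro X hX
  rw [iOp_pb, h (A X) hX, map_zero]

lemma apply_quadElt {T T' : Type*} [AddCommGroup T] [Module ℝ T] [AddCommGroup T'] [Module ℝ T']
    {ι : Type*} [Fintype ι] (f : T →ₗ[ℝ] T') {e : ι → Module.End ℝ T} {e' : ι → Module.End ℝ T'}
    (h : ∀ a x, f (e a x) = e' a (f x)) (w : Matrix ι ι ℝ) (x : T) :
    f (quadElt w e x) = quadElt w e' (f x) := by
  simp only [quadElt, LinearMap.smul_apply, LinearMap.sum_apply, Module.End.mul_apply, map_smul,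
    map_sum, h]

lemma flat_pb (A : V →L[ℝ] V') (w : V' [⋀^Fin 2]→L[ℝ] ℝ) (v u : V) :
    flat (w.compContinuousLinearMap A) v u = flat w (A v) (A u) := by
  rw [flat_apply, flat_apply, ContinuousAlternatingMap.compContinuousLinearMap_apply]
  congr 1
  funext i
  fin_cases i <;> rfl

lemma IsFibreSymplectic.pb {A : V →L[ℝ] V'} {B : V' →L[ℝ] V} (hAB : ∀ v, A (B v) = v)
    {K : Submodule ℝ V'} {w : V' [⋀^Fin 2]→L[ℝ] ℝ} (hw : IsFibreSymplectic K w) :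
    IsFibreSymplectic (K.comap A.toLinearMap) (w.compContinuousLinearMap A) where
  flat_eq_zero v hv := by
    ext u
    rw [flat_pb, hw.flat_eq_zero (A v) hv]
    rfl
  mem_of_flat v hv := by
    refine hw.mem_of_flat _ (ContinuousLinearMap.ext fun u => ?_)
    have := DFunLike.congr_fun hv (B u)
    rwa [flat_pb, hAB] at this

namespace NormalFrame

variable {K : Submodule ℝ V'} {ι : Type*} [Fintype ι] [DecidableEq ι] (D : NormalFrame K ι)

/-- The pullback of a frame under a linear isomorphism `A` with inverse `B`. -/
def pullback (A : V →L[ℝ] V') (B : V' →L[ℝ] V) (hAB : ∀ v, A (B v) = v) :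
    NormalFrame (K.comap A.toLinearMap) ι where
  X a := B (D.X a)
  e a := (D.e a).comp A
  e_X a b := by rw [ContinuousLinearMap.comp_apply, hAB, D.e_X]
  e_eq_zero a v hv := D.e_eq_zero a _ hv
  sub_mem v := by
    change A _ ∈ K
    rw [map_sub, map_sum]
    simpa [hAB] using D.sub_mem (A v)

variable (A : V →L[ℝ] V') (B : V' →L[ℝ] V) (hAB : ∀ v, A (B v) = v)

lemma gram_pullback (w : V' [⋀^Fin 2]→L[ℝ] ℝ) :
    (D.pullback A B hAB).gram (w.compContinuousLinearMap A) = D.gram w := by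
  ext a b
  rw [gram_apply, gram_apply, flat_pb]
  simp only [pullback, hAB]

lemma pb_lef (w : V' [⋀^Fin 2]→L[ℝ] ℝ) (α : ExtForms V') :
    pb A (D.lef w α) = (D.pullback A B hAB).lef (w.compContinuousLinearMap A) (pb A α) := by
  rw [lef, lef, gram_pullback]
  exact apply_quadElt _ (fun a x => (eOp_pb A (D.e a) x).symm) _ _

lemma pb_lam (w : V' [⋀^Fin 2]→L[ℝ] ℝ) (α : ExtForms V') :
    pb A (D.lam w α) = (D.pullback A B hAB).lam (w.compContinuousLinearMap A) (pb A α) := by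
  rw [lam, lam, gram_pullback]
  refine apply_quadElt _ (fun a x => ?_) _ _
  change _ = iOp (B (D.X a)) (pb A x)
  rw [iOp_pb, hAB]
  rfl

end NormalFrame

end Pullback

/-! ### Forms in charts -/

section Smooth

variable {E E' : Type*} [NormedAddCommGroup E] [NormedSpace ℝ E] [FiniteDimensional ℝ E]
  [NormedAddCommGroup E'] [NormedSpace ℝ E'] {k : ℕ}

/-- A form is a linear function of its values on tuples of basis vectors, which are finite in
number. -/
lemma contDiffAt_form_of_apply {a : E' → E [⋀^Fin k]→L[ℝ] ℝ} {y : E'}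
    (h : ∀ v, ContDiffAt ℝ ∞ (fun z => a z v) y) : ContDiffAt ℝ ∞ a y := by
  let b := Module.finBasis ℝ E
  let T : (E [⋀^Fin k]→L[ℝ] ℝ) →ₗ[ℝ] ((Fin k → Fin (Module.finrank ℝ E)) → ℝ) :=
    LinearMap.pi fun J => evalForm fun s => b (J s)
  have hT : Function.Injective T := by
    intro α β h
    have h1 : α.toAlternatingMap.toMultilinearMap = β.toAlternatingMap.toMultilinearMap :=
      Module.Basis.ext_multilinear (fun _ => b) fun J => congrFun h J
    ext v
    exact DFunLike.congr_fun h1 v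
  obtain ⟨S, hS⟩ := T.exists_leftInverse_of_injective (LinearMap.ker_eq_bot.2 hT)
  have h1 : a = fun z => toCLM S (T (a z)) := funext fun z => (LinearMap.congr_fun hS (a z)).symm
  rw [h1]
  refine (toCLM S).contDiff.contDiffAt.comp y ?_
  exact contDiffAt_pi.2 fun J => h _

/-- Expanding in a basis shows that the pulled back form is polynomial in the entries of `g` and
linear in those of `a`. -/
lemma ContDiffAt.compForm {a : E' → E [⋀^Fin k]→L[ℝ] ℝ} {g : E' → E →L[ℝ] E} {y : E'}
    (ha : ContDiffAt ℝ ∞ a y) (hg : ContDiffAt ℝ ∞ g y) :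
    ContDiffAt ℝ ∞ (fun z => (a z).compContinuousLinearMap (g z)) y := by
  refine contDiffAt_form_of_apply fun v => ?_
  let b := Module.finBasis ℝ E
  have h1 : (fun z => (a z).compContinuousLinearMap (g z) v) = fun z =>
      ∑ J : Fin k → Fin (Module.finrank ℝ E),
        (∏ s, toCLM (b.coord (J s)) (g z (v s))) • a z fun s => b (J s) := by
    funext z
    have h2 := (a z).toMultilinearMap.map_sum fun s j => b.coord j (g z (v s)) • b j
    have h3 : (fun s => ∑ j, b.coord j (g z (v s)) • b j) = fun s => g z (v s) :=
      funext fun s => b.sum_repr _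
    rw [h3] at h2
    refine h2.trans (Finset.sum_congr rfl fun J _ => ?_)
    rw [MultilinearMap.map_smul_univ]
    rfl
  rw [h1]
  refine ContDiffAt.sum fun J _ => ?_
  have h4 : ContDiffAt ℝ ∞ (fun z => ∏ s, toCLM (b.coord (J s)) (g z (v s))) y :=
    contDiffAt_prod fun s _ =>
      (toCLM (b.coord (J s))).contDiff.contDiffAt.comp y (hg.clm_apply contDiffAt_const)
  have h5 : ContDiffAt ℝ ∞ (fun z => a z fun s => b (J s)) y :=
    (toCLM (evalForm fun s => b (J s))).contDiff.contDiffAt.comp y ha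
  exact h4.smul h5

end Smooth

section Charts

variable {n : ℕ} {M : Type*} [TopologicalSpace M] [ChartedSpace (EuclideanSpace ℝ (Fin n)) M]
  [IsManifold (𝓡 n) ∞ M] {k : ℕ}
  {c c' : OpenPartialHomeomorph M (EuclideanSpace ℝ (Fin n))}

lemma mdifferentiable_of_mem_maximalAtlas (hc : c ∈ IsManifold.maximalAtlas (𝓡 n) ∞ M) :
    c.MDifferentiable (𝓡 n) (𝓡 n) :=
  ⟨(contMDiffOn_of_mem_maximalAtlas hc).mdifferentiableOn (by simp),
    (contMDiffOn_symm_of_mem_maximalAtlas hc).mdifferentiableOn (by simp)⟩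

/-- The transition map between two charts. -/
def chartTrans (c c' : OpenPartialHomeomorph M (EuclideanSpace ℝ (Fin n))) :
    EuclideanSpace ℝ (Fin n) → EuclideanSpace ℝ (Fin n) := fun y => c' (c.symm y)

lemma contDiffAt_chartTrans (hc : c ∈ IsManifold.maximalAtlas (𝓡 n) ∞ M)
    (hc' : c' ∈ IsManifold.maximalAtlas (𝓡 n) ∞ M) {y : EuclideanSpace ℝ (Fin n)}
    (hy : y ∈ c.target) (hy' : c.symm y ∈ c'.source) : ContDiffAt ℝ ∞ (chartTrans c c') y :=
  ((contMDiffAt_of_mem_maximalAtlas hc' hy').comp y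
    (contMDiffAt_symm_of_mem_maximalAtlas hc hy)).contDiffAt

lemma mfderiv_symm_eq (hc : c ∈ IsManifold.maximalAtlas (𝓡 n) ∞ M)
    (hc' : c' ∈ IsManifold.maximalAtlas (𝓡 n) ∞ M) {y : EuclideanSpace ℝ (Fin n)}
    (hy : y ∈ c.target) (hy' : c.symm y ∈ c'.source) (v : EuclideanSpace ℝ (Fin n)) :
    (mfderiv (𝓡 n) (𝓡 n) c.symm y v : EuclideanSpace ℝ (Fin n)) =
      mfderiv (𝓡 n) (𝓡 n) c'.symm (chartTrans c c' y) (fderiv ℝ (chartTrans c c') y v) := by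
  have h1 : MDifferentiableAt (𝓡 n) (𝓡 n) (chartTrans c c') y :=
    ((contDiffAt_chartTrans hc hc' hy hy').differentiableAt (by simp)).mdifferentiableAt
  have h2 : MDifferentiableAt (𝓡 n) (𝓡 n) c'.symm (chartTrans c c' y) :=
    (mdifferentiable_of_mem_maximalAtlas hc').mdifferentiableAt_symm (c'.map_source hy')
  have h3 : (c'.symm ∘ chartTrans c c') =ᶠ[nhds y] c.symm := by
    filter_upwards [c.symm.open_source.mem_nhds hy,
      c.continuousAt_symm hy (c'.open_source.mem_nhds hy')] with z _ hz
    exact c'.left_inv hz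
  have h4 := mfderiv_comp y h2 h1
  rw [h3.mfderiv_eq, mfderiv_eq_fderiv] at h4
  exact DFunLike.congr_fun h4 v

lemma localRep_apply (α : FormSec n M k) (y : EuclideanSpace ℝ (Fin n))
    (v : Fin k → EuclideanSpace ℝ (Fin n)) : localRep α c y v =
      α (c.symm y) fun i => mfderiv 𝓘(ℝ, EuclideanSpace ℝ (Fin n)) (𝓡 n) c.symm y (v i) := rfl

lemma localRep_eq (α : FormSec n M k) (hc : c ∈ IsManifold.maximalAtlas (𝓡 n) ∞ M)
    (hc' : c' ∈ IsManifold.maximalAtlas (𝓡 n) ∞ M) {y : EuclideanSpace ℝ (Fin n)}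
    (hy : y ∈ c.target) (hy' : c.symm y ∈ c'.source) :
    localRep α c y =
      (localRep α c' (chartTrans c c' y)).compContinuousLinearMap (fderiv ℝ (chartTrans c c') y) := by
  ext v
  rw [ContinuousAlternatingMap.compContinuousLinearMap_apply, localRep_apply, localRep_apply]
  -- All tangent spaces are the same model space by definition; forgetting the dependence on the
  -- point allows the base point to be rewritten.
  let β : M → EuclideanSpace ℝ (Fin n) [⋀^Fin k]→L[ℝ] ℝ := α
  have h1 : β (c'.symm (chartTrans c c' y)) = β (c.symm y) := congrArg β (c'.left_inv hy')
  have h2 := fun i => mfderiv_symm_eq hc hc' hy hy' (v i)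
  change β (c.symm y) (fun i => (mfderiv (𝓡 n) (𝓡 n) c.symm y (v i) : EuclideanSpace ℝ (Fin n))) =
    β (c'.symm (chartTrans c c' y)) _
  rw [h1]
  exact congrArg _ (funext h2)

lemma eventually_localRep_eq (α : FormSec n M k) (hc : c ∈ IsManifold.maximalAtlas (𝓡 n) ∞ M)
    (hc' : c' ∈ IsManifold.maximalAtlas (𝓡 n) ∞ M) {y : EuclideanSpace ℝ (Fin n)}
    (hy : y ∈ c.target) (hy' : c.symm y ∈ c'.source) :
    localRep α c =ᶠ[nhds y] fun z => (localRep α c' (chartTrans c c' z)).compContinuousLinearMap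
      (fderiv ℝ (chartTrans c c') z) := by
  filter_upwards [c.open_target.mem_nhds hy,
    c.continuousAt_symm hy (c'.open_source.mem_nhds hy')] with z hz hz'
  exact localRep_eq α hc hc' hz hz'

lemma ContDiffAt.localRep_of_chart {α : FormSec n M k}
    (hc : c ∈ IsManifold.maximalAtlas (𝓡 n) ∞ M)
    (hc' : c' ∈ IsManifold.maximalAtlas (𝓡 n) ∞ M) {y : EuclideanSpace ℝ (Fin n)}
    (hy : y ∈ c.target) (hy' : c.symm y ∈ c'.source)
    (h : ContDiffAt ℝ ∞ (localRep α c') (chartTrans c c' y)) : ContDiffAt ℝ ∞ (localRep α c) y := by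
  have hτ := contDiffAt_chartTrans hc hc' hy hy'
  exact ((h.comp y hτ).compForm (hτ.fderiv_right (m := ∞) (by simp))).congr_of_eventuallyEq
    (eventually_localRep_eq α hc hc' hy hy')

lemma SmoothForm.contDiffOn {α : FormSec n M k} (hα : SmoothForm α)
    (hc : c ∈ IsManifold.maximalAtlas (𝓡 n) ∞ M) : ContDiffOn ℝ ∞ (localRep α c) c.target := by
  intro y hy
  set c' := chartAt (EuclideanSpace ℝ (Fin n)) (c.symm y) with hc'
  have hs : c.symm y ∈ c'.source := mem_chart_source _ _
  refine (ContDiffAt.localRep_of_chart hc (IsManifold.chart_mem_maximalAtlas (c.symm y)) hy hs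
    ?_).contDiffWithinAt
  exact (hα c' (chart_mem_atlas _ _)).contDiffAt (c'.open_target.mem_nhds (c'.map_source hs))

/-- Smoothness may be tested in one convenient chart around each point, even one outside the given
atlas, as adapted charts may be. -/
lemma smoothForm_of_charts {α : FormSec n M k}
    (h : ∀ x : M, ∃ c ∈ IsManifold.maximalAtlas (𝓡 n) ∞ M, x ∈ c.source ∧
      ContDiffAt ℝ ∞ (localRep α c) (c x)) : SmoothForm α := by
  intro c hc y hy
  obtain ⟨c', hc', hx, hs⟩ := h (c.symm y)
  exact (ContDiffAt.localRep_of_chart (IsManifold.subset_maximalAtlas hc) hc' hy hx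
    hs).contDiffWithinAt

/-- `extD` is computed in a preferred chart that varies with the point; naturality of d under the
transition map makes it computable in any chart. -/
lemma localRep_extD {α : FormSec n M k} (hα : SmoothForm α)
    (hc : c ∈ IsManifold.maximalAtlas (𝓡 n) ∞ M) {y : EuclideanSpace ℝ (Fin n)}
    (hy : y ∈ c.target) : localRep (extD α) c y = extDeriv (localRep α c) y := by
  set c' := chartAt (EuclideanSpace ℝ (Fin n)) (c.symm y) with hc'
  have hs : c.symm y ∈ c'.source := mem_chart_source _ _
  have hm := IsManifold.chart_mem_maximalAtlas (I := 𝓡 n) (n := ∞) (c.symm y)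
  have hτ := contDiffAt_chartTrans hc hm hy hs
  rw [(eventually_localRep_eq α hc hm hy hs).extDeriv_eq]
  have hd : DifferentiableAt ℝ (localRep α c') (chartTrans c c' y) :=
    (((hα c' (chart_mem_atlas _ _)).contDiffAt
      (c'.open_target.mem_nhds (c'.map_source hs))).differentiableAt (by simp))
  have h2 : ((2 : ℕ∞) : WithTop ℕ∞) ≤ ∞ := WithTop.coe_le_coe.2 le_top
  rw [extDeriv_pullback hd hτ (by rwa [minSmoothness_of_isRCLikeNormedField])]
  have h1 : MDifferentiableAt (𝓡 n) (𝓡 n) c' (c.symm y) :=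
    (mdifferentiable_of_mem_maximalAtlas hm).mdifferentiableAt hs
  have h2 : MDifferentiableAt (𝓡 n) (𝓡 n) c.symm y :=
    (mdifferentiable_of_mem_maximalAtlas hc).mdifferentiableAt_symm hy
  have h3 := mfderiv_comp y h1 h2
  ext v
  rw [localRep_apply, ContinuousAlternatingMap.compContinuousLinearMap_apply]
  change extDeriv (localRep α c') (c' (c.symm y)) _ = _
  refine congrArg _ (funext fun i => ?_)
  have h4 := DFunLike.congr_fun h3 (v i)
  change mfderiv (𝓡 n) (𝓡 n) (chartTrans c c') y (v i) = _ at h4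
  rw [mfderiv_eq_fderiv] at h4
  exact h4.symm

end Charts

/-! ### Charts adapted to a foliation -/

namespace Foliation

variable {n c : ℕ} {M : Type*} [TopologicalSpace M]
    [ChartedSpace (EuclideanSpace ℝ (Fin n)) M] [IsManifold (𝓡 n) ∞ M]
    {T₀ : Type*} [TopologicalSpace T₀]
    [ChartedSpace (EuclideanSpace ℝ (Fin c)) T₀] [IsManifold (𝓡 c) ∞ T₀] {ι : Type*}
    (F : Foliation n c M T₀ ι)

lemma mdifferentiableAt_f {i : ι} {x : M} (hx : x ∈ F.U i) :
    MDifferentiableAt (𝓡 n) (𝓡 c) (F.f i) x :=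
  (F.submersion i x hx).contMDiffAt.mdifferentiableAt (by simp)

/-- Where two of the submersions are defined, one is a local diffeomorphism composed with the other,
so each kernel is contained in the other. -/
lemma mem_tangent_iff {i : ι} {x : M} (hx : x ∈ F.U i) (v : TangentSpace (𝓡 n) x) :
    v ∈ F.tangent x ↔ mfderiv (𝓡 n) (𝓡 c) (F.f i) x v = 0 := by
  simp only [tangent, Submodule.mem_iInf, LinearMap.mem_ker, ContinuousLinearMap.coe_coe]
  refine ⟨fun h => h i hx, fun h j hj => ?_⟩
  obtain ⟨γ, hγ, hf⟩ := F.transition i j ⟨x, hx, hj⟩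
  have hs : F.f i x ∈ γ.source := hγ ▸ Set.mem_image_of_mem _ ⟨hx, hj⟩
  have h1 : MDifferentiableAt (𝓡 c) (𝓡 c) γ (F.f i x) :=
    (γ.contMDiffOn_toFun.contMDiffAt (γ.open_source.mem_nhds hs)).mdifferentiableAt (by simp)
  have h2 : F.f j =ᶠ[nhds x] γ ∘ F.f i :=
    Filter.eventuallyEq_of_mem (((F.isOpen_U i).inter (F.isOpen_U j)).mem_nhds ⟨hx, hj⟩) hf
  have h3 := h2.mfderiv_eq.trans (mfderiv_comp x h1 (F.mdifferentiableAt_f hx))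
  have h4 := DFunLike.congr_fun h3 v
  refine h4.trans ?_
  change mfderiv (𝓡 c) (𝓡 c) γ (F.f i x) (mfderiv (𝓡 n) (𝓡 c) (F.f i) x v) = 0
  rw [h, map_zero]

/-- On the open subset `Ω` of the target of the chart `e`, the tangent spaces of the leaves
correspond to the constant subspace `K`. -/
structure IsAdapted (e : OpenPartialHomeomorph M (EuclideanSpace ℝ (Fin n)))
    (Ω : Set (EuclideanSpace ℝ (Fin n))) (K : Submodule ℝ (EuclideanSpace ℝ (Fin n))) : Prop where
  mem_atlas : e ∈ IsManifold.maximalAtlas (𝓡 n) ∞ M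
  isOpen : IsOpen Ω
  subset : Ω ⊆ e.target
  finrank_quotient : Module.finrank ℝ (EuclideanSpace ℝ (Fin n) ⧸ K) = c
  mem_iff : ∀ y ∈ Ω, ∀ v : EuclideanSpace ℝ (Fin n),
    v ∈ K ↔ mfderiv (𝓡 n) (𝓡 n) e.symm y v ∈ F.tangent (e.symm y)

/-- In the charts of the normal form of a submersion, `f i` is a linear projection; its kernel is K.
-/
lemma exists_isAdapted (x : M) : ∃ e Ω K, F.IsAdapted e Ω K ∧ ∃ y ∈ Ω, e.symm y = x := by
  obtain ⟨i, hi⟩ := F.cover x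
  let h := F.submersion i x hi
  let p : EuclideanSpace ℝ (Fin n) →L[ℝ] EuclideanSpace ℝ (Fin c) :=
    (ContinuousLinearMap.fst ℝ _ h.complement).comp h.equiv.toContinuousLinearMap
  refine ⟨h.domChart, h.domChart.target ∩ h.domChart.symm ⁻¹' F.U i, LinearMap.ker p.toLinearMap,
    ⟨h.domChart_mem_maximalAtlas, h.domChart.isOpen_inter_preimage_symm (F.isOpen_U i),
      Set.inter_subset_left, ?_, ?_⟩, h.domChart x,
    ⟨h.domChart.map_source h.mem_domChart_source, ?_⟩,
    h.domChart.left_inv h.mem_domChart_source⟩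
  · have hp : Function.Surjective p.toLinearMap :=
      Prod.fst_surjective.comp h.equiv.surjective
    rw [(LinearMap.quotKerEquivOfSurjective _ hp).finrank_eq, finrank_euclideanSpace_fin]
  · rintro y ⟨hy, hyU⟩ v
    have hs : h.domChart.symm y ∈ h.domChart.source := h.domChart.map_target hy
    have hcod := mdifferentiable_of_mem_maximalAtlas h.codChart_mem_maximalAtlas
    have hdom := mdifferentiable_of_mem_maximalAtlas h.domChart_mem_maximalAtlas
    have h1 : (h.codChart ∘ F.f i ∘ h.domChart.symm) =ᶠ[nhds y] p := by
      filter_upwards [h.domChart.open_target.mem_nhds hy] with z hz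
      have := h.writtenInCharts
        (show z ∈ (h.domChart.extend (𝓡 n)).target by simpa using hz)
      simpa [p] using this
    have hfy : F.f i (h.domChart.symm y) ∈ h.codChart.source := h.source_subset_preimage_source hs
    have hf := F.mdifferentiableAt_f hyU
    have hd := hdom.mdifferentiableAt_symm hy
    have h2 := mfderiv_comp y (hcod.mdifferentiableAt hfy) (hf.comp y hd)
    have h3 := mfderiv_comp y hf hd
    rw [h1.mfderiv_eq, h3] at h2
    have h4 := DFunLike.congr_fun h2 v
    rw [F.mem_tangent_iff hyU]
    change p v = 0 ↔ _
    have h5 : p v = mfderiv (𝓡 c) (𝓡 c) h.codChart (F.f i (h.domChart.symm y))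
        (mfderiv (𝓡 n) (𝓡 c) (F.f i) (h.domChart.symm y)
          (mfderiv (𝓡 n) (𝓡 n) h.domChart.symm y v)) := by
      refine Eq.trans ?_ h4
      rw [mfderiv_eq_fderiv, p.fderiv]
      rfl
    rw [h5]
    exact map_eq_zero_iff _ (hcod.mfderiv_injective hfy)
  · change h.domChart.symm (h.domChart x) ∈ F.U i
    rwa [h.domChart.left_inv h.mem_domChart_source]

end Foliation

/-! ### Rescaling of homogeneous components -/

section ScaleDeg

variable {V : Type*} [AddCommGroup V] [Module ℝ V] [TopologicalSpace V]

/-- Multiplication of the component of degree `k` by `c k`. -/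
def scaleDeg (c : ℕ → ℝ) : Module.End ℝ (ExtForms V) where
  toFun α := ofParts fun k => c k • degPart k α
  map_add' α β := by
    ext k : 1
    rw [map_add, degPart_ofParts, degPart_ofParts, degPart_ofParts, map_add, smul_add]
  map_smul' r α := by
    ext k : 1
    rw [RingHom.id_apply, map_smul, degPart_ofParts, degPart_ofParts, map_smul, smul_comm]

lemma degPart_scaleDeg (c : ℕ → ℝ) (α : ExtForms V) (k : ℕ) :
    degPart k (scaleDeg c α) = c k • degPart k α := rfl

lemma scaleDeg_mem {K : Submodule ℝ V} {α : ExtForms V} (h : α ∈ horForms K) (c : ℕ → ℝ) :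
    scaleDeg c α ∈ horForms K := by
  rw [mem_horForms_iff] at h ⊢
  intro k v hv
  change c k • degPart k α v = 0
  rw [show degPart k α v = 0 from h k v hv, smul_zero]

namespace NormalFrame

variable {K : Submodule ℝ V} {ι : Type*} [Fintype ι] [DecidableEq ι] {D : NormalFrame K ι}
  {w : V [⋀^Fin 2]→L[ℝ] ℝ} {α : ExtForms V} {q : ℕ}

lemma lam_scaleDeg (c : ℕ → ℝ) (α : ExtForms V) :
    D.lam w (scaleDeg c α) = scaleDeg (fun k => c (k + 2)) (D.lam w α) := by
  ext k : 1
  refine (degPart_quadElt_iOp _ _ _ _).trans ?_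
  have h : degPart k (D.lam w α) = _ := degPart_quadElt_iOp _ _ _ _
  rw [degPart_scaleDeg, degPart_scaleDeg, h]
  simp only [map_smul, Finset.smul_sum, smul_comm (c (k + 2))]

lemma lef_lam_sub (hw : IsFibreSymplectic K w) (hq : Fintype.card ι = 2 * q)
    (h : α ∈ horForms K) :
    D.lef w (D.lam w α) - D.lam w (D.lef w α) = scaleDeg (fun k => (k : ℝ) - q) α := by
  have h1 := LinearMap.congr_fun (lef_mul_lam (D := D) hw) α
  rw [LinearMap.sub_apply, LinearMap.sub_apply, Module.End.mul_apply, Module.End.mul_apply] at h1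
  rw [h1]
  ext k : 1
  rw [map_sub, numElt_apply h, Module.algebraMap_end_apply, map_smul, degPart_scaleDeg, hq,
    show ((2 * q : ℕ) : ℝ) / 2 = q by push_cast; ring]
  exact (sub_smul _ _ _).symm

variable [FiniteDimensional ℝ V]

/-- W exchanges degrees k and 2q - k, so a single component of α is responsible. -/
lemma degPart_weylOp (hw : IsFibreSymplectic K w) (hq : Fintype.card ι = 2 * q)
    (h : α ∈ horForms K) {k l : ℕ} (hkl : k + l = 2 * q) :
    degPart l (D.weylOp w α) = degPart l (D.weylOp w (homog k (degPart k α))) := by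
  have hγ : α - homog k (degPart k α) ∈ horForms K :=
    Submodule.sub_mem _ h (homog_mem_horForms ((mem_horForms_iff α).1 h k))
  rw [← sub_eq_zero, ← map_sub, ← map_sub]
  set γ := α - homog k (degPart k α)
  have hk : degPart k γ = 0 := by rw [map_sub, degPart_homog, sub_self]
  rw [eq_sum_homog γ, map_sum, map_sum]
  refine Finset.sum_eq_zero fun j _ => ?_
  by_cases hj : j = k
  · rw [hj, hk, map_zero, map_zero, map_zero]
  · exact weylOp_mem_degForms hw hq (homog_mem_horForms ((mem_horForms_iff _).1 hγ j))
      (homog_mem_degForms j _) l (by omega)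

lemma degPart_weylOp_scaleDeg (hw : IsFibreSymplectic K w) (hq : Fintype.card ι = 2 * q)
    (h : α ∈ horForms K) (c : ℕ → ℝ) :
    D.weylOp w (scaleDeg c α) = scaleDeg (fun l => c (2 * q - l)) (D.weylOp w α) := by
  ext l : 1
  rw [degPart_scaleDeg]
  by_cases hl : l ≤ 2 * q
  · have hkl : 2 * q - l + l = 2 * q := Nat.sub_add_cancel hl
    rw [degPart_weylOp hw hq (scaleDeg_mem h c) hkl, degPart_weylOp hw hq h hkl, degPart_scaleDeg,
      map_smul, map_smul, map_smul]
  · rw [D.apply_eq_zero_of_card_lt (weylOp_mem h) (by omega),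
      D.apply_eq_zero_of_card_lt (weylOp_mem (scaleDeg_mem h c)) (by omega), smul_zero]

lemma weylOp_weylOp_eq_scaleDeg (hw : IsFibreSymplectic K w) (hq : Fintype.card ι = 2 * q)
    (h : α ∈ horForms K) :
    D.weylOp w (D.weylOp w α) = scaleDeg (fun k => (-1 : ℝ) ^ (k + q)) α := by
  refine (congrArg (fun β => D.weylOp w (D.weylOp w β)) (eq_sum_homog α)).trans
    (Eq.trans ?_ (congrArg (scaleDeg _) (eq_sum_homog α)).symm)
  simp only [map_sum]
  refine Finset.sum_congr rfl fun j _ => ?_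
  rw [weylOp_weylOp hw hq (homog_mem_horForms ((mem_horForms_iff α).1 h j)) (homog_mem_degForms j _)]
  ext k : 1
  rw [degPart_scaleDeg, map_smul]
  by_cases hk : k = j
  · rw [hk]
  · rw [degPart_homog_of_ne hk, smul_zero, smul_zero]

end NormalFrame

end ScaleDeg

/-! ### Pullback combined with change of frame -/

section PullbackChange

variable {V V' : Type*} [AddCommGroup V] [Module ℝ V] [TopologicalSpace V]
  [AddCommGroup V'] [Module ℝ V'] [TopologicalSpace V'] {K : Submodule ℝ V} {K' : Submodule ℝ V'}
  {A : V →L[ℝ] V'} {B : V' →L[ℝ] V}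

lemma IsFibreSymplectic.of_comap (hAB : ∀ v, A (B v) = v) (hK : K = K'.comap A.toLinearMap)
    {w : V' [⋀^Fin 2]→L[ℝ] ℝ} (hw : IsFibreSymplectic K' w) :
    IsFibreSymplectic K (w.compContinuousLinearMap A) := hK ▸ hw.pb hAB

variable {ι κ : Type*} [Fintype ι] [DecidableEq ι] [Fintype κ] [DecidableEq κ]
  (D : NormalFrame K ι) (D' : NormalFrame K' κ) {w : V' [⋀^Fin 2]→L[ℝ] ℝ}

lemma pb_lef_eq (hAB : ∀ v, A (B v) = v) (hK : K = K'.comap A.toLinearMap)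
    (hw : IsFibreSymplectic K' w) (α : ExtForms V') :
    pb A (D'.lef w α) = D.lef (w.compContinuousLinearMap A) (pb A α) := by
  subst hK
  rw [NormalFrame.pb_lef D' A B hAB, NormalFrame.lef_change D (hw.pb hAB)]

lemma pb_lam_eq (hAB : ∀ v, A (B v) = v) (hK : K = K'.comap A.toLinearMap)
    (hw : IsFibreSymplectic K' w) {α : ExtForms V'} (h : α ∈ horForms K') :
    pb A (D'.lam w α) = D.lam (w.compContinuousLinearMap A) (pb A α) := by
  subst hK
  rw [NormalFrame.pb_lam D' A B hAB, NormalFrame.lam_change D (hw.pb hAB) (pb_mem_horForms h)]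

end PullbackChange

/-! ### Basic forms in adapted charts -/

section Ev

variable {n : ℕ} {M : Type*} [TopologicalSpace M] [ChartedSpace (EuclideanSpace ℝ (Fin n)) M]

/-- The value of a mixed differential form at a point. -/
def MixedSec.ev (x : M) : MixedSec n M →ₗ[ℝ] ExtForms (TangentSpace (𝓡 n) x) where
  toFun α := ofParts fun k => α k x
  map_add' _ _ := rfl
  map_smul' _ _ := rfl

lemma MixedSec.ext_ev {α β : MixedSec n M} (h : ∀ x, ev x α = ev x β) : α = β := by
  funext k x
  exact congrArg (degPart k) (h x)

/-- The derivative of the inverse of a chart. -/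
def chartDeriv (e : OpenPartialHomeomorph M (EuclideanSpace ℝ (Fin n)))
    (y : EuclideanSpace ℝ (Fin n)) :
    EuclideanSpace ℝ (Fin n) →L[ℝ] TangentSpace (𝓡 n) (e.symm y) :=
  mfderiv (𝓡 n) (𝓡 n) e.symm y

/-- The expression of a mixed form in a chart. -/
def locMix (α : MixedSec n M) (e : OpenPartialHomeomorph M (EuclideanSpace ℝ (Fin n)))
    (y : EuclideanSpace ℝ (Fin n)) : ExtForms (EuclideanSpace ℝ (Fin n)) :=
  pb (chartDeriv e y) (MixedSec.ev (e.symm y) α)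

instance instT2SpaceTangent (x : M) : T2Space (TangentSpace (𝓡 n) x) :=
  inferInstanceAs (T2Space (EuclideanSpace ℝ (Fin n)))

variable [IsManifold (𝓡 n) ∞ M]

lemma exists_inverse_chartDeriv {e : OpenPartialHomeomorph M (EuclideanSpace ℝ (Fin n))}
    (he : e ∈ IsManifold.maximalAtlas (𝓡 n) ∞ M) {y : EuclideanSpace ℝ (Fin n)}
    (hy : y ∈ e.target) :
    ∃ B : TangentSpace (𝓡 n) (e.symm y) →L[ℝ] EuclideanSpace ℝ (Fin n),
      (∀ v, chartDeriv e y (B v) = v) ∧ ∀ u, B (chartDeriv e y u) = u := by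
  let A := (mdifferentiable_of_mem_maximalAtlas he).symm.mfderiv hy
  exact ⟨A.symm.toContinuousLinearMap, fun v => A.apply_symm_apply v, fun u => A.symm_apply_apply u⟩

lemma contDiffOn_extDeriv {k : ℕ} {Ω : Set (EuclideanSpace ℝ (Fin n))} (hΩ : IsOpen Ω)
    {a : EuclideanSpace ℝ (Fin n) → EuclideanSpace ℝ (Fin n) [⋀^Fin k]→L[ℝ] ℝ}
    (ha : ContDiffOn ℝ ∞ a Ω) : ContDiffOn ℝ ∞ (extDeriv a) Ω := by
  intro y hy
  have h1 : ContDiffAt ℝ ∞ (fderiv ℝ a) y :=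
    (ha.contDiffAt (hΩ.mem_nhds hy)).fderiv_right (m := ∞) (by simp)
  exact ((ContinuousAlternatingMap.alternatizeUncurryFinCLM ℝ (EuclideanSpace ℝ (Fin n))
    ℝ).contDiff.contDiffAt.comp y h1).contDiffWithinAt

lemma SmoothForm.extD {k : ℕ} {α : FormSec n M k} (hα : SmoothForm α) : SmoothForm (extD α) := by
  intro c hc
  have hc' : c ∈ IsManifold.maximalAtlas (𝓡 n) ∞ M := IsManifold.subset_maximalAtlas hc
  exact (contDiffOn_extDeriv c.open_target (hα c hc)).congr fun y hy => localRep_extD hα hc' hy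

lemma apply_eq_localRep {k : ℕ} (α : FormSec n M k)
    {e : OpenPartialHomeomorph M (EuclideanSpace ℝ (Fin n))}
    {y : EuclideanSpace ℝ (Fin n)}
    {B : TangentSpace (𝓡 n) (e.symm y) →L[ℝ] EuclideanSpace ℝ (Fin n)}
    (hB : ∀ v, chartDeriv e y (B v) = v) (v : Fin k → TangentSpace (𝓡 n) (e.symm y)) :
    α (e.symm y) v = localRep α e y fun i => B (v i) := by
  rw [localRep_apply]
  exact congrArg _ (funext fun i => (hB (v i)).symm)

lemma exists_chart_eq (x : M) :
    ∃ e : OpenPartialHomeomorph M (EuclideanSpace ℝ (Fin n)),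
    e ∈ IsManifold.maximalAtlas (𝓡 n) ∞ M ∧ ∃ y ∈ e.target, e.symm y = x :=
  ⟨chartAt _ x, IsManifold.chart_mem_maximalAtlas (I := 𝓡 n) (n := ∞) x, chartAt _ x x,
    (chartAt _ x).map_source (mem_chart_source _ x), (chartAt _ x).left_inv (mem_chart_source _ x)⟩

lemma extD_extD {k : ℕ} {α : FormSec n M k} (hα : SmoothForm α) :
    _root_.extD (_root_.extD α) = 0 := by
  funext x
  obtain ⟨e, he, y, hy, rfl⟩ := exists_chart_eq (n := n) x
  obtain ⟨B, hB, -⟩ := exists_inverse_chartDeriv he hy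
  ext v
  rw [apply_eq_localRep _ hB, localRep_extD hα.extD he hy]
  have h1 : localRep (_root_.extD α) e =ᶠ[nhds y] extDeriv (localRep α e) :=
    Filter.eventuallyEq_of_mem (e.open_target.mem_nhds hy) fun z hz => localRep_extD hα he hz
  have h2 : ((2 : ℕ∞) : WithTop ℕ∞) ≤ ∞ := WithTop.coe_le_coe.2 le_top
  rw [h1.extDeriv_eq, extDeriv_extDeriv_apply ((hα.contDiffOn he).contDiffAt
    (e.open_target.mem_nhds hy)) (by rwa [minSmoothness_of_isRCLikeNormedField])]
  rfl

end Ev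

namespace Foliation

open MixedSec

variable {n c : ℕ} {M : Type*} [TopologicalSpace M]
    [ChartedSpace (EuclideanSpace ℝ (Fin n)) M] [IsManifold (𝓡 n) ∞ M]
    {T₀ : Type*} [TopologicalSpace T₀]
    [ChartedSpace (EuclideanSpace ℝ (Fin c)) T₀] [IsManifold (𝓡 c) ∞ T₀] {ι : Type*}
    {F : Foliation n c M T₀ ι} {e : OpenPartialHomeomorph M (EuclideanSpace ℝ (Fin n))}
    {Ω : Set (EuclideanSpace ℝ (Fin n))} {K : Submodule ℝ (EuclideanSpace ℝ (Fin n))}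
    {y : EuclideanSpace ℝ (Fin n)} {k : ℕ} {α : MixedSec n M}

namespace IsAdapted

lemma eq_comap (h : F.IsAdapted e Ω K) (hy : y ∈ Ω) :
    K = (F.tangent (e.symm y)).comap (chartDeriv e y).toLinearMap :=
  Submodule.ext fun v => h.mem_iff y hy v

lemma exists_inverse (h : F.IsAdapted e Ω K) (hy : y ∈ Ω) :
    ∃ B : TangentSpace (𝓡 n) (e.symm y) →L[ℝ] EuclideanSpace ℝ (Fin n),
      (∀ v, chartDeriv e y (B v) = v) ∧ ∀ u, B (chartDeriv e y u) = u :=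
  exists_inverse_chartDeriv h.mem_atlas (h.subset hy)

lemma horizontal_localRep (h : F.IsAdapted e Ω K) (hy : y ∈ Ω) {β : FormSec n M k}
    (hβ : ∀ (x : M) (v : Fin k → TangentSpace (𝓡 n) x), (∃ i, v i ∈ F.tangent x) → β x v = 0) :
    FibreAlg.Horizontal K (localRep β e y).toAlternatingMap := by
  rintro v ⟨i, hi⟩
  exact hβ _ _ ⟨i, (h.mem_iff y hy (v i)).1 hi⟩

lemma apply_eq_zero (h : F.IsAdapted e Ω K) (hy : y ∈ Ω) {β : FormSec n M k}
    (hβ : FibreAlg.Horizontal K (localRep β e y).toAlternatingMap)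
    {v : Fin k → TangentSpace (𝓡 n) (e.symm y)} (hv : ∃ i, v i ∈ F.tangent (e.symm y)) :
    β (e.symm y) v = 0 := by
  obtain ⟨B, hB, -⟩ := h.exists_inverse hy
  obtain ⟨i, hi⟩ := hv
  rw [apply_eq_localRep _ hB]
  refine hβ _ ⟨i, (h.mem_iff y hy _).2 ?_⟩
  change chartDeriv e y (B (v i)) ∈ _
  rwa [hB]

lemma basicOn_localRep (h : F.IsAdapted e Ω K) {β : FormSec n M k} (hβ : F.IsBasic β) :
    BasicOn K Ω (localRep β e) := by
  refine basicOn_of_horizontal h.isOpen ((hβ.smooth.contDiffOn h.mem_atlas).mono h.subset)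
    (fun y hy => h.horizontal_localRep hy hβ.horizontal) fun y hy => ?_
  rw [← localRep_extD hβ.smooth h.mem_atlas (h.subset hy)]
  exact h.horizontal_localRep hy hβ.horizontal_extD

lemma locBasic (h : F.IsAdapted e Ω K) (hα : α ∈ F.BasicForms) : LocBasic K Ω (locMix α e) where
  hor y hy := (mem_horForms_iff _).2 fun k => h.horizontal_localRep hy (hα k).horizontal
  basic k := h.basicOn_localRep (hα k)

lemma finrank_quotient_tangent (h : F.IsAdapted e Ω K) (hy : y ∈ Ω) :
    Module.finrank ℝ (TangentSpace (𝓡 n) (e.symm y) ⧸ F.tangent (e.symm y)) = c := by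
  obtain ⟨B, hB, hB'⟩ := h.exists_inverse hy
  let A : EuclideanSpace ℝ (Fin n) ≃ₗ[ℝ] TangentSpace (𝓡 n) (e.symm y) :=
    LinearEquiv.ofLinearMap (chartDeriv e y).toLinearMap B.toLinearMap
      (LinearMap.ext hB) (LinearMap.ext hB')
  refine Eq.trans ?_ h.finrank_quotient
  refine (Submodule.Quotient.equiv K (F.tangent (e.symm y)) A ?_).finrank_eq.symm
  rw [h.eq_comap hy]
  exact Submodule.map_comap_eq_of_surjective A.surjective _

end IsAdapted

variable (F) in
lemma finrank_quotient_tangent (x : M) :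
    Module.finrank ℝ (TangentSpace (𝓡 n) x ⧸ F.tangent x) = c := by
  obtain ⟨e, Ω, K, h, y, hy, rfl⟩ := F.exists_isAdapted x
  exact h.finrank_quotient_tangent hy

/-- The criterion by which operators defined with pointwise chosen frames are seen to give smooth
basic forms. -/
lemma mem_basicForms_of_locBasic
    (H : ∀ e Ω K, F.IsAdapted e Ω K → LocBasic K Ω (locMix α e)) : α ∈ F.BasicForms := by
  intro k
  have hs : SmoothForm (α k) := by
    refine smoothForm_of_charts fun x => ?_
    obtain ⟨e, Ω, K, h, y, hy, rfl⟩ := F.exists_isAdapted x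
    refine ⟨e, h.mem_atlas, e.map_target (h.subset hy), ?_⟩
    rw [e.right_inv (h.subset hy)]
    exact ((H e Ω K h).basic k).contDiffAt h.isOpen hy
  refine ⟨hs, fun x v hv => ?_, fun x v hv => ?_⟩
  · obtain ⟨e, Ω, K, h, y, hy, rfl⟩ := F.exists_isAdapted x
    exact h.apply_eq_zero hy ((mem_horForms_iff _).1 ((H e Ω K h).hor y hy) k) hv
  · obtain ⟨e, Ω, K, h, y, hy, rfl⟩ := F.exists_isAdapted x
    refine h.apply_eq_zero hy ?_ hv
    rw [localRep_extD hs h.mem_atlas (h.subset hy)]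
    exact ((H e Ω K h).basic k).horizontal_extDeriv h.isOpen
      (fun z hz => (mem_horForms_iff _).1 ((H e Ω K h).hor z hz) k) hy

lemma ev_mem_horForms (hα : α ∈ F.BasicForms) (x : M) : ev x α ∈ horForms (F.tangent x) :=
  (mem_horForms_iff _).2 fun k v hv => (hα k).horizontal x v hv

lemma IsBasic.extD {β : FormSec n M k} (hβ : F.IsBasic β) : F.IsBasic (extD β) where
  smooth := hβ.smooth.extD
  horizontal := hβ.horizontal_extD
  horizontal_extD x v _ := by
    rw [extD_extD hβ.smooth]
    rfl

lemma mixedD_mem (hα : α ∈ F.BasicForms) : mixedD α ∈ F.BasicForms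
  | 0 => F.isBasic_zero
  | k + 1 => (hα k).extD

lemma mixedD_mixedD (hα : α ∈ F.BasicForms) : mixedD (mixedD α) = 0 := by
  funext k
  match k with
  | 0 => rfl
  | 1 =>
    -- The component of degree 0 of a derivative is zero by definition, so all that is needed is
    -- d(0) = 0, taken from linearity.
    have h := extD_smul (0 : ℝ) (0 : FormSec n M 0)
    rw [zero_smul, zero_smul] at h
    exact h
  | k + 2 => exact extD_extD (hα k).smooth

lemma IsAdapted.locMix_mixedD (h : F.IsAdapted e Ω K) (hα : α ∈ F.BasicForms) (hy : y ∈ Ω) :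
    locMix (mixedD α) e y = extDerivMix (locMix α e) y := by
  ext k : 1
  cases k with
  | zero => exact ContinuousAlternatingMap.ext fun v => rfl
  | succ k => exact localRep_extD (hα k).smooth h.mem_atlas (h.subset hy)

end Foliation

/-! ### The Lefschetz operators on basic forms -/

namespace Foliation

open MixedSec

variable {n c : ℕ} {M : Type*} [TopologicalSpace M]
    [ChartedSpace (EuclideanSpace ℝ (Fin n)) M]
    {T₀ : Type*} [TopologicalSpace T₀]
    [ChartedSpace (EuclideanSpace ℝ (Fin c)) T₀] {ι : Type*}

section Operators

variable (F : Foliation n c M T₀ ι) (σ : FormSec n M 2)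

/-- A frame of the normal bundle at `x`. -/
def frameAt (x : M) :
    NormalFrame (F.tangent x) (Fin (Module.finrank ℝ (TangentSpace (𝓡 n) x ⧸ F.tangent x))) :=
  FibreAlg.normalFrame (F.tangent x)

/-- The fibrewise application of a family of operators. -/
def fibrewise (T : ∀ x : M, Module.End ℝ (ExtForms (TangentSpace (𝓡 n) x))) :
    Module.End ℝ (MixedSec n M) where
  toFun α k x := degPart k (T x (ev x α))
  map_add' α β := by
    funext k x
    rw [map_add, map_add, map_add]
    rfl
  map_smul' r α := by
    funext k x
    rw [map_smul, map_smul, map_smul]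
    rfl

/-- Exterior multiplication with `σ`. -/
def lefschetz : Module.End ℝ (MixedSec n M) := fibrewise fun x => (F.frameAt x).lef (σ x)

/-- The contraction dual to exterior multiplication with `σ`. -/
def dualLefschetz : Module.End ℝ (MixedSec n M) := fibrewise fun x => (F.frameAt x).lam (σ x)

/-- Multiplication of the component of degree `k` by `c k`. -/
def scale (c : ℕ → ℝ) : Module.End ℝ (MixedSec n M) := fibrewise fun _ => scaleDeg c

end Operators

variable [IsManifold (𝓡 n) ∞ M] [IsManifold (𝓡 c) ∞ T₀]
    {F : Foliation n c M T₀ ι} {σ : FormSec n M 2} {e : OpenPartialHomeomorph M (EuclideanSpace ℝ (Fin n))}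
    {Ω : Set (EuclideanSpace ℝ (Fin n))} {K : Submodule ℝ (EuclideanSpace ℝ (Fin n))}
    {y : EuclideanSpace ℝ (Fin n)} {k : ℕ} {α : MixedSec n M}

omit [IsManifold (𝓡 n) ∞ M] [IsManifold (𝓡 c) ∞ T₀] in
lemma IsSymplectic.isFibreSymplectic (hσ : F.IsSymplectic σ) (x : M) :
    IsFibreSymplectic (F.tangent x) (σ x) where
  flat_eq_zero v hv := by
    ext u
    rw [flat_apply]
    exact hσ.basic.horizontal x _ ⟨0, hv⟩
  mem_of_flat v hv := hσ.nondegenerate x v fun u => by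
    rw [← flat_apply, hv]
    rfl

omit [IsManifold (𝓡 n) ∞ M] [IsManifold (𝓡 c) ∞ T₀] in
lemma scale_mem (hα : α ∈ F.BasicForms) (c : ℕ → ℝ) : scale c α ∈ F.BasicForms :=
  fun k => (hα k).smul (c k)

namespace IsAdapted

lemma isFibreSymplectic_localRep (h : F.IsAdapted e Ω K) (hσ : F.IsSymplectic σ) (hy : y ∈ Ω) :
    IsFibreSymplectic K (localRep σ e y) := by
  obtain ⟨B, hB, -⟩ := h.exists_inverse hy
  exact (hσ.isFibreSymplectic _).of_comap hB (h.eq_comap hy)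

lemma extDeriv_localRep (h : F.IsAdapted e Ω K) (hσ : F.IsSymplectic σ) (hy : y ∈ Ω) :
    extDeriv (localRep σ e) y = 0 := by
  rw [← localRep_extD hσ.basic.smooth h.mem_atlas (h.subset hy), hσ.closed]
  rfl

lemma locMix_lefschetz (h : F.IsAdapted e Ω K) (hσ : F.IsSymplectic σ) (hy : y ∈ Ω)
    (α : MixedSec n M) : locMix (F.lefschetz σ α) e y =
      (FibreAlg.normalFrame K).lef (localRep σ e y) (locMix α e y) := by
  obtain ⟨B, hB, -⟩ := h.exists_inverse hy
  exact pb_lef_eq _ _ hB (h.eq_comap hy) (hσ.isFibreSymplectic _) _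

lemma locMix_dualLefschetz (h : F.IsAdapted e Ω K) (hσ : F.IsSymplectic σ) (hy : y ∈ Ω)
    (hα : α ∈ F.BasicForms) : locMix (F.dualLefschetz σ α) e y =
      (FibreAlg.normalFrame K).lam (localRep σ e y) (locMix α e y) := by
  obtain ⟨B, hB, -⟩ := h.exists_inverse hy
  exact pb_lam_eq _ _ hB (h.eq_comap hy) (hσ.isFibreSymplectic _) (ev_mem_horForms hα _)

end IsAdapted

lemma locBasic_congr {α β : EuclideanSpace ℝ (Fin n) → ExtForms (EuclideanSpace ℝ (Fin n))}
    (hΩ : IsOpen Ω) (h : LocBasic K Ω α) (hαβ : ∀ y ∈ Ω, β y = α y) : LocBasic K Ω β where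
  hor y hy := hαβ y hy ▸ h.hor y hy
  basic k := (h.basic k).congr hΩ fun y hy => congrArg (degPart k) (hαβ y hy)

lemma lefschetz_mem (hσ : F.IsSymplectic σ) (hα : α ∈ F.BasicForms) :
    F.lefschetz σ α ∈ F.BasicForms :=
  mem_basicForms_of_locBasic fun _ _ _ h => locBasic_congr h.isOpen
    (NormalFrame.locBasic_lef _ (h.basicOn_localRep hσ.basic) h.isOpen (h.locBasic hα))
    fun _ hy => h.locMix_lefschetz hσ hy α

lemma dualLefschetz_mem (hσ : F.IsSymplectic σ) (hα : α ∈ F.BasicForms) :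
    F.dualLefschetz σ α ∈ F.BasicForms :=
  mem_basicForms_of_locBasic fun _ _ _ h => locBasic_congr h.isOpen
    (NormalFrame.locBasic_lam _ (h.basicOn_localRep hσ.basic) h.isOpen (h.locBasic hα)
      fun _ hy => h.isFibreSymplectic_localRep hσ hy)
    fun _ hy => h.locMix_dualLefschetz hσ hy hα

/-- The one place where closedness of σ gives [L, d] = 0. The identity is checked in an adapted
chart and carried back by the inverse of the chart derivative. -/
lemma lefschetz_mixedD (hσ : F.IsSymplectic σ) (hα : α ∈ F.BasicForms) :
    F.lefschetz σ (mixedD α) = mixedD (F.lefschetz σ α) := by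
  refine ext_ev fun x => ?_
  obtain ⟨e, Ω, K, h, y, hy, rfl⟩ := F.exists_isAdapted x
  obtain ⟨B, hB, -⟩ := h.exists_inverse hy
  have key : locMix (F.lefschetz σ (mixedD α)) e y = locMix (mixedD (F.lefschetz σ α)) e y := by
    rw [h.locMix_lefschetz hσ hy, h.locMix_mixedD hα hy, h.locMix_mixedD (lefschetz_mem hσ hα) hy,
      ← NormalFrame.extDerivMix_lef _ h.isOpen (h.basicOn_localRep hσ.basic)
        (fun _ hz => h.isFibreSymplectic_localRep hσ hz) hy (h.extDeriv_localRep hσ hy)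
        fun k => ((h.locBasic hα).basic k).differentiableAt h.isOpen hy]
    exact extDerivMix_congr (Filter.eventually_of_mem (h.isOpen.mem_nhds hy)
      fun z hz => (h.locMix_lefschetz hσ hz α).symm)
  have := congrArg (pb B) key
  rwa [locMix, locMix, pb_pb_of_comp_eq_id hB, pb_pb_of_comp_eq_id hB] at this

end Foliation

/-! ### The operators `d`, `d^Λ` and the double complex -/

section Commutators

variable {A : Type*} [Ring A] [Algebra ℝ A] {l m h d : A}

lemma commute_commutator (hm : IsNilpotent m) (hlm : l * m - m * l = h)
    (hhm : h * m - m * h = (-2 : ℝ) • m) (hhd : h * d - d * h = d) (hld : l * d = d * l) :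
    m * (d * m - m * d) = (d * m - m * d) * m := by
  have h1 := commute_commutator_of_sl2 (l := l) (m := m) (h := h) (d := d) hm
    (by rw [LieRing.of_associative_ring_bracket, hlm])
    (by rw [LieRing.of_associative_ring_bracket, hhm])
    (by rw [LieRing.of_associative_ring_bracket, hhd])
    (by rw [LieRing.of_associative_ring_bracket, hld, sub_self])
  rw [LieRing.of_associative_ring_bracket, LieRing.of_associative_ring_bracket, sub_eq_zero] at h1
  rw [← neg_sub (m * d), mul_neg, h1, neg_mul]

/-- By the Jacobi identity [l, [d, m]] = [d, [l, m]] = [d, h] = -d. -/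
lemma mul_commutator (hlm : l * m - m * l = h) (hhd : h * d - d * h = d) (hld : l * d = d * l) :
    l * (d * m - m * d) = (d * m - m * d) * l - d := by
  have h1 : l * (d * m - m * d) - (d * m - m * d) * l =
      (l * d - d * l) * m - m * (l * d - d * l) + d * (l * m - m * l) - (l * m - m * l) * d := by
    noncomm_ring
  rw [hld, sub_self, hlm, zero_mul, mul_zero, sub_zero, zero_add, ← neg_sub (h * d), hhd] at h1
  rw [sub_eq_iff_eq_add.1 h1]
  abel

lemma anticommute_commutator (hdd : d * d = 0) :
    d * (d * m - m * d) + (d * m - m * d) * d = 0 := by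
  have h1 : d * (d * m - m * d) + (d * m - m * d) * d = (d * d) * m - m * (d * d) := by
    noncomm_ring
  rw [h1, hdd, zero_mul, mul_zero, sub_zero]

/-- The bracket of `m` with the relation dδ + δd = 0 leaves 2δ² = 0, because δ commutes with `m`. -/
lemma commutator_mul_self (hdd : d * d = 0)
    (hm : m * (d * m - m * d) = (d * m - m * d) * m) :
    (d * m - m * d) * (d * m - m * d) = 0 := by
  set δ := d * m - m * d with hδ
  have h1 : d * δ + δ * d = 0 := anticommute_commutator hdd
  have h2 : ∀ x : A, x * (d * m - m * d) + (d * m - m * d) * x = (d * x + x * d) * m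
      - m * (d * x + x * d) + (m * x - x * m) * d + d * (m * x - x * m) := fun x => by
    noncomm_ring
  have h3 := h2 δ
  rw [← hδ, h1, hm, sub_self, zero_mul, mul_zero, zero_mul, mul_zero, sub_zero, add_zero, add_zero,
    ← two_smul ℝ] at h3
  exact (smul_eq_zero.1 h3).resolve_left two_ne_zero

end Commutators

/-- The total sign in d^Λ: the star in degree k, the star in degree l + 1, the factor (-1)^{k+1} of
the definition, and W² = (-1)^{k+q}. -/
lemma even_choose_add_choose {k l q : ℕ} (h : k + l = 2 * q) :
    Even ((k + 1).choose 2 + (l + 2).choose 2 + (k + 1) + (k + q)) := by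
  have hA : (k + 1).choose 2 = (k + 1) * k / 2 := Nat.choose_two_right _
  have hB : (l + 2).choose 2 = (l + 2) * (l + 1) / 2 := Nat.choose_two_right _
  obtain ⟨m, hm | hm⟩ := Nat.even_or_odd' k
  · obtain ⟨p, rfl⟩ : ∃ p, l = 2 * p := ⟨q - m, by omega⟩
    obtain rfl : q = m + p := by omega
    rw [hA, hB, hm, show (2 * m + 1) * (2 * m) = 2 * ((2 * m + 1) * m) by ring,
      show (2 * p + 2) * (2 * p + 1) = 2 * ((p + 1) * (2 * p + 1)) by ring,
      Nat.mul_div_cancel_left _ two_pos, Nat.mul_div_cancel_left _ two_pos]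
    exact ⟨m * m + 3 * m + p * p + 2 * p + 1, by ring⟩
  · obtain ⟨p, rfl⟩ : ∃ p, l = 2 * p + 1 := ⟨q - m - 1, by omega⟩
    obtain rfl : q = m + p + 1 := by omega
    rw [hA, hB, hm, show (2 * m + 1 + 1) * (2 * m + 1) = 2 * ((m + 1) * (2 * m + 1)) by ring,
      show (2 * p + 1 + 2) * (2 * p + 1 + 1) = 2 * ((2 * p + 3) * (p + 1)) by ring,
      Nat.mul_div_cancel_left _ two_pos, Nat.mul_div_cancel_left _ two_pos]
    exact ⟨m * m + 4 * m + p * p + 3 * p + 4, by ring⟩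

namespace Foliation

open MixedSec

variable {n c : ℕ} {M : Type*} [TopologicalSpace M]
    [ChartedSpace (EuclideanSpace ℝ (Fin n)) M] [IsManifold (𝓡 n) ∞ M]
    {T₀ : Type*} [TopologicalSpace T₀]
    [ChartedSpace (EuclideanSpace ℝ (Fin c)) T₀] [IsManifold (𝓡 c) ∞ T₀] {ι : Type*}

/-! ### The operators on basic forms -/

section General

variable (F : Foliation n c M T₀ ι) {σ : FormSec n M 2}

/-- The additive group of basic forms. -/
@[reducible]
def basicFormsAddCommGroup : AddCommGroup F.BasicForms := inferInstance

attribute [local instance] basicFormsAddCommGroup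

/-- The additive monoid of basic forms. -/
@[reducible]
def basicFormsAddCommMonoid : AddCommMonoid F.BasicForms := AddCommGroup.toAddCommMonoid

attribute [local instance] basicFormsAddCommMonoid

/-- The vector space of basic forms. -/
@[reducible]
def basicFormsModule : Module ℝ F.BasicForms := Submodule.module F.BasicForms

attribute [local instance] basicFormsModule

/-- The value of a basic form at a point. -/
def evB (x : M) : F.BasicForms →ₗ[ℝ] ExtForms (TangentSpace (𝓡 n) x) :=
  ev x ∘ₗ F.BasicForms.subtype

/-- The exterior derivative of basic forms. -/
def basicD : Module.End ℝ F.BasicForms where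
  toFun α := ⟨mixedD α.1, mixedD_mem α.2⟩
  map_add' α β := by
    refine Subtype.ext (funext fun k => ?_)
    cases k with
    | zero => exact (add_zero (0 : FormSec n M 0)).symm
    | succ k => exact extD_add (α.2 k).smooth (β.2 k).smooth
  map_smul' r α := by
    refine Subtype.ext (funext fun k => ?_)
    cases k with
    | zero => exact (smul_zero (A := FormSec n M 0) r).symm
    | succ k => exact extD_smul r (α.1 k)

/-- Multiplication of the component of degree `k` of a basic form by `a k`. -/
def basicScale (a : ℕ → ℝ) : Module.End ℝ F.BasicForms :=
  (scale a).restrict fun _ hα => scale_mem hα a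

variable {F}

lemma ext_evB {α β : F.BasicForms} (h : ∀ x, F.evB x α = F.evB x β) : α = β :=
  Subtype.ext (ext_ev h)

lemma evB_mem (α : F.BasicForms) (x : M) : F.evB x α ∈ horForms (F.tangent x) :=
  ev_mem_horForms α.2 x

lemma evB_basicScale (a : ℕ → ℝ) (x : M) (α : F.BasicForms) :
    F.evB x (F.basicScale a α) = scaleDeg a (F.evB x α) := rfl

lemma basicD_basicD : F.basicD * F.basicD = 0 :=
  LinearMap.ext fun α => Subtype.ext (mixedD_mixedD α.2)

lemma basicScale_basicD (a : ℕ → ℝ) (α : F.BasicForms) :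
    F.basicScale a (F.basicD α) = F.basicD (F.basicScale (fun k => a (k + 1)) α) := by
  refine Subtype.ext (funext fun k => ?_)
  cases k with
  | zero => exact smul_zero (A := FormSec n M 0) (a 0)
  | succ k => exact (extD_smul (a (k + 1)) (α.1 k)).symm

lemma basicScale_basicScale (a b : ℕ → ℝ) (α : F.BasicForms) :
    F.basicScale a (F.basicScale b α) = F.basicScale (fun k => a k * b k) α :=
  Subtype.ext (funext fun k => smul_smul (a k) (b k) (α.1 k))

lemma card_frameAt (x : M) :
    Fintype.card (Fin (Module.finrank ℝ (TangentSpace (𝓡 n) x ⧸ F.tangent x))) = c := by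
  rw [Fintype.card_fin, F.finrank_quotient_tangent]

lemma degPart_evB_eq_zero (α : F.BasicForms) (x : M) {k : ℕ} (hk : c < k) :
    degPart k (F.evB x α) = 0 :=
  (F.frameAt x).apply_eq_zero_of_card_lt (evB_mem α x) (by rwa [card_frameAt])

/-- Basic forms vanish above the codimension, so signs written with truncated subtraction need to
agree only up to it. -/
lemma basicScale_congr {a b : ℕ → ℝ} (h : ∀ k ≤ c, a k = b k) (α : F.BasicForms) :
    F.basicScale a α = F.basicScale b α := by
  refine ext_evB fun x => ?_
  ext k : 1
  rw [evB_basicScale, evB_basicScale, degPart_scaleDeg, degPart_scaleDeg]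
  by_cases hk : k ≤ c
  · rw [h k hk]
  · rw [degPart_evB_eq_zero α x (by omega), smul_zero, smul_zero]

lemma basicScale_one (α : F.BasicForms) : F.basicScale (fun _ => 1) α = α :=
  Subtype.ext (funext fun k => one_smul ℝ (α.1 k))

lemma mem_basicDeg_iff {j : ℤ} {α : F.BasicForms} :
    α ∈ F.basicDeg j ↔ ∀ x, F.evB x α ∈ degForms (TangentSpace (𝓡 n) x) j :=
  ⟨fun h x k hk => congrFun (h k hk) x, fun h k hk => funext fun x => h x k hk⟩

lemma basicD_mem_basicDeg {j : ℤ} {α : F.BasicForms} (h : α ∈ F.basicDeg j) :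
    F.basicD α ∈ F.basicDeg (j + 1) := by
  intro k hk
  cases k with
  | zero => rfl
  | succ k =>
    have h1 : α.1 k = 0 := h k (by push_cast at hk; omega)
    change extD (α.1 k) = 0
    have h2 := extD_smul (0 : ℝ) (0 : FormSec n M k)
    rw [zero_smul, zero_smul] at h2
    rw [h1, h2]

variable (hσ : F.IsSymplectic σ)

/-- Exterior multiplication with the symplectic form, on basic forms. -/
def IsSymplectic.basicLef : Module.End ℝ F.BasicForms :=
  (F.lefschetz σ).restrict fun _ hα => lefschetz_mem hσ hα

/-- The dual Lefschetz operator on basic forms. -/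
def IsSymplectic.basicLam : Module.End ℝ F.BasicForms :=
  (F.dualLefschetz σ).restrict fun _ hα => dualLefschetz_mem hσ hα

/-- The Weyl element of the Lefschetz `sl₂` on basic forms. -/
def IsSymplectic.basicWeyl : Module.End ℝ F.BasicForms := weyl (n + 1) hσ.basicLef hσ.basicLam

/-- The commutator of `d` with the dual Lefschetz operator. -/
def IsSymplectic.basicDΛ : Module.End ℝ F.BasicForms :=
  F.basicD * hσ.basicLam - hσ.basicLam * F.basicD

namespace IsSymplectic

lemma evB_basicLef (x : M) (α : F.BasicForms) :
    F.evB x (hσ.basicLef α) = (F.frameAt x).lef (σ x) (F.evB x α) := rfl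

lemma evB_basicLam (x : M) (α : F.BasicForms) :
    F.evB x (hσ.basicLam α) = (F.frameAt x).lam (σ x) (F.evB x α) := rfl

lemma finrank_tangentSpace (x : M) : Module.finrank ℝ (TangentSpace (𝓡 n) x) = n :=
  finrank_euclideanSpace_fin

lemma evB_basicWeyl (x : M) (α : F.BasicForms) :
    F.evB x (hσ.basicWeyl α) = (F.frameAt x).weylOp (σ x) (F.evB x α) := by
  rw [basicWeyl, weyl_apply_of_intertwine (F.evB x) (hσ.evB_basicLef x) (hσ.evB_basicLam x),
    NormalFrame.weylOp, finrank_tangentSpace]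

lemma basicLef_pow : hσ.basicLef ^ (n + 1) = 0 := by
  refine LinearMap.ext fun α => ext_evB fun x => ?_
  have h : ∀ m : ℕ, F.evB x ((hσ.basicLef ^ m) α) = ((F.frameAt x).lef (σ x) ^ m) (F.evB x α) := by
    intro m
    induction m with
    | zero => rfl
    | succ m ih => rw [pow_succ', pow_succ', Module.End.mul_apply, evB_basicLef, ih]; rfl
  have h0 := NormalFrame.lef_pow_eq_zero (D := F.frameAt x) (w := σ x)
  rw [finrank_tangentSpace] at h0
  rw [h, h0]
  exact (map_zero _).symm

lemma basicLam_pow : hσ.basicLam ^ (n + 1) = 0 := by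
  refine LinearMap.ext fun α => ext_evB fun x => ?_
  have h : ∀ m : ℕ, F.evB x ((hσ.basicLam ^ m) α) = ((F.frameAt x).lam (σ x) ^ m) (F.evB x α) := by
    intro m
    induction m with
    | zero => rfl
    | succ m ih => rw [pow_succ', pow_succ', Module.End.mul_apply, evB_basicLam, ih]; rfl
  have h0 := NormalFrame.lam_pow_eq_zero (D := F.frameAt x) (w := σ x)
  rw [finrank_tangentSpace] at h0
  rw [h, h0]
  exact (map_zero _).symm

lemma basicLef_mul_basicD : hσ.basicLef * F.basicD = F.basicD * hσ.basicLef :=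
  LinearMap.ext fun α => Subtype.ext (lefschetz_mixedD hσ α.2)

lemma basicLef_mem_basicDeg {j : ℤ} {α : F.BasicForms} (h : α ∈ F.basicDeg j) :
    hσ.basicLef α ∈ F.basicDeg (j + 2) :=
  mem_basicDeg_iff.2 fun x => NormalFrame.lef_mem_degForms (mem_basicDeg_iff.1 h x)

lemma basicLam_mem_basicDeg {j : ℤ} {α : F.BasicForms} (h : α ∈ F.basicDeg j) :
    hσ.basicLam α ∈ F.basicDeg (j - 2) :=
  mem_basicDeg_iff.2 fun x => NormalFrame.lam_mem_degForms (mem_basicDeg_iff.1 h x)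

lemma basicLam_basicScale (a : ℕ → ℝ) (α : F.BasicForms) :
    hσ.basicLam (F.basicScale a α) = F.basicScale (fun k => a (k + 2)) (hσ.basicLam α) :=
  ext_evB fun x => NormalFrame.lam_scaleDeg a _

end IsSymplectic

end General

end Foliation

/-- Basic forms are a product over all degrees; that only the degrees in the finite set `s` can be
nonzero makes this product a direct sum. -/
lemma isInternal_of_components {V : Type*} [AddCommGroup V] [Module ℝ V] {𝒱 : ℤ → Submodule ℝ V}
    (P : ℤ → Module.End ℝ V) (hP : ∀ j x, P j x ∈ 𝒱 j) (hid : ∀ j, ∀ x ∈ 𝒱 j, P j x = x)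
    (h0 : ∀ i j, i ≠ j → ∀ x ∈ 𝒱 j, P i x = 0) (s : Finset ℤ) 
    (hs : ∀ x, (∀ j ∈ s, P j x = 0) → x = 0) :
    DirectSum.IsInternal 𝒱 := by
  have key : ∀ (i : ℤ) (α : ⨁ j, 𝒱 j), P i (DirectSum.coeAddMonoidHom 𝒱 α) = α i := by
    intro i α
    induction α using DirectSum.induction_on with
    | zero => simp
    | of j β =>
      rw [DirectSum.coeAddMonoidHom_of]
      by_cases hij : i = j
      · subst hij
        rw [DirectSum.of_eq_same, hid _ _ β.2]
      · rw [DirectSum.of_eq_of_ne _ _ _ hij, h0 _ _ hij _ β.2]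
        rfl
    | add α β hα hβ => rw [map_add, map_add, hα, hβ]; rfl
  constructor
  · rw [injective_iff_map_eq_zero]
    intro α hα
    refine DFinsupp.ext fun j => Subtype.ext ?_
    rw [← key, hα, map_zero]
    rfl
  · intro x
    set β := ∑ j ∈ s, DirectSum.of (fun j => 𝒱 j) j ⟨P j x, hP j x⟩ with hβ
    refine ⟨β, sub_eq_zero.1 (hs _ fun i hi => ?_)⟩
    rw [map_sub, key, hβ, DFinsupp.finsetSum_apply, Finset.sum_eq_single_of_mem i hi fun j _ hj =>
      DirectSum.of_eq_of_ne _ _ _ hj.symm, DirectSum.of_eq_same, sub_self]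

lemma isBidifferential_of_components {V : Type*} [AddCommGroup V] [Module ℝ V]
    {𝒱 : ℤ → Submodule ℝ V} {d δ : V →ₗ[ℝ] V} {a b : ℤ}
    (P : ℤ → V →ₗ[ℝ] V) (hP : ∀ j x, P j x ∈ 𝒱 j) (hid : ∀ j, ∀ x ∈ 𝒱 j, P j x = x)
    (h0 : ∀ i j, i ≠ j → ∀ x ∈ 𝒱 j, P i x = 0) (s : Finset ℤ)
    (hs : ∀ x, (∀ j ∈ s, P j x = 0) → x = 0) (hd : ∀ j x, x ∈ 𝒱 j → d x ∈ 𝒱 (j + a))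
    (hδ : ∀ j x, x ∈ 𝒱 j → δ x ∈ 𝒱 (j + b)) (hdd : ∀ x, d (d x) = 0) (hδδ : ∀ x, δ (δ x) = 0)
    (hdδ : ∀ x, d (δ x) + δ (d x) = 0) : IsBidifferential 𝒱 d δ a b :=
  ⟨isInternal_of_components P hP hid h0 s hs, hd, hδ, hdd, hδδ, hdδ⟩

namespace Foliation

open MixedSec

variable {n q : ℕ} {M : Type*} [TopologicalSpace M]
    [ChartedSpace (EuclideanSpace ℝ (Fin n)) M] [IsManifold (𝓡 n) ∞ M]
    {T₀ : Type*} [TopologicalSpace T₀]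
    [ChartedSpace (EuclideanSpace ℝ (Fin (2 * q))) T₀] [IsManifold (𝓡 (2 * q)) ∞ T₀] {ι : Type*}
    {F : Foliation n (2 * q) M T₀ ι} {σ : FormSec n M 2}

/-! ### The commutation relations and the identification of d^Λ -/

section Relations

attribute [local instance] basicFormsAddCommGroup
attribute [local instance] basicFormsAddCommMonoid
attribute [local instance] basicFormsModule

namespace IsSymplectic

variable (hσ : F.IsSymplectic σ)

lemma basicWeyl_basicScale (a : ℕ → ℝ) (α : F.BasicForms) :
    hσ.basicWeyl (F.basicScale a α) = F.basicScale (fun l => a (2 * q - l)) (hσ.basicWeyl α) :=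
  ext_evB fun x => by
    rw [evB_basicWeyl, evB_basicScale, evB_basicScale, evB_basicWeyl]
    exact NormalFrame.degPart_weylOp_scaleDeg (hσ.isFibreSymplectic x) (card_frameAt x)
      (evB_mem α x) a

lemma basicWeyl_basicWeyl (α : F.BasicForms) :
    hσ.basicWeyl (hσ.basicWeyl α) = F.basicScale (fun k => (-1 : ℝ) ^ (k + q)) α :=
  ext_evB fun x => by
    rw [evB_basicWeyl, evB_basicWeyl, evB_basicScale]
    exact NormalFrame.weylOp_weylOp_eq_scaleDeg (hσ.isFibreSymplectic x) (card_frameAt x)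
      (evB_mem α x)

lemma basicLef_mul_basicLam : hσ.basicLef * hσ.basicLam - hσ.basicLam * hσ.basicLef =
    F.basicScale fun k => (k : ℝ) - q :=
  LinearMap.ext fun α => ext_evB fun x =>
    NormalFrame.lef_lam_sub (hσ.isFibreSymplectic x) (card_frameAt x) (evB_mem α x)

lemma basicScale_mul_basicLam : (F.basicScale fun k => (k : ℝ) - q) * hσ.basicLam -
    hσ.basicLam * (F.basicScale fun k => (k : ℝ) - q) = (-2 : ℝ) • hσ.basicLam := by
  refine LinearMap.ext fun α => ?_
  rw [LinearMap.sub_apply, Module.End.mul_apply, Module.End.mul_apply, basicLam_basicScale]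
  refine Subtype.ext (funext fun k => ?_)
  set β := hσ.basicLam α
  change ((k : ℝ) - q) • β.1 k - (((k + 2 : ℕ) : ℝ) - q) • β.1 k = (-2 : ℝ) • β.1 k
  push_cast
  module

lemma basicScale_mul_basicD : (F.basicScale fun k => (k : ℝ) - q) * F.basicD -
    F.basicD * (F.basicScale fun k => (k : ℝ) - q) = F.basicD := by
  refine LinearMap.ext fun α => ?_
  rw [LinearMap.sub_apply, Module.End.mul_apply, Module.End.mul_apply, basicScale_basicD, ← map_sub]
  refine congrArg F.basicD (Subtype.ext (funext fun k => ?_))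
  change (((k + 1 : ℕ) : ℝ) - q) • α.1 k - ((k : ℝ) - q) • α.1 k = α.1 k
  push_cast
  module

/-- Obtained from representation theory alone: d has weight 1 and commutes with `L`, and `Λ` is
nilpotent. -/
lemma basicLam_mul_basicDΛ : hσ.basicLam * hσ.basicDΛ = hσ.basicDΛ * hσ.basicLam :=
  commute_commutator ⟨_, hσ.basicLam_pow⟩ hσ.basicLef_mul_basicLam hσ.basicScale_mul_basicLam
    basicScale_mul_basicD hσ.basicLef_mul_basicD

lemma basicLef_mul_basicDΛ : hσ.basicLef * hσ.basicDΛ = hσ.basicDΛ * hσ.basicLef - F.basicD :=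
  mul_commutator hσ.basicLef_mul_basicLam basicScale_mul_basicD hσ.basicLef_mul_basicD

lemma basicLam_mul_basicD : hσ.basicLam * F.basicD = F.basicD * hσ.basicLam - hσ.basicDΛ := by
  rw [basicDΛ, sub_sub_cancel]

lemma basicD_mul_basicDΛ : F.basicD * hσ.basicDΛ + hσ.basicDΛ * F.basicD = 0 :=
  anticommute_commutator basicD_basicD

lemma basicDΛ_mul_basicDΛ : hσ.basicDΛ * hσ.basicDΛ = 0 :=
  commutator_mul_self basicD_basicD hσ.basicLam_mul_basicDΛ

/-- The pair (d, δ) satisfies the same relations as an exterior product and its dual contraction, so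
W conjugates d into δ. -/
lemma basicWeyl_mul_basicD : hσ.basicWeyl * F.basicD = hσ.basicDΛ * hσ.basicWeyl :=
  weyl_mul_left hσ.basicLef_pow hσ.basicLam_pow hσ.basicLef_mul_basicD hσ.basicLam_mul_basicD
    hσ.basicLef_mul_basicDΛ hσ.basicLam_mul_basicDΛ

lemma basicDΛ_mem_basicDeg {j : ℤ} {α : F.BasicForms} (h : α ∈ F.basicDeg j) :
    hσ.basicDΛ α ∈ F.basicDeg (j - 1) := by
  have h1 := basicD_mem_basicDeg (hσ.basicLam_mem_basicDeg h)
  have h2 := hσ.basicLam_mem_basicDeg (basicD_mem_basicDeg h)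
  rw [show j - 2 + 1 = j - 1 by ring] at h1
  rw [show j + 1 - 2 = j - 1 by ring] at h2
  exact Submodule.sub_mem _ h1 h2

lemma starOp_eq (α : F.BasicForms) : F.starOp q σ α.1 =
    (hσ.basicWeyl (F.basicScale (fun k => (-1 : ℝ) ^ ((k + 1).choose 2)) α)).1 := by
  funext l x
  change _ = degPart l (F.evB x _)
  rw [evB_basicWeyl, evB_basicScale]
  have hw := hσ.isFibreSymplectic x
  have hα := evB_mem α x
  by_cases hl : l ≤ 2 * q
  · have hkl : 2 * q - l + l = 2 * q := Nat.sub_add_cancel hl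
    rw [NormalFrame.degPart_weylOp hw (card_frameAt x) (scaleDeg_mem hα _) hkl, degPart_scaleDeg,
      map_smul, map_smul, map_smul]
    refine (dif_pos hl).trans ?_
    exact FibreAlg.star_eq hw (F.finrank_quotient_tangent x) hkl
      ((mem_horForms_iff _).1 hα (2 * q - l))
  · refine (dif_neg hl).trans ?_
    rw [(F.frameAt x).apply_eq_zero_of_card_lt (NormalFrame.weylOp_mem (scaleDeg_mem hα _))
      (by rw [card_frameAt]; omega)]

lemma symplecticD_eq (α : F.BasicForms) : F.symplecticD q σ α.1 = (hσ.basicDΛ α).1 := by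
  set s : ℕ → ℝ := fun k => (-1 : ℝ) ^ ((k + 1).choose 2) with hs
  have h1 : F.symplecticD q σ α.1 = (hσ.basicWeyl (F.basicScale s (F.basicD (hσ.basicWeyl
      (F.basicScale s (F.basicScale (fun k => (-1 : ℝ) ^ (k + 1)) α)))))).1 := by
    rw [← starOp_eq]
    change _ = F.starOp q σ (mixedD (hσ.basicWeyl _).1)
    rw [← starOp_eq]
    rfl
  -- Moving W past d leaves δ applied to W² with a product of signs; it remains to see that this
  -- factor is the identity.
  rw [h1, basicScale_basicD, ← Module.End.mul_apply, basicWeyl_mul_basicD, Module.End.mul_apply]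
  congr 2
  have h2 : ∀ β : F.BasicForms, F.basicScale (fun k => s (k + 1)) (hσ.basicWeyl β) =
      hσ.basicWeyl (F.basicScale (fun k => s (2 * q - k + 1)) β) := fun β => by
    rw [basicWeyl_basicScale]
    exact basicScale_congr (fun k hk => by rw [Nat.sub_sub_self hk]) _
  rw [h2, basicWeyl_basicWeyl, basicScale_basicScale, basicScale_basicScale, basicScale_basicScale]
  refine (basicScale_congr (fun k hk => ?_) α).trans (basicScale_one α)
  obtain ⟨m, hm⟩ := even_choose_add_choose (Nat.add_sub_cancel' hk)
  rw [hs, ← pow_add, ← pow_add, ← pow_add, (by rw [show 2 * q - k + 1 + 1 = 2 * q - k + 2 from rfl]; omega : k + q + (2 * q - k + 1 + 1).choose 2 +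
    (k + 1).choose 2 + (k + 1) = m + m), ← two_mul, pow_mul, neg_one_sq, one_pow]

end IsSymplectic

end Relations

theorem IsSymplectic.exists_operators (hσ : F.IsSymplectic σ) :
    ∃ d dΛ : F.BasicForms →ₗ[ℝ] F.BasicForms,
      (∀ α : F.BasicForms, (d α : MixedSec n M) = mixedD α) ∧
      (∀ α : F.BasicForms, (dΛ α : MixedSec n M) = F.symplecticD q σ α) ∧
      ∃ h : IsBidifferential (R := ℝ) (V := F.BasicForms) F.basicDeg d dΛ 1 (-1),
        (Doub h).first.DegeneratesAt 1 ∧ (Doub h).second.DegeneratesAt 1 := by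
  -- The projections onto the homogeneous components; they are zero outside the degrees from 0 to
  -- 2q.
  let P : ℤ → Module.End ℝ F.BasicForms := fun j =>
    F.basicScale fun k => if (k : ℤ) = j then 1 else 0
  have hP : ∀ j α, P j α ∈ F.basicDeg j := fun j α k hk => by
    change (if (k : ℤ) = j then (1 : ℝ) else 0) • α.1 k = 0
    rw [if_neg hk, zero_smul]
  have hid : ∀ j, ∀ α ∈ F.basicDeg j, P j α = α := fun j α hα =>
    Subtype.ext (funext fun k => by
      change (if (k : ℤ) = j then (1 : ℝ) else 0) • α.1 k = α.1 k
      split_ifs with hk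
      · rw [one_smul]
      · rw [hα k hk, smul_zero])
  have h0 : ∀ i j, i ≠ j → ∀ α ∈ F.basicDeg j, P i α = 0 := fun i j hij α hα =>
    Subtype.ext (funext fun k => by
      change (if (k : ℤ) = i then (1 : ℝ) else 0) • α.1 k = 0
      split_ifs with hk
      · rw [hα k (hk ▸ hij), smul_zero]
      · rw [zero_smul])
  have hs : ∀ α, (∀ j ∈ Finset.Icc (0 : ℤ) (2 * q : ℕ), P j α = 0) → α = 0 := fun α h =>
    Subtype.ext (funext fun k => by
      by_cases hk : k ≤ 2 * q
      · have h1 := congrFun (congrArg Subtype.val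
          (h k (Finset.mem_Icc.2 ⟨by omega, by exact_mod_cast hk⟩))) k
        change (if (k : ℤ) = k then (1 : ℝ) else 0) • α.1 k = 0 at h1
        rwa [if_pos rfl, one_smul] at h1
      · exact funext fun x => degPart_evB_eq_zero α x (by omega))
  have h : IsBidifferential (R := ℝ) (V := F.BasicForms) F.basicDeg F.basicD hσ.basicDΛ 1 (-1) :=
    isBidifferential_of_components P hP hid h0 _ hs
      (fun _ _ hx => basicD_mem_basicDeg hx) (fun _ _ hx => hσ.basicDΛ_mem_basicDeg hx)
      (fun x => LinearMap.congr_fun basicD_basicD x)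
      (fun x => LinearMap.congr_fun hσ.basicDΛ_mul_basicDΛ x)
      fun x => LinearMap.congr_fun hσ.basicD_mul_basicDΛ x
  exact ⟨F.basicD, hσ.basicDΛ, fun _ => rfl, fun α => (hσ.symplecticD_eq α).symm, h,
    Doub.first_degeneratesAt_one h hσ.basicLef (fun j x hx => hσ.basicLef_mem_basicDeg hx)
      hσ.basicLef_pow (fun x => LinearMap.congr_fun hσ.basicLef_mul_basicD x)
      fun x => LinearMap.congr_fun hσ.basicLef_mul_basicDΛ x,
    Doub.second_degeneratesAt_one h hσ.basicLam (fun j x hx => hσ.basicLam_mem_basicDeg hx)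
      hσ.basicLam_pow (fun x => LinearMap.congr_fun hσ.basicLam_mul_basicD x)
      fun x => LinearMap.congr_fun hσ.basicLam_mul_basicDΛ x⟩

end Foliation

end

theorem mainTheorem3 (n q : ℕ) {M : Type*} [TopologicalSpace M]
    [ChartedSpace (EuclideanSpace ℝ (Fin n)) M] [IsManifold (𝓡 n) ∞ M]
    {T₀ : Type*} [TopologicalSpace T₀] [ChartedSpace (EuclideanSpace ℝ (Fin (2 * q))) T₀]
    [IsManifold (𝓡 (2 * q)) ∞ T₀] {ι : Type*} (F : Foliation n (2 * q) M T₀ ι)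
    (σ : FormSec n M 2) (hσ : F.IsSymplectic σ) :
    ∃ d dΛ : F.BasicForms →ₗ[ℝ] F.BasicForms,
      (∀ α : F.BasicForms, (d α : MixedSec n M) = mixedD α) ∧
      (∀ α : F.BasicForms, (dΛ α : MixedSec n M) = F.symplecticD q σ α) ∧
      ∃ h : IsBidifferential (R := ℝ) (V := F.BasicForms) F.basicDeg d dΛ 1 (-1),
        (Doub h).first.DegeneratesAt 1 ∧ (Doub h).second.DegeneratesAt 1 :=
  hσ.exists_operators
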